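/- Let $W$ be a complex vector space of dimension $6$, let $\mathbb G\subset\mathbb P(\wedge^3W)$ be the Grassmannian of planes of $\mathbb P(W)=\mathbb P^5$, and let $u=[\wedge^3U]\in\mathbb G$ be the point given by a $3$-dimensional subspace $U\subset W$. For $0\le i\le 3$ let $W^i_u\subset\wedge^3W$ be the image of $\wedge^iU\otimes\wedge^{3-i}W$. Let $A\subset\wedge^3W$ be a Lagrangian subspace for the wedge pairing $\wedge^3W\times\wedge^3W\to\wedge^6W\cong\mathbb C$, with $\wedge^3U\subset A$, and assume that the scheme $F_A:=\mathbb P(A)\cdot\mathbb G$ (scheme-theoretic intersection in $\mathbb P(\wedge^3W)$) is finite and smooth at $u$. Let $P_u=\mathbb P(U)\cong\mathbb P^2$ and let $P_u^\perp\cong\mathbb P^2$ be the net of hyperplanes of $\mathbb P(W)$ through $P_u$. The Segre embedding $s:P_u\times P_u^\perp\to\mathbb P(W^1_u/W^2_u)=\mathbb P^8$ sends $([x],H)$, where $H=U+\langle h_2,h_3\rangle$, to the class of $x\wedge h_2\wedge h_3$. Let $u_1,u_2,u_3$ be any basis of $U$, with corresponding coordinates $(x_1:x_2:x_3)$ on $P_u$,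 and let $e_1,e_2,e_3\in W$ be any vectors inducing a basis of $W/U$; let $(y_1:y_2:y_3)$ be the coordinates on $P_u^\perp$ such that the hyperplane with coordinates $y$ contains $U$ and has an equation taking the values $y_j$ on $e_j$. Put $T_{ij}=u_i\wedge e_{j+1}\wedge e_{j+2}$ (indices mod $3$) and choose $a_{ij}\in A$ with $a_{ij}-T_{ij}\in W^2_u$ (such elements exist, and are unique modulo $\wedge^3U$). Let $V_A\subset P_u\times P_u^\perp$ be defined by $f=0$, where $$f=\sum_{i,j,k,l}\,(T_{ij}\wedge a_{kl})\;x_iy_jx_ky_l .$$ Then: 1. $f$ is a nonzero form of bidegree $(2,2)$, so that $V_A$ is a hypersurface of bidegree $(2,2)$. 2. The singular scheme $\operatorname{Sing}V_A$ (the scheme of points of $V_A$ at which every tangent vector to $P_u\times P_u^\perp$ is tangent to $V_A$) is the closed subscheme of $P_u\times P_u^\perp$ defined by the six partial derivatives $\partial f/\partial x_i$, $\partial f/\partial y_i$, $i=1,2,3$. 3. The tangential projection $\mathbb P(W^1_u)\dashrightarrow\mathbb P(W^1_u/W^2_u)$, restricted to $F_A-\{u\}$, factors through $s$ and induces an isomorphism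 of schemes $F_A-\{u\}\;\cong\;\operatorname{Sing}V_A$. -/

import Mathlib

open CategoryTheory Module
open scoped TensorProduct

noncomputable section

namespace Morin

universe v

/-! Schemes over `ℂ` are represented by their functors of points on commutative `ℂ`-algebras;
closed and open subschemes are subfunctors, and an isomorphism of schemes is an isomorphism of
functors of points.  `Module.Grassmannian.functor ℂ V k` is the Grassmannian of linear subspaces of
*codimension* `k` in `V`: its `R`-points are the submodules of `R ⊗ V` whose quotient is projective
of constant rank `k`.  The exterior algebra of `R ⊗ W` is taken to be `R ⊗ ⋀ W`. -/

section BaseChange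

theorem ker_baseChange_mkQ {R S : Type} [CommRing R] [CommRing S] [Algebra R S]
    {M P : Type v} [AddCommGroup M] [Module R M] [AddCommGroup P] [Module S P]
    (c : S ⊗[R] M ≃ₗ[S] P) (φ : M → P)
    (hc : ∀ x, c (1 ⊗ₜ[R] x) = φ x) (N : Submodule R M) :
    LinearMap.ker (N.mkQ.baseChange S ∘ₗ c.symm.toLinearMap) =
      Submodule.span S (φ '' (N : Set M)) := by
  have hex : Function.Exact (N.subtype.lTensor S) (N.mkQ.lTensor S) :=
    lTensor_exact S (LinearMap.exact_subtype_mkQ N) (Submodule.mkQ_surjective N)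
  have hmem : ∀ z : S ⊗[R] M, c z ∈ LinearMap.ker (N.mkQ.baseChange S ∘ₗ c.symm.toLinearMap) ↔
      N.mkQ.lTensor S z = 0 := by
    intro z
    rw [LinearMap.mem_ker, LinearMap.comp_apply,
      LinearEquiv.coe_coe, LinearEquiv.symm_apply_apply, LinearMap.baseChange_eq_ltensor]
  apply le_antisymm
  · intro z hz
    obtain ⟨z, rfl⟩ := c.surjective z
    obtain ⟨t, rfl⟩ := (hex _).1 ((hmem z).1 hz)
    clear hz
    induction t using TensorProduct.induction_on with
    | zero => simp
    | tmul s n =>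
      have h1 : (s ⊗ₜ[R] (n : M)) = s • ((1 : S) ⊗ₜ[R] (n : M)) := by
        rw [TensorProduct.smul_tmul', smul_eq_mul, mul_one]
      rw [LinearMap.lTensor_tmul, Submodule.subtype_apply, h1, map_smul, hc]
      exact Submodule.smul_mem _ _ (Submodule.subset_span ⟨_, n.2, rfl⟩)
    | add x y hx hy => rw [map_add, map_add]; exact add_mem hx hy
  · rw [Submodule.span_le]
    rintro _ ⟨n, hn, rfl⟩
    rw [SetLike.mem_coe, ← hc, hmem, LinearMap.lTensor_tmul, Submodule.mkQ_apply,
      (Submodule.Quotient.mk_eq_zero _).2 hn, TensorProduct.tmul_zero]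

variable {V : Type v} [AddCommGroup V] [Module ℂ V]
variable {R S : Type} [CommRing R] [Algebra ℂ R] [CommRing S] [Algebra ℂ S]

theorem cancelBaseChange_one_tmul [Algebra R S] [IsScalarTower ℂ R S] (g : R →ₗ[ℂ] S)
    (hg : ∀ r, g r = algebraMap R S r) (x : R ⊗[ℂ] V) :
    TensorProduct.AlgebraTensorModule.cancelBaseChange ℂ R S S V (1 ⊗ₜ[R] x) =
      g.rTensor V x := by
  induction x using TensorProduct.induction_on with
  | zero => simp
  | tmul r m =>
    rw [TensorProduct.AlgebraTensorModule.cancelBaseChange_tmul,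
      LinearMap.rTensor_tmul, Algebra.smul_def, mul_one, hg]
  | add x y hx hy => rw [TensorProduct.tmul_add, map_add, hx, hy, map_add]

/-- The submodule attached to the pullback of a point of a Grassmannian along `R → S` is spanned by
the image of the original submodule. -/
theorem toSubmodule_map {k : ℕ} (f : R →ₐ[ℂ] S) (N : Grassmannian R (R ⊗[ℂ] V) k) :
    (Grassmannian.map f N).toSubmodule =
      Submodule.span S (f.toLinearMap.rTensor V '' (N.toSubmodule : Set (R ⊗[ℂ] V))) := by
  let : Algebra R S := f.toAlgebra
  let : IsScalarTower ℂ R S :=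
    IsScalarTower.of_algebraMap_eq' <| IsScalarTower.algebraMap_eq ℂ R S
  rw [Grassmannian.map_toSubmodule]
  exact ker_baseChange_mkQ (TensorProduct.AlgebraTensorModule.cancelBaseChange ℂ R S S V) _
    (cancelBaseChange_one_tmul f.toLinearMap fun _ => rfl) N.toSubmodule

end BaseChange

section Exterior

variable {W : Type v} [AddCommGroup W] [Module ℂ W]

/-- `A ⊆ ⋀³ W` is Lagrangian for the wedge pairing `⋀³ W × ⋀³ W → ⋀⁶ W`: it equals its own
orthogonal. -/
def IsLagrangian (A : Submodule ℂ (ExteriorAlgebra ℂ W)) : Prop :=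
  A ≤ ⋀[ℂ]^3 W ∧ ∀ a ∈ ⋀[ℂ]^3 W, a ∈ A ↔ ∀ b ∈ A, a * b = 0

/-- The image of `⋀ⁱ U × ⋀³⁻ⁱ W → ⋀³ W`, for `i ≤ 3`. -/
def filt (U : Submodule ℂ W) (i : ℕ) : Submodule ℂ (ExteriorAlgebra ℂ W) :=
  U.map (ExteriorAlgebra.ι ℂ) ^ i * ⋀[ℂ]^(3 - i) W

variable (R : Type) [CommRing R] [Algebra ℂ R]

/-- The submodule `⋀ⁿ N` of `⋀ⁿ (R ⊗ W)` spanned by the products of `n` elements of `N`. -/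
def wedgePow (n : ℕ) (N : Submodule R (R ⊗[ℂ] W)) : Submodule R (R ⊗[ℂ] ExteriorAlgebra ℂ W) :=
  N.map ((ExteriorAlgebra.ι ℂ).baseChange R) ^ n

variable {R} {S : Type} [CommRing S] [Algebra ℂ S]

theorem wedgePow_map_le {k n : ℕ} (f : R →ₐ[ℂ] S) (N : Grassmannian R (R ⊗[ℂ] W) k)
    (A : Submodule ℂ (ExteriorAlgebra ℂ W))
    (h : wedgePow R n N.toSubmodule ≤ A.baseChange R) :
    wedgePow S n (Grassmannian.map f N).toSubmodule ≤ A.baseChange S := by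
  let g : R ⊗[ℂ] ExteriorAlgebra ℂ W →ₐ[ℂ] S ⊗[ℂ] ExteriorAlgebra ℂ W :=
    Algebra.TensorProduct.map f (AlgHom.id ℂ _)
  have hg : ∀ x : R ⊗[ℂ] W, (ExteriorAlgebra.ι ℂ).baseChange S (f.toLinearMap.rTensor W x) =
      g ((ExteriorAlgebra.ι ℂ).baseChange R x) := by
    intro x
    induction x using TensorProduct.induction_on with
    | zero => simp
    | tmul r m => simp [g]
    | add x y hx hy => simp only [map_add, hx, hy]
  have hA : ∀ a ∈ A.baseChange R, g a ∈ A.baseChange S := by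
    rintro _ ⟨t, rfl⟩
    induction t using TensorProduct.induction_on with
    | zero => simp
    | tmul r m =>
      simp only [LinearMap.baseChange_tmul, g, Algebra.TensorProduct.map_tmul]
      exact Submodule.tmul_mem_baseChange_of_mem _ m.2
    | add x y hx hy => rw [map_add, map_add]; exact add_mem hx hy
  unfold wedgePow at *
  rw [toSubmodule_map, Submodule.map_span, Submodule.span_pow, Submodule.span_le]
  have hset : ((ExteriorAlgebra.ι ℂ).baseChange S '' (f.toLinearMap.rTensor W ''
      (N.toSubmodule : Set (R ⊗[ℂ] W)))) =
      g '' (N.toSubmodule.map ((ExteriorAlgebra.ι ℂ).baseChange R) : Set _) := by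
    ext z; constructor
    · rintro ⟨_, ⟨n, hn, rfl⟩, rfl⟩
      exact ⟨_, ⟨n, hn, rfl⟩, (hg n).symm⟩
    · rintro ⟨_, ⟨n, hn, rfl⟩, rfl⟩
      exact ⟨_, ⟨n, hn, rfl⟩, hg n⟩
  rw [hset, ← Set.image_pow]
  rintro _ ⟨z, hz, rfl⟩
  exact hA z (h (Submodule.pow_subset_pow _ hz))

end Exterior

section Schemes

/-- The Grassmannian of linear subspaces of codimension `k` in `V`. -/
abbrev Gr (V : Type v) [AddCommGroup V] [Module ℂ V] (k : ℕ) : CommAlgCat.{0} ℂ ⥤ Type v :=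
  Grassmannian.functor (R := ℂ) (M := V) k

variable {W : Type v} [AddCommGroup W] [Module ℂ W]

/-- The scheme `F_A = ℙ(A) · 𝔾`, where `𝔾` is the Grassmannian of three-dimensional subspaces of the
six-dimensional space `W`: it consists of the `Λ` with `⋀³ Λ ⊆ A`. -/
def schemeF (A : Submodule ℂ (ExteriorAlgebra ℂ W)) :
    Subfunctor (Gr W 3) where
  obj R := {Λ | wedgePow R 3 Λ.toSubmodule ≤ A.baseChange R}
  map f _ hΛ := wedgePow_map_le f.hom _ A hΛ

/-- The open subscheme `F_A - {u}`, where `u` is the point `U` of `𝔾`: those points of `F_A` which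
are different from `u` over every field-valued point of the base. -/
def schemeFMinus (A : Submodule ℂ (ExteriorAlgebra ℂ W)) (U : Submodule ℂ W) :
    Subfunctor (Gr W 3) where
  obj R := {Λ | Λ ∈ (schemeF A).obj R ∧ ∀ (K : CommAlgCat.{0} ℂ) (f : R ⟶ K), IsField K →
    ((Gr W 3).map f Λ).toSubmodule ≠ U.baseChange K}
  map f Λ hΛ := ⟨(schemeF A).map f hΛ.1, fun K g hK => by
    have h := hΛ.2 K (f ≫ g) hK
    rw [Functor.map_comp] at h
    exact h⟩

/-- `F_A` is finite: being a projective scheme over `ℂ`, this means that it has finitely many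
complex points. -/
def FiniteF (A : Submodule ℂ (ExteriorAlgebra ℂ W)) : Prop :=
  ((schemeF A).obj (CommAlgCat.of ℂ ℂ)).Finite

/-- The Zariski tangent space of `F_A` at `u` is zero: the only `ℂ[ε]`-point of `F_A` over `u` is the
constant one.  When `u` is a point of `F_A` and `F_A` is finite, this says that `F_A` is smooth
at `u`. -/
def TangentZeroAt (A : Submodule ℂ (ExteriorAlgebra ℂ W)) (U : Submodule ℂ W) : Prop :=
  ∀ Λ ∈ (schemeF A).obj (CommAlgCat.of ℂ (DualNumber ℂ)),
    (Grassmannian.map (TrivSqZeroExt.fstHom ℂ ℂ ℂ) Λ).toSubmodule = U.baseChange ℂ →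
      Λ.toSubmodule = U.baseChange (DualNumber ℂ)

/-- `ℙ² × ℙ² = P_u × P_u^⊥`: pairs of a line in `U` and a hyperplane of `W / U`, that is, a
hyperplane of `W` containing `U`. -/
abbrev planeProd (U : Submodule ℂ W) : CommAlgCat.{0} ℂ ⥤ Type v :=
  FunctorToTypes.prod (Gr U 2) (Gr (W ⧸ U) 1)

variable {U : Submodule ℂ W} (u : Basis (Fin 3) ℂ U) (e : Basis (Fin 3) ℂ (W ⧸ U))

/-- `(x₁ : x₂ : x₃) × (y₁ : y₂ : y₃)` are homogeneous coordinates of the `R`-point `p` of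
`P_u × P_u^⊥`: the line is generated by `∑ xᵢ uᵢ`, and the hyperplane has the equation `y`, whose
coefficients with respect to `e` are the `yⱼ`. -/
def IsCoord {R : CommAlgCat.{0} ℂ} (p : (planeProd U).obj R) (x y : Fin 3 → R) : Prop :=
  p.1.toSubmodule = Submodule.span R {∑ i, x i ⊗ₜ[ℂ] u i} ∧
    Ideal.span (Set.range y) = ⊤ ∧
    p.2.toSubmodule = LinearMap.ker ((e.baseChange R).constr R y)

/-- The closed subscheme of `P_u × P_u^⊥` cut out by a set of bihomogeneous forms.  Points have
homogeneous coordinates only locally, hence the quantification over `R → S`. -/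
def zeroScheme (s : Set (MvPolynomial (Fin 3 ⊕ Fin 3) ℂ)) : Subfunctor (planeProd U) where
  obj R := {p | ∀ (S : CommAlgCat.{0} ℂ) (f : R ⟶ S) (x y : Fin 3 → S),
    IsCoord u e ((planeProd U).map f p) x y → ∀ g ∈ s, MvPolynomial.aeval (Sum.elim x y) g = 0}
  map f p hp S g x y h := hp S (f ≫ g) x y (by rw [Functor.map_comp]; exact h)

/-- The dual number `x + ε v`. -/
def addEps {R : Type} [CommRing R] (x v : R) : DualNumber R :=
  TrivSqZeroExt.inl x + TrivSqZeroExt.inr v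

/-- The singular scheme of the hypersurface `f = 0` in `P_u × P_u^⊥`: the points all of whose
first order deformations `(x + ε v, y + ε w)` satisfy `f = 0`, that is, the points of the
hypersurface at which every tangent vector of `P_u × P_u^⊥` is tangent to the hypersurface. -/
def singScheme (f : MvPolynomial (Fin 3 ⊕ Fin 3) ℂ) : Subfunctor (planeProd U) where
  obj R := {p | ∀ (S : CommAlgCat.{0} ℂ) (h : R ⟶ S) (x y : Fin 3 → S),
    IsCoord u e ((planeProd U).map h p) x y → ∀ v w : Fin 3 → S,
      MvPolynomial.aeval
        (Sum.elim (fun i => addEps (x i) (v i)) fun j => addEps (y j) (w j)) f = 0}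
  map f p hp S g x y h := hp S (f ≫ g) x y (by rw [Functor.map_comp]; exact h)

/-- A vector of `W` lifting the basis vector `eⱼ` of `W / U`. -/
def liftVec (j : Fin 3) : W := Function.surjInv U.mkQ_surjective (e j)

/-- The trivector `uᵢ ∧ e_{j+1} ∧ e_{j+2}` (indices mod 3).  The hyperplane with coefficients `y`
corresponds to the bivector `∑ⱼ yⱼ e_{j+1} ∧ e_{j+2}` of `⋀² (W / U)`. -/
def segreVec (i j : Fin 3) : ExteriorAlgebra ℂ W :=
  ExteriorAlgebra.ι ℂ (u i : W) * ExteriorAlgebra.ι ℂ (liftVec e (j + 1)) *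
    ExteriorAlgebra.ι ℂ (liftVec e (j + 2))

/-- An element `a = a₁ + a₂ + a₃` of `A` with first component `a₁ = uᵢ ∧ e_{j+1} ∧ e_{j+2}`, where
`a₂ + a₃` lies in the image of `⋀² U × W`. -/
def segreLift (A : Submodule ℂ (ExteriorAlgebra ℂ W)) (i j : Fin 3) : ExteriorAlgebra ℂ W :=
  Classical.epsilon fun a => a ∈ A ∧ a - segreVec u e i j ∈ filt U 2

/-- The identification `⋀⁶ W → ℂ` given by a volume form, extended by zero to the other degrees. -/
def topForm (vol : W [⋀^Fin 6]→ₗ[ℂ] ℂ) : ExteriorAlgebra ℂ W →ₗ[ℂ] ℂ :=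
  ExteriorAlgebra.liftAlternating (Pi.single 6 vol)

/-- The equation `v_A` of `V_A` in the coordinates `(x, y)`: the form `a₁ ∧ a = a₁ ∧ a₂`, where
`a = a₁ + a₂ + a₃ ∈ A` has first component `a₁ = ∑ xᵢ yⱼ uᵢ ∧ e_{j+1} ∧ e_{j+2}`. -/
def verraForm (A : Submodule ℂ (ExteriorAlgebra ℂ W)) (vol : W [⋀^Fin 6]→ₗ[ℂ] ℂ) :
    MvPolynomial (Fin 3 ⊕ Fin 3) ℂ :=
  ∑ i, ∑ j, ∑ k, ∑ l,
    MvPolynomial.C (topForm vol (segreVec u e i j * segreLift u e A k l)) *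
      (MvPolynomial.X (Sum.inl i) * MvPolynomial.X (Sum.inr j) *
        (MvPolynomial.X (Sum.inl k) * MvPolynomial.X (Sum.inr l)))

/-- `f` is bihomogeneous of bidegree `d` in the `x` and the `y` variables. -/
def IsBihomogeneous (f : MvPolynomial (Fin 3 ⊕ Fin 3) ℂ) (d : ℕ × ℕ) : Prop :=
  MvPolynomial.IsWeightedHomogeneous (Sum.elim (fun _ => ((1, 0) : ℕ × ℕ)) fun _ => (0, 1)) f d

/-- `p = (ℓ, H)` is the tangential projection of `Λ` from `u`: the class of `⋀³ Λ` modulo the image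
of `⋀² U × W` is the Segre image `ℓ ∧ ⋀² H` of `p`. -/
def IsTangentialProjection {R : CommAlgCat.{0} ℂ} (Λ : (Gr W 3).obj R)
    (p : (planeProd U).obj R) : Prop :=
  wedgePow R 3 Λ.toSubmodule ⊔ (filt U 2).baseChange R =
    wedgePow R 1 (p.1.toSubmodule.map (U.subtype.baseChange R)) *
      wedgePow R 2 (p.2.toSubmodule.comap (U.mkQ.baseChange R)) ⊔ (filt U 2).baseChange R

end Schemes

end Morin

end

/-! Lift a basis of `W ⧸ U` to span a complement `E` of `U`. Then `⋀³ W = ⋀³ U ⊕ (⋀² U ⊗ E) ⊕ (U ⊗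
⋀² E) ⊕ ⋀³ E`, and the wedge pairing couples the outer two summands and the inner two. Since `⋀³ U ⊆
A`, the Lagrangian `A` has no component in `⋀³ E`. First order deformations of `u` in the
Grassmannian form `Hom (U, W / U) = ⋀² U ⊗ E`, and those lying in `A` are tangent to `F_A`;
smoothness at `u` therefore gives `A ∩ W²_u = ⋀³ U` (`TangentZeroAt.isTransversal`). By duality `A`
is, modulo `⋀³ U`, the graph of a symmetric map `G : U ⊗ ⋀² E → ⋀² U ⊗ E` (`exists_symmetric_form`),
and `f` is a nonzero multiple of `G (x ⊗ y, x ⊗ y)`. Its partial derivatives are, up to a nonzero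
constant, the contractions of `G (x ⊗ y)` with `x` and with `y`.

Let `Λ` be a point of `F_A`, with `ℓ = Λ ∩ U` and `H` its image in `W / U`. The missing `⋀³ E`
component forces `H` to have rank at most two, and the graph condition shows that over a field a
smaller rank occurs only for `Λ = U` (`InGraph.snd_eq_zero`). Away from `u`, then, `ℓ` is a line and
`H` a plane. For `x` in `ℓ` and `m + h`, `m' + h'` in `Λ` the graph condition reads `h ⊗ (m' ∧ x) +
h' ⊗ (x ∧ m) = G (x ⊗ h ∧ h')` (`InGraph.eq_contr`). The left side is annihilated by `x` and by the
equation `y` of `H`, so `(ℓ, H)` is a singular point. Conversely, at a singular point this equation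
can be solved for `m` and `m'` uniquely modulo `ℓ` (`InGraph.le`, `map_snd_reconstruct`,
`inGraph_reconstruct`). Modulo `W²_u` only the component in `U ⊗ ⋀² E` of `⋀³ Λ` remains, and it is
`ℓ ⊗ ⋀² H`; so the bijection is the tangential projection.

The argument runs over an arbitrary `ℂ`-algebra `R`, which gives an isomorphism of schemes and not
only of points. Instead of choosing local generators, lines and planes in `R³` are handled through
cross products whose coordinates generate the unit ideal. Finally `f ≠ 0`: otherwise every point of
`P_u × P_u^⊥` would be singular and `F_A` would be infinite. -/

noncomputable section

namespace Morin

universe v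

open scoped Matrix

/-! ### Products of three vectors of `U ⊕ E` -/

section Expansion

/-- The coefficients in `U ⊗ ⋀² E` of the product of the three vectors `aᵢ + bᵢ` of `U ⊕ E`. -/
def mix {R : Type*} [CommRing R] (a₁ b₁ a₂ b₂ a₃ b₃ : Fin 3 → R) (i j : Fin 3) : R :=
  a₁ i * (b₂ ⨯₃ b₃) j + a₂ i * (b₃ ⨯₃ b₁) j + a₃ i * (b₁ ⨯₃ b₂) j

variable {R 𝒜 : Type*} [CommRing R] [Ring 𝒜] [Algebra R 𝒜]

theorem sum_smul_mul_sum_smul (p : Fin 3 → 𝒜) (hp : ∀ i, p i * p i = 0)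
    (hp' : ∀ i j, p i * p j = -(p j * p i)) (a b : Fin 3 → R) :
    (∑ i, a i • p i) * (∑ i, b i • p i) = ∑ k, (a ⨯₃ b) k • (p (k + 1) * p (k + 2)) := by
  simp only [Fin.sum_univ_three, mul_add, add_mul, smul_mul_smul_comm, hp, cross_apply, smul_zero]
  rw [hp' 1 0, hp' 2 1, hp' 2 0]
  simp
  rw [hp' 2 0]
  module

theorem mul_mul_eq_ite (p : Fin 3 → 𝒜) (hp : ∀ i, p i * p i = 0)
    (hp' : ∀ i j, p i * p j = -(p j * p i)) (i k : Fin 3) :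
    p i * (p (k + 1) * p (k + 2)) = if i = k then p 0 * p 1 * p 2 else 0 := by
  have h1 : ∀ i (z : 𝒜), p i * (p i * z) = 0 := fun i z => by rw [← mul_assoc, hp, zero_mul]
  have h2 : ∀ i j, p i * (p j * p i) = 0 := fun i j => by
    rw [hp' j i, mul_neg, h1, neg_zero]
  have h3 : p 1 * (p 2 * p 0) = p 0 * p 1 * p 2 := by
    rw [hp' 2 0, mul_neg, ← mul_assoc, hp' 1 0, neg_mul, neg_neg]
  have h4 : p 2 * (p 0 * p 1) = p 0 * p 1 * p 2 := by
    rw [← mul_assoc, hp' 2 0, neg_mul, mul_assoc, hp' 2 1, mul_neg, neg_neg, mul_assoc]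
  fin_cases i <;> fin_cases k <;> simp [h1, h2, h3, h4, mul_assoc]

theorem sum_smul_mul_mul (p : Fin 3 → 𝒜) (hp : ∀ i, p i * p i = 0)
    (hp' : ∀ i j, p i * p j = -(p j * p i)) (a b c : Fin 3 → R) :
    (∑ i, a i • p i) * ((∑ i, b i • p i) * (∑ i, c i • p i)) =
      (a ⬝ᵥ b ⨯₃ c) • (p 0 * p 1 * p 2) := by
  rw [sum_smul_mul_sum_smul p hp hp' b c]
  simp only [Finset.sum_mul_sum, smul_mul_smul_comm, mul_mul_eq_ite p hp hp', smul_ite, smul_zero,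
    Finset.sum_ite_eq, Finset.mem_univ, if_true, dotProduct, Finset.sum_smul]

/-- Sorting by the number of factors from each triple gives the four summands. Writing each mixed
term with its indices in cyclic order absorbs all signs, so the two middle coefficients are the same
function `mix` with the roles of `a` and `b` exchanged. -/
theorem mul_mul_expansion (p q : Fin 3 → 𝒜) (hp : ∀ i, p i * p i = 0)
    (hp' : ∀ i j, p i * p j = -(p j * p i)) (hq : ∀ i, q i * q i = 0)
    (hq' : ∀ i j, q i * q j = -(q j * q i)) (hpq : ∀ i j, q j * p i = -(p i * q j))
    (a₁ b₁ a₂ b₂ a₃ b₃ : Fin 3 → R) :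
    (∑ i, a₁ i • p i + ∑ i, b₁ i • q i) * (∑ i, a₂ i • p i + ∑ i, b₂ i • q i) *
      (∑ i, a₃ i • p i + ∑ i, b₃ i • q i) =
    (a₁ ⬝ᵥ a₂ ⨯₃ a₃) • (p 0 * p 1 * p 2) +
      ∑ k, ∑ l, mix b₁ a₁ b₂ a₂ b₃ a₃ l k • (p (k + 1) * p (k + 2) * q l) +
      ∑ i, ∑ j, mix a₁ b₁ a₂ b₂ a₃ b₃ i j • (p i * q (j + 1) * q (j + 2)) +
      (b₁ ⬝ᵥ b₂ ⨯₃ b₃) • (q 0 * q 1 * q 2) := by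
  have hc : ∀ a b : Fin 3 → R, (∑ i, b i • q i) * (∑ i, a i • p i) =
      -((∑ i, a i • p i) * (∑ i, b i • q i)) := by
    intro a b
    simp only [Finset.sum_mul_sum, smul_mul_smul_comm, hpq]
    rw [Finset.sum_comm]
    simp only [smul_neg, Finset.sum_neg_distrib, mul_comm]
  have hppq : ∀ a a' b : Fin 3 → R, (∑ i, a i • p i) * ((∑ i, a' i • p i) * (∑ i, b i • q i)) =
      ∑ k, ∑ l, ((a ⨯₃ a') k * b l) • (p (k + 1) * p (k + 2) * q l) := by
    intro a a' b
    rw [← mul_assoc, sum_smul_mul_sum_smul p hp hp']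
    simp only [Finset.sum_mul_sum, smul_mul_smul_comm]
  have hpqq : ∀ a b b' : Fin 3 → R, (∑ i, a i • p i) * ((∑ i, b i • q i) * (∑ i, b' i • q i)) =
      ∑ k, ∑ l, (a k * (b ⨯₃ b') l) • (p k * q (l + 1) * q (l + 2)) := by
    intro a b b'
    rw [sum_smul_mul_sum_smul q hq hq']
    simp only [Finset.sum_mul_sum, smul_mul_smul_comm, mul_assoc]
  have e1 := sum_smul_mul_mul p hp hp' a₁ a₂ a₃
  have e2 := sum_smul_mul_mul q hq hq' b₁ b₂ b₃
  have e3 := hppq a₁ a₂ b₃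
  have e4 := hppq a₃ a₁ b₂
  have e5 := hppq a₂ a₃ b₁
  have e6 := hpqq a₁ b₂ b₃
  have e7 := hpqq a₂ b₃ b₁
  have e8 := hpqq a₃ b₁ b₂
  have hS : ∑ k, ∑ l, mix b₁ a₁ b₂ a₂ b₃ a₃ l k • (p (k + 1) * p (k + 2) * q l) =
      ∑ k, ∑ l, ((a₁ ⨯₃ a₂) k * b₃ l) • (p (k + 1) * p (k + 2) * q l) +
      ∑ k, ∑ l, ((a₃ ⨯₃ a₁) k * b₂ l) • (p (k + 1) * p (k + 2) * q l) +
      ∑ k, ∑ l, ((a₂ ⨯₃ a₃) k * b₁ l) • (p (k + 1) * p (k + 2) * q l) := by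
    simp only [← Finset.sum_add_distrib, ← add_smul, mix]
    refine Finset.sum_congr rfl fun k _ => Finset.sum_congr rfl fun l _ => ?_
    congr 1; ring
  have hT : ∑ i, ∑ j, mix a₁ b₁ a₂ b₂ a₃ b₃ i j • (p i * q (j + 1) * q (j + 2)) =
      ∑ k, ∑ l, (a₁ k * (b₂ ⨯₃ b₃) l) • (p k * q (l + 1) * q (l + 2)) +
      ∑ k, ∑ l, (a₂ k * (b₃ ⨯₃ b₁) l) • (p k * q (l + 1) * q (l + 2)) +
      ∑ k, ∑ l, (a₃ k * (b₁ ⨯₃ b₂) l) • (p k * q (l + 1) * q (l + 2)) := by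
    simp only [← Finset.sum_add_distrib, ← add_smul, mix]
  rw [hS, hT, ← e1, ← e2, ← e3, ← e4, ← e5, ← e6, ← e7, ← e8]
  have cp : ∀ a a' : Fin 3 → R, (∑ i, a i • p i) * (∑ i, a' i • p i) =
      -((∑ i, a' i • p i) * (∑ i, a i • p i)) := fun a a' => by
    rw [sum_smul_mul_sum_smul p hp hp', sum_smul_mul_sum_smul p hp hp', ← cross_anticomm,
      ← Finset.sum_neg_distrib]
    simp
  have cq : ∀ a a' : Fin 3 → R, (∑ i, a i • q i) * (∑ i, a' i • q i) =
      -((∑ i, a' i • q i) * (∑ i, a i • q i)) := fun a a' => by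
    rw [sum_smul_mul_sum_smul q hq hq', sum_smul_mul_sum_smul q hq hq', ← cross_anticomm,
      ← Finset.sum_neg_distrib]
    simp
  have k1 := hc a₁ b₂; have k2 := hc a₁ b₃; have k3 := hc a₂ b₁; have k4 := hc a₂ b₃
  have k5 := hc a₃ b₁; have k6 := hc a₃ b₂
  have m1 := cp a₃ a₁; have m2 := cq b₃ b₁
  have k7 := hc a₂ b₁
  generalize ∑ i, a₁ i • p i = A₁ at *
  generalize ∑ i, a₂ i • p i = A₂ at *
  generalize ∑ i, a₃ i • p i = A₃ at *
  generalize ∑ i, b₁ i • q i = B₁ at *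
  generalize ∑ i, b₂ i • q i = B₂ at *
  generalize ∑ i, b₃ i • q i = B₃ at *
  -- The four mixed products that are not yet in the cyclic order used in `e3`–`e8`.
  have n1 : B₁ * (A₂ * A₃) = A₂ * (A₃ * B₁) := by
    rw [← mul_assoc, k3, neg_mul, mul_assoc, k5, mul_neg, neg_neg]
  have n2 : B₁ * (B₂ * A₃) = A₃ * (B₁ * B₂) := by
    rw [k6, mul_neg, ← mul_assoc, k5, neg_mul, neg_neg, mul_assoc]
  have n3 : B₁ * (A₂ * B₃) = A₂ * (B₃ * B₁) := by
    rw [← mul_assoc, k3, m2, neg_mul, mul_neg, mul_assoc]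
  have n4 : A₁ * (B₂ * A₃) = A₃ * (A₁ * B₂) := by
    rw [k6, mul_neg, ← mul_assoc, ← mul_assoc, m1, neg_mul]
  simp only [add_mul, mul_add, mul_assoc, n1, n2, n3, n4]
  abel

end Expansion

/-! ### The wedge pairing on trivectors -/

section Products

variable {R 𝒜 : Type*} [CommRing R] [Ring 𝒜] [Algebra R 𝒜]

/-- The six elements `pᵢ`, `qⱼ` anticommute with each other and have square zero. -/
structure AnticommutingTriples (p q : Fin 3 → 𝒜) : Prop where
  sq_left : ∀ i, p i * p i = 0
  swap_left : ∀ i j, p i * p j = -(p j * p i)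
  sq_right : ∀ i, q i * q i = 0
  swap_right : ∀ i j, q i * q j = -(q j * q i)
  swap : ∀ i j, q j * p i = -(p i * q j)

/-- The element of `⋀³ (U ⊕ E)` with the given coordinates in the four summands. -/
def trivector (p q : Fin 3 → 𝒜) (s₀ : R) (s t : Fin 3 → Fin 3 → R) (t₀ : R) : 𝒜 :=
  s₀ • (p 0 * p 1 * p 2) + ∑ k, ∑ l, s k l • (p (k + 1) * p (k + 2) * q l) +
    ∑ i, ∑ j, t i j • (p i * q (j + 1) * q (j + 2)) + t₀ • (q 0 * q 1 * q 2)

namespace AnticommutingTriples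

variable {p q : Fin 3 → 𝒜}

/-- Lets identities proved once for abstract triples serve both in `⋀ W` and in `R ⊗ ⋀ W`. -/
theorem map {ℬ : Type*} [Ring ℬ] (h : AnticommutingTriples p q) (φ : 𝒜 →+* ℬ) :
    AnticommutingTriples (fun i => φ (p i)) fun j => φ (q j) where
  sq_left i := by rw [← map_mul, h.sq_left, map_zero]
  swap_left i j := by rw [← map_mul, ← map_mul, h.swap_left, map_neg]
  sq_right i := by rw [← map_mul, h.sq_right, map_zero]
  swap_right i j := by rw [← map_mul, ← map_mul, h.swap_right, map_neg]
  swap i j := by rw [← map_mul, ← map_mul, h.swap, map_neg]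

theorem symm (h : AnticommutingTriples p q) : AnticommutingTriples q p where
  sq_left := h.sq_right
  swap_left := h.swap_right
  sq_right := h.sq_left
  swap_right := h.swap_left
  swap i j := by rw [h.swap, neg_neg]

theorem mul_mul_eq_trivector (h : AnticommutingTriples p q) (a₁ b₁ a₂ b₂ a₃ b₃ : Fin 3 → R) :
    (∑ i, a₁ i • p i + ∑ i, b₁ i • q i) * (∑ i, a₂ i • p i + ∑ i, b₂ i • q i) *
      (∑ i, a₃ i • p i + ∑ i, b₃ i • q i) =
    trivector p q (a₁ ⬝ᵥ a₂ ⨯₃ a₃) (fun k l => mix b₁ a₁ b₂ a₂ b₃ a₃ l k)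
      (mix a₁ b₁ a₂ b₂ a₃ b₃) (b₁ ⬝ᵥ b₂ ⨯₃ b₃) :=
  mul_mul_expansion p q h.sq_left h.swap_left h.sq_right h.swap_right h.swap ..

theorem mul_top (h : AnticommutingTriples p q) (i : Fin 3) : p i * (p 0 * p 1 * p 2) = 0 := by
  have := mul_mul_eq_ite p h.sq_left h.swap_left i i
  rw [if_pos rfl] at this
  rw [← this, ← mul_assoc, h.sq_left, zero_mul]

theorem top_mul (h : AnticommutingTriples p q) (i : Fin 3) : p 0 * p 1 * p 2 * p i = 0 := by
  have h1 : p 0 * p 1 * p 2 * p i = -(p i * (p 0 * p 1 * p 2)) := by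
    rw [mul_assoc, h.swap_left 2 i, mul_neg, ← mul_assoc, mul_assoc (p 0), h.swap_left 1 i,
      mul_neg, neg_mul, neg_neg, ← mul_assoc, h.swap_left 0 i]
    simp only [neg_mul, mul_assoc]
  rw [h1, h.mul_top, neg_zero]

theorem pair_mul_pair (h : AnticommutingTriples p q) (i j : Fin 3) :
    p (i + 1) * p (i + 2) * (p (j + 1) * p (j + 2)) = 0 := by
  rw [mul_assoc, mul_mul_eq_ite p h.sq_left h.swap_left]
  split_ifs
  · exact h.mul_top _
  · exact mul_zero _

theorem pair_mul (h : AnticommutingTriples p q) (i j : Fin 3) :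
    p (i + 1) * p (i + 2) * p j = if j = i then p 0 * p 1 * p 2 else 0 := by
  rw [← mul_mul_eq_ite p h.sq_left h.swap_left j i, mul_assoc, h.swap_left _ j, mul_neg,
    ← mul_assoc, h.swap_left _ j, neg_mul, neg_neg, mul_assoc]

theorem right_mul_pair (h : AnticommutingTriples p q) (i j k : Fin 3) :
    q k * (p i * p j) = p i * p j * q k := by
  rw [← mul_assoc, h.swap, neg_mul, mul_assoc, h.swap, mul_neg, neg_neg, mul_assoc]

theorem right_mul_pair_mul (h : AnticommutingTriples p q) (i j k : Fin 3) (z : 𝒜) :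
    q k * (p i * (p j * z)) = p i * (p j * (q k * z)) := by
  rw [← mul_assoc (p i), ← mul_assoc, h.right_mul_pair, mul_assoc, mul_assoc]

theorem pair_mul_right_mul_pair_mul_right (h : AnticommutingTriples p q) (k l k' l' : Fin 3) :
    p (k + 1) * p (k + 2) * q l * (p (k' + 1) * p (k' + 2) * q l') = 0 := by
  rw [mul_assoc, ← mul_assoc (q l), h.right_mul_pair, mul_assoc (p (k' + 1) * p (k' + 2)),
    ← mul_assoc, h.pair_mul_pair, zero_mul]

theorem mul_rightPair_mul_mul_rightPair (h : AnticommutingTriples p q) (i j i' j' : Fin 3) :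
    p i * q (j + 1) * q (j + 2) * (p i' * q (j' + 1) * q (j' + 2)) = 0 := by
  have h1 := h.symm.right_mul_pair_mul (j + 1) (j + 2) i' (q (j' + 1) * q (j' + 2))
  have h2 := h.symm.pair_mul_pair j j'
  simp only [mul_assoc] at *
  rw [← h1, h2, mul_zero, mul_zero]

/-- The reason for indexing pairs by the omitted index: the bases of `U ⊗ ⋀² E` and `⋀² U ⊗ E`
become dual to each other without signs. -/
theorem mul_rightPair_mul_pair_mul_right (h : AnticommutingTriples p q) (i j k l : Fin 3) :
    p i * q (j + 1) * q (j + 2) * (p (k + 1) * p (k + 2) * q l) =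
      if i = k ∧ j = l then p 0 * p 1 * p 2 * (q 0 * q 1 * q 2) else 0 := by
  have h1 := mul_mul_eq_ite p h.sq_left h.swap_left i k
  have h2 := h.symm.pair_mul j l
  have h3 : p i * q (j + 1) * q (j + 2) * (p (k + 1) * p (k + 2) * q l) =
      p i * (p (k + 1) * p (k + 2)) * (q (j + 1) * q (j + 2) * q l) := by
    simp only [mul_assoc, h.right_mul_pair_mul]
  rw [h3, h1, h2]
  by_cases hi : i = k <;> by_cases hj : j = l <;> simp [hi, hj, eq_comm]

theorem pair_mul_right_mul_mul_rightPair (h : AnticommutingTriples p q) (i j k l : Fin 3) :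
    p (k + 1) * p (k + 2) * q l * (p i * q (j + 1) * q (j + 2)) =
      -if i = k ∧ j = l then p 0 * p 1 * p 2 * (q 0 * q 1 * q 2) else 0 := by
  have h1 := h.pair_mul k i
  have h2 := mul_mul_eq_ite q h.sq_right h.swap_right l j
  have h3 : p (k + 1) * p (k + 2) * q l * (p i * q (j + 1) * q (j + 2)) =
      -(p (k + 1) * p (k + 2) * p i * (q l * (q (j + 1) * q (j + 2)))) := by
    have h4 : q l * (p i * (q (j + 1) * q (j + 2))) = -(p i * (q l * (q (j + 1) * q (j + 2)))) := by
      rw [← mul_assoc, h.swap, neg_mul, mul_assoc]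
    simp only [mul_assoc, h4, mul_neg]
  rw [h3, h1, h2]
  by_cases hi : i = k <;> by_cases hj : j = l <;> simp [hi, hj, eq_comm]

theorem rightTop_mul_top (h : AnticommutingTriples p q) :
    q 0 * q 1 * q 2 * (p 0 * p 1 * p 2) = -(p 0 * p 1 * p 2 * (q 0 * q 1 * q 2)) := by
  have h1 : q 2 * p 0 = -(p 0 * q 2) := h.swap ..
  have h2 := h.symm.right_mul_pair 0 1 0
  have h3 := h.right_mul_pair 1 2 2
  have h4 := h.right_mul_pair_mul 1 2
  have h6 := h.symm.right_mul_pair_mul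
  calc q 0 * q 1 * q 2 * (p 0 * p 1 * p 2) = q 0 * q 1 * (q 2 * p 0) * (p 1 * p 2) := by
        simp only [mul_assoc]
    _ = -(q 0 * q 1 * p 0 * (q 2 * (p 1 * p 2))) := by
        rw [h1]; simp only [mul_assoc, neg_mul, mul_neg]
    _ = -(p 0 * (q 0 * q 1) * (p 1 * p 2 * q 2)) := by rw [h2, h3]
    _ = -(p 0 * p 1 * p 2 * (q 0 * q 1 * q 2)) := by
        simp only [mul_assoc, h4]

/-- Only products of complementary types survive, and exchanging two elements of odd degree three
changes the sign. All information about the Lagrangian condition is extracted through this formula.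
-/
theorem trivector_mul_trivector (h : AnticommutingTriples p q) (s₀ s₀' t₀ t₀' : R)
    (s t s' t' : Fin 3 → Fin 3 → R) :
    trivector p q s₀ s t t₀ * trivector p q s₀' s' t' t₀' =
      (s₀ * t₀' - t₀ * s₀' + ∑ i, ∑ j, (t i j * s' i j - s i j * t' i j)) •
        (p 0 * p 1 * p 2 * (q 0 * q 1 * q 2)) := by
  -- `e1`–`e10` are the products with at least four factors from a single triple.
  have e1 : ∀ k l, p 0 * p 1 * p 2 * (p (k + 1) * p (k + 2) * q l) = 0 := fun k l => by
    rw [mul_assoc (p (k + 1)), ← mul_assoc, h.top_mul, zero_mul]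
  have e2 : ∀ i j, p 0 * p 1 * p 2 * (p i * q (j + 1) * q (j + 2)) = 0 := fun i j => by
    rw [mul_assoc (p i), ← mul_assoc, h.top_mul, zero_mul]
  have e3 : p 0 * p 1 * p 2 * (p 0 * p 1 * p 2) = 0 := by
    rw [mul_assoc (p 0) (p 1) (p 2), ← mul_assoc _ (p 0), ← mul_assoc (p 0) (p 1) (p 2),
      h.top_mul, zero_mul]
  have e4 : ∀ k l, p (k + 1) * p (k + 2) * q l * (q 0 * q 1 * q 2) = 0 := fun k l => by
    rw [mul_assoc _ (q l), h.symm.mul_top, mul_zero]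
  have e5 : ∀ k l, p (k + 1) * p (k + 2) * q l * (p 0 * p 1 * p 2) = 0 := fun k l => by
    have h1 := h.right_mul_pair 0 1 l
    rw [mul_assoc _ (q l), ← mul_assoc (q l), h1, mul_assoc _ (q l), h.swap, mul_neg, ← mul_assoc,
      mul_neg, ← mul_assoc, mul_assoc (p (k + 1)), h.mul_top, mul_zero, zero_mul, neg_zero]
  have e6 : ∀ i j, p i * q (j + 1) * q (j + 2) * (q 0 * q 1 * q 2) = 0 := fun i j => by
    rw [mul_assoc _ (q (j + 2)), h.symm.mul_top, mul_zero]
  have e7 : ∀ i j, p i * q (j + 1) * q (j + 2) * (p 0 * p 1 * p 2) = 0 := fun i j => by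
    have h1 := h.right_mul_pair 1 2
    have h2 := h.symm.right_mul_pair (j + 1) (j + 2) 0
    have h3 := h.mul_top i
    calc _ = p i * (q (j + 1) * q (j + 2) * p 0) * (p 1 * p 2) := by simp only [mul_assoc]
      _ = p i * p 0 * (q (j + 1) * (q (j + 2) * (p 1 * p 2))) := by
        rw [← h2]; simp only [mul_assoc]
      _ = p i * (p 0 * p 1 * p 2) * (q (j + 1) * q (j + 2)) := by
        rw [h1, ← mul_assoc (q _), h1]; simp only [mul_assoc]
      _ = 0 := by rw [h3, zero_mul]
  have e8 : q 0 * q 1 * q 2 * (q 0 * q 1 * q 2) = 0 := by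
    rw [mul_assoc (q 0) (q 1) (q 2), ← mul_assoc _ (q 0), ← mul_assoc (q 0) (q 1) (q 2),
      h.symm.top_mul, zero_mul]
  have e9 : ∀ k l, q 0 * q 1 * q 2 * (p (k + 1) * p (k + 2) * q l) = 0 := fun k l => by
    have h1 := h.right_mul_pair (k + 1) (k + 2)
    have h2 := h.symm.top_mul l
    calc _ = q 0 * (q 1 * (q 2 * (p (k + 1) * p (k + 2)))) * q l := by simp only [mul_assoc]
      _ = p (k + 1) * p (k + 2) * (q 0 * q 1 * q 2 * q l) := by
        rw [h1, ← mul_assoc (q 1), h1, mul_assoc _ (q 1), ← mul_assoc (q 0), h1]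
        simp only [mul_assoc]
      _ = 0 := by rw [h2, mul_zero]
  have e10 : ∀ i j, q 0 * q 1 * q 2 * (p i * q (j + 1) * q (j + 2)) = 0 := fun i j => by
    have h1 := h.symm.right_mul_pair (j + 1) (j + 2) i
    have h2 := h.symm.top_mul (j + 1)
    rw [mul_assoc (p i), h1, ← mul_assoc, ← mul_assoc, h2, zero_mul, zero_mul]
  unfold trivector
  simp only [add_mul, mul_add, Finset.sum_mul, Finset.mul_sum, smul_mul_smul_comm, e1, e2, e3, e4,
    e5, e6, e7, e8, e9, e10, h.pair_mul_right_mul_pair_mul_right,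
    h.mul_rightPair_mul_mul_rightPair, h.mul_rightPair_mul_pair_mul_right,
    h.pair_mul_right_mul_mul_rightPair, h.rightTop_mul_top, smul_zero, Finset.sum_const_zero,
    add_zero, zero_add]
  simp only [smul_neg, smul_ite, smul_zero, ite_and, Finset.sum_neg_distrib, add_smul, sub_smul]
  simp only [Finset.sum_ite_irrel, Finset.sum_const_zero, Finset.sum_ite_eq, Finset.sum_ite_eq',
    Finset.mem_univ, if_true, Finset.sum_smul, sub_smul, Finset.sum_sub_distrib]
  abel

end AnticommutingTriples
end Products

/-! ### The splitting of `⋀³ W` adapted to `U` -/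

section Lagrangian

variable {W : Type v} [AddCommGroup W] [Module ℂ W] {U : Submodule ℂ W}
variable (u : Basis (Fin 3) ℂ U) (e : Basis (Fin 3) ℂ (W ⧸ U))

/-- The vectors `uᵢ` in the exterior algebra. -/
def uVec (i : Fin 3) : ExteriorAlgebra ℂ W := ExteriorAlgebra.ι ℂ (u i : W)

/-- The vectors `eⱼ` in the exterior algebra. -/
def eVec (j : Fin 3) : ExteriorAlgebra ℂ W := ExteriorAlgebra.ι ℂ (liftVec e j)

/-- The basis `u₁, u₂, u₃, e₁, e₂, e₃` of `W`. -/
def adaptedBasis : Basis (Fin 3 ⊕ Fin 3) ℂ W := u.sumQuot e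

theorem adaptedBasis_inl (i : Fin 3) : adaptedBasis u e (Sum.inl i) = u i := by
  simp [adaptedBasis]

theorem adaptedBasis_inr (j : Fin 3) : adaptedBasis u e (Sum.inr j) = liftVec e j := by
  simp [adaptedBasis, Basis.sumQuot, liftVec]

theorem ι_adaptedBasis (x : Fin 3 ⊕ Fin 3) :
    ExteriorAlgebra.ι ℂ (adaptedBasis u e x) = Sum.elim (uVec u) (eVec e) x := by
  rcases x with i | j
  · rw [adaptedBasis_inl]; rfl
  · rw [adaptedBasis_inr]; rfl

theorem anticommutingTriples : AnticommutingTriples (uVec u) (eVec e) := by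
  have h : ∀ x y : W, ExteriorAlgebra.ι ℂ x * ExteriorAlgebra.ι ℂ y =
      -(ExteriorAlgebra.ι ℂ y * ExteriorAlgebra.ι ℂ x) := fun x y =>
    eq_neg_of_add_eq_zero_left (ExteriorAlgebra.ι_add_mul_swap x y)
  exact ⟨fun _ => ExteriorAlgebra.ι_sq_zero _, fun _ _ => h _ _,
    fun _ => ExteriorAlgebra.ι_sq_zero _, fun _ _ => h _ _, fun _ _ => h _ _⟩

theorem ι_eq_sum (w : W) :
    ExteriorAlgebra.ι ℂ w = ∑ i, (adaptedBasis u e).repr w (Sum.inl i) • uVec u i +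
      ∑ j, (adaptedBasis u e).repr w (Sum.inr j) • eVec e j := by
  conv_lhs => rw [← (adaptedBasis u e).sum_repr w]
  simp only [map_add, map_sum, map_smul, Fintype.sum_sum_type, ι_adaptedBasis, Sum.elim_inl, Sum.elim_inr]

theorem ι_subtype_eq_sum (x : U) :
    ExteriorAlgebra.ι ℂ (x : W) = ∑ i, u.repr x i • uVec u i := by
  conv_lhs => rw [← u.sum_repr x]
  simp only [Submodule.coe_sum, Submodule.coe_smul, map_sum, map_smul, uVec]

/-- `trivector` as a linear map. -/
def trivectorₗ : (ℂ × (Fin 3 → Fin 3 → ℂ) × (Fin 3 → Fin 3 → ℂ) × ℂ) →ₗ[ℂ]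
    ExteriorAlgebra ℂ W where
  toFun x := trivector (uVec u) (eVec e) x.1 x.2.1 x.2.2.1 x.2.2.2
  map_add' x y := by
    simp only [trivector, Prod.fst_add, Prod.snd_add, Pi.add_apply, add_smul,
      Finset.sum_add_distrib]
    abel
  map_smul' c x := by
    simp only [trivector, Prod.smul_fst, Prod.smul_snd, Pi.smul_apply, smul_eq_mul, mul_smul,
      Finset.smul_sum, smul_add, RingHom.id_apply]

theorem trivectorₗ_apply (s₀ : ℂ) (s t : Fin 3 → Fin 3 → ℂ) (t₀ : ℂ) :
    trivectorₗ u e (s₀, s, t, t₀) = trivector (uVec u) (eVec e) s₀ s t t₀ := rfl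

theorem exteriorPower_three_eq_range : ⋀[ℂ]^3 W = LinearMap.range (trivectorₗ u e) := by
  apply le_antisymm
  · rw [← ExteriorAlgebra.ιMulti_span_fixedDegree, Submodule.span_le]
    rintro _ ⟨w, rfl⟩
    have h : ExteriorAlgebra.ιMulti ℂ 3 w = ExteriorAlgebra.ι ℂ (w 0) * ExteriorAlgebra.ι ℂ (w 1) *
        ExteriorAlgebra.ι ℂ (w 2) := by
      rw [ExteriorAlgebra.ιMulti_apply]
      simp [List.ofFn_succ, mul_assoc]
    rw [h, ι_eq_sum u e (w 0), ι_eq_sum u e (w 1), ι_eq_sum u e (w 2),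
      (anticommutingTriples u e).mul_mul_eq_trivector]
    exact ⟨(_, _, _, _), rfl⟩
  · have h3 : ∀ x y z : W, ExteriorAlgebra.ι ℂ x * ExteriorAlgebra.ι ℂ y * ExteriorAlgebra.ι ℂ z ∈
        ⋀[ℂ]^3 W := by
      intro x y z
      have h : ∀ x : W, ExteriorAlgebra.ι ℂ x ∈ LinearMap.range (ExteriorAlgebra.ι ℂ (M := W)) :=
        fun x => ⟨x, rfl⟩
      rw [ExteriorAlgebra.exteriorPower, pow_succ, pow_two]
      exact Submodule.mul_mem_mul (Submodule.mul_mem_mul (h x) (h y)) (h z)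
    rintro _ ⟨⟨s₀, s, t, t₀⟩, rfl⟩
    rw [trivectorₗ_apply, trivector]
    refine add_mem (add_mem (add_mem ?_ ?_) ?_) ?_
    · exact Submodule.smul_mem _ _ (h3 _ _ _)
    · exact Submodule.sum_mem _ fun _ _ => Submodule.sum_mem _ fun _ _ =>
        Submodule.smul_mem _ _ (h3 _ _ _)
    · exact Submodule.sum_mem _ fun _ _ => Submodule.sum_mem _ fun _ _ =>
        Submodule.smul_mem _ _ (h3 _ _ _)
    · exact Submodule.smul_mem _ _ (h3 _ _ _)

/-- A product of two vectors of `U` and one of `W` has at most one factor in `E`, so the last two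
components of `trivector` vanish; the remaining basis trivectors visibly have two factors in `U`. -/
theorem mem_filt_two_iff (x : ExteriorAlgebra ℂ W) :
    x ∈ filt U 2 ↔ ∃ (s₀ : ℂ) (s : Fin 3 → Fin 3 → ℂ),
      x = trivector (uVec u) (eVec e) s₀ s (0 : Fin 3 → Fin 3 → ℂ) (0 : ℂ) := by
  have hp : ∀ i, uVec u i ∈ U.map (ExteriorAlgebra.ι ℂ) := fun i => ⟨u i, (u i).2, rfl⟩
  have hr : ∀ w : W, ExteriorAlgebra.ι ℂ w ∈ ⋀[ℂ]^(3 - 2) W := fun w => by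
    rw [ExteriorAlgebra.exteriorPower, pow_one]; exact ⟨w, rfl⟩
  have hmem : ∀ (i j : Fin 3) (w : W), uVec u i * uVec u j * ExteriorAlgebra.ι ℂ w ∈ filt U 2 := by
    intro i j w
    rw [filt, pow_two]
    exact Submodule.mul_mem_mul (Submodule.mul_mem_mul (hp i) (hp j)) (hr w)
  constructor
  · intro hx
    suffices h : filt U 2 ≤ (LinearMap.range (trivectorₗ u e ∘ₗ
        LinearMap.prodMap LinearMap.id (LinearMap.inl ℂ _ _))) by
      obtain ⟨⟨s₀, s⟩, rfl⟩ := h hx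
      exact ⟨s₀, s, rfl⟩
    have hrange : ∀ (s₀ : ℂ) (s t : Fin 3 → Fin 3 → ℂ) (t₀ : ℂ), t = 0 → t₀ = 0 →
        trivector (uVec u) (eVec e) s₀ s t t₀ ∈ LinearMap.range (trivectorₗ u e ∘ₗ
          LinearMap.prodMap LinearMap.id (LinearMap.inl ℂ _ _)) := by
      rintro s₀ s _ _ rfl rfl
      exact ⟨(s₀, s), rfl⟩
    rw [filt, pow_two, Submodule.mul_le]
    intro m hm n hn
    rw [ExteriorAlgebra.exteriorPower, pow_one] at hn
    obtain ⟨w, rfl⟩ := hn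
    induction hm using Submodule.mul_induction_on' with
    | add x _ y _ hx hy => rw [add_mul]; exact add_mem hx hy
    | mem_mul_mem x hx y hy =>
      obtain ⟨x, hx, rfl⟩ := hx
      obtain ⟨y, hy, rfl⟩ := hy
      have h1 := ι_subtype_eq_sum u ⟨x, hx⟩
      have h2 := ι_subtype_eq_sum u ⟨y, hy⟩
      have h3 : ∀ a : Fin 3 → ℂ, ∑ i, a i • uVec u i = ∑ i, a i • uVec u i +
        ∑ j, (0 : Fin 3 → ℂ) j • eVec e j := fun a => by simp
      rw [h3] at h1 h2
      rw [h1, h2, ι_eq_sum u e w, (anticommutingTriples u e).mul_mul_eq_trivector]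
      refine hrange _ _ _ _ ?_ ?_
      · ext i j; simp [mix]
      · simp
  · rintro ⟨s₀, s, rfl⟩
    have h0 : trivector (uVec u) (eVec e) s₀ s (0 : Fin 3 → Fin 3 → ℂ) (0 : ℂ) = s₀ • (uVec u 0 * uVec u 1 * uVec u 2) +
        ∑ k, ∑ l, s k l • (uVec u (k + 1) * uVec u (k + 2) * eVec e l) := by
      simp [trivector]
    rw [h0]
    exact add_mem (Submodule.smul_mem _ _ (hmem _ _ _)) (Submodule.sum_mem _ fun _ _ =>
      Submodule.sum_mem _ fun _ _ => Submodule.smul_mem _ _ (hmem _ _ _))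

/-- The six factors form a basis of `W`. This nonvanishing is what allows coefficients to be read
off from wedge products. -/
theorem topForm_ne_zero (vol : W [⋀^Fin 6]→ₗ[ℂ] ℂ) (hvol : vol ≠ 0) :
    topForm vol (uVec u 0 * uVec u 1 * uVec u 2 * (eVec e 0 * eVec e 1 * eVec e 2)) ≠ 0 := by
  let b := (adaptedBasis u e).reindex finSumFinEquiv
  have h : uVec u 0 * uVec u 1 * uVec u 2 * (eVec e 0 * eVec e 1 * eVec e 2) =
      ExteriorAlgebra.ιMulti ℂ 6 b := by
    rw [ExteriorAlgebra.ιMulti_apply]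
    have hl : ∀ i : Fin 3, ExteriorAlgebra.ι ℂ (b (Fin.castAdd 3 i)) = uVec u i := fun i => by
      rw [Basis.reindex_apply, finSumFinEquiv_symm_apply_castAdd, ι_adaptedBasis, Sum.elim_inl]
    have hr : ∀ i : Fin 3, ExteriorAlgebra.ι ℂ (b (Fin.natAdd 3 i)) = eVec e i := fun i => by
      rw [Basis.reindex_apply, finSumFinEquiv_symm_apply_natAdd, ι_adaptedBasis, Sum.elim_inr]
    rw [← hl 0, ← hl 1, ← hl 2, ← hr 0, ← hr 1, ← hr 2]
    simp only [List.ofFn_succ, List.ofFn_zero, List.prod_cons, List.prod_nil, mul_one, mul_assoc]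
    rfl
  rw [h, topForm, ExteriorAlgebra.liftAlternating_apply_ιMulti, Pi.single_eq_same]
  exact (AlternatingMap.map_basis_ne_zero_iff b vol).2 hvol

end Lagrangian

/-! ### `A` as the graph of a symmetric form -/

section SymmetricForm

/-- A graph is spanned by the points over the basis vectors of its source. The discrepancy in the
first component is a multiple of the generator of `⋀³ U`, which belongs to `A`, so the constants `c`
are harmless. -/
theorem trivector_eq_sum_smul {R 𝒜 : Type*} [CommRing R] [Ring 𝒜] [Algebra R 𝒜] (p q : Fin 3 → 𝒜)
    (s₀ : R) (t c : Fin 3 → Fin 3 → R) (G : Fin 3 → Fin 3 → Fin 3 → Fin 3 → R) :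
    trivector p q s₀ (fun k l => ∑ i, ∑ j, t i j * G i j k l) t 0 =
      (s₀ - ∑ i, ∑ j, t i j * c i j) • (p 0 * p 1 * p 2) +
        ∑ i, ∑ j, t i j • trivector p q (c i j) (G i j)
          (fun k l => if k = i ∧ l = j then 1 else 0) 0 := by
  have h : ∀ (X : Fin 3 → Fin 3 → Fin 3 → Fin 3 → 𝒜),
      ∑ k, ∑ l, ∑ i, ∑ j, X i j k l = ∑ i, ∑ j, ∑ k, ∑ l, X i j k l := fun X =>
    (Finset.sum_congr rfl fun k _ => Finset.sum_comm).trans <| Finset.sum_comm.trans <|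
      Finset.sum_congr rfl fun i _ =>
        (Finset.sum_congr rfl fun k _ => Finset.sum_comm).trans Finset.sum_comm
  simp only [trivector, zero_smul, add_zero, smul_add, Finset.sum_add_distrib, Finset.smul_sum,
    smul_smul, sub_smul, Finset.sum_smul]
  rw [h]
  simp only [mul_ite, mul_one, mul_zero, ite_smul, zero_smul, ite_and, Finset.sum_ite_irrel,
    Finset.sum_const_zero, Finset.sum_ite_eq', Finset.mem_univ, if_true]
  abel

variable {W : Type v} [AddCommGroup W] [Module ℂ W] {U : Submodule ℂ W}
variable (u : Basis (Fin 3) ℂ U) (e : Basis (Fin 3) ℂ (W ⧸ U))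
variable {A : Submodule ℂ (ExteriorAlgebra ℂ W)}

theorem trivector_mem_exteriorPower (s₀ : ℂ) (s t : Fin 3 → Fin 3 → ℂ) (t₀ : ℂ) :
    trivector (uVec u) (eVec e) s₀ s t t₀ ∈ ⋀[ℂ]^3 W := by
  rw [exteriorPower_three_eq_range u e]
  exact ⟨(s₀, s, t, t₀), rfl⟩

theorem uTop_eq_trivector : uVec u 0 * uVec u 1 * uVec u 2 =
    trivector (uVec u) (eVec e) (1 : ℂ) (0 : Fin 3 → Fin 3 → ℂ) (0 : Fin 3 → Fin 3 → ℂ) (0 : ℂ) := by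
  simp [trivector]

theorem segreVec_eq_trivector (i j : Fin 3) : segreVec u e i j =
    trivector (uVec u) (eVec e) (0 : ℂ) (0 : Fin 3 → Fin 3 → ℂ)
      (fun k l => if k = i ∧ l = j then 1 else 0) (0 : ℂ) := by
  simp [trivector, segreVec, uVec, eVec, ite_and, ite_smul, Finset.sum_ite_irrel]

theorem uTop_mem (huA : U.map (ExteriorAlgebra.ι ℂ) ^ 3 ≤ A) :
    uVec u 0 * uVec u 1 * uVec u 2 ∈ A := by
  have hp : ∀ i, uVec u i ∈ U.map (ExteriorAlgebra.ι ℂ) := fun i => ⟨u i, (u i).2, rfl⟩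
  apply huA
  rw [pow_succ, pow_two]
  exact Submodule.mul_mem_mul (Submodule.mul_mem_mul (hp 0) (hp 1)) (hp 2)

variable {vol : W [⋀^Fin 6]→ₗ[ℂ] ℂ}

theorem top_ne_zero (hvol : vol ≠ 0) :
    uVec u 0 * uVec u 1 * uVec u 2 * (eVec e 0 * eVec e 1 * eVec e 2) ≠ 0 := fun h =>
  topForm_ne_zero u e vol hvol (by rw [h, map_zero])

/-- Pairing with the generator of `⋀³ U`, which lies in `A`, isolates the coefficient in `⋀³ E`. -/
theorem exists_eq_trivector (hA : IsLagrangian A) (huA : U.map (ExteriorAlgebra.ι ℂ) ^ 3 ≤ A)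
    (hvol : vol ≠ 0) {a : ExteriorAlgebra ℂ W} (ha : a ∈ A) :
    ∃ (s₀ : ℂ) (s t : Fin 3 → Fin 3 → ℂ), a = trivector (uVec u) (eVec e) s₀ s t (0 : ℂ) := by
  have h1 := hA.1 ha
  rw [exteriorPower_three_eq_range u e] at h1
  obtain ⟨⟨s₀, s, t, t₀⟩, rfl⟩ := h1
  have h2 := (hA.2 _ (hA.1 (uTop_mem u huA))).1 (uTop_mem u huA) _ ha
  rw [uTop_eq_trivector u e, trivectorₗ_apply,
    (anticommutingTriples u e).trivector_mul_trivector] at h2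
  have h3 := (smul_eq_zero.1 h2).resolve_right (top_ne_zero u e hvol)
  obtain rfl : t₀ = 0 := by simpa using h3
  exact ⟨s₀, s, t, rfl⟩

/-- The Lagrangian subspace `A` meets the image of `⋀² U × W` only in `⋀³ U`. -/
def IsTransversal (A : Submodule ℂ (ExteriorAlgebra ℂ W)) : Prop :=
  ∀ s : Fin 3 → Fin 3 → ℂ, trivector (uVec u) (eVec e) (0 : ℂ) s (0 : Fin 3 → Fin 3 → ℂ) (0 : ℂ) ∈ A →
    s = 0

/-- Duality replaces a dimension count: a functional vanishing on the projection `N` of `A` to `U ⊗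
⋀² E` is an element of `⋀² U ⊗ E` orthogonal to `A`. It therefore lies in `A`, and transversality
makes it zero. -/
theorem exists_trivector_mem (hA : IsLagrangian A) (huA : U.map (ExteriorAlgebra.ι ℂ) ^ 3 ≤ A)
    (hT : IsTransversal u e A) (hvol : vol ≠ 0) (t : Fin 3 → Fin 3 → ℂ) :
    ∃ (s₀ : ℂ) (s : Fin 3 → Fin 3 → ℂ), trivector (uVec u) (eVec e) s₀ s t (0 : ℂ) ∈ A := by
  let N : Submodule ℂ (Fin 3 → Fin 3 → ℂ) := (A.comap (trivectorₗ u e)).map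
    (LinearMap.fst ℂ _ _ ∘ₗ LinearMap.snd ℂ _ _ ∘ₗ LinearMap.snd ℂ _ _)
  suffices h : N = ⊤ by
    obtain ⟨⟨s₀, s, t', t₀⟩, h1, rfl⟩ : t ∈ N := h ▸ Submodule.mem_top
    obtain ⟨s₀', s', t'', h2⟩ := exists_eq_trivector u e hA huA hvol h1
    have h4 : trivector (uVec u) (eVec e) s₀ s t' t₀ ∈ A := h1
    have h3 := (hA.2 _ (hA.1 (uTop_mem u huA))).1 (uTop_mem u huA) _ h1
    rw [uTop_eq_trivector u e, trivectorₗ_apply,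
      (anticommutingTriples u e).trivector_mul_trivector] at h3
    have h5 := (smul_eq_zero.1 h3).resolve_right (top_ne_zero u e hvol)
    obtain rfl : t₀ = 0 := by simpa using h5
    exact ⟨s₀, s, h4⟩
  by_contra hN
  obtain ⟨f, hf, hNf⟩ := Submodule.exists_le_ker_of_lt_top N (lt_top_iff_ne_top.2 hN)
  apply hf
  -- The functional `f`, seen as an element of `⋀² U ⊗ E` through the pairing.
  let φ : Fin 3 → Fin 3 → ℂ := fun i j => f (Pi.single i (Pi.single j 1))
  have hfφ : ∀ t, f t = ∑ i, ∑ j, t i j * φ i j := by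
    intro t
    have ht : t = ∑ i, ∑ j, t i j • (Pi.single i (Pi.single j (1 : ℂ)) : Fin 3 → Fin 3 → ℂ) := by
      ext i j
      simp [Finset.sum_apply, Pi.single_apply, ite_apply]
    conv_lhs => rw [ht]
    simp only [map_sum, map_smul, smul_eq_mul, φ]
  have hφ : φ = 0 := by
    apply hT
    rw [hA.2 _ (trivector_mem_exteriorPower u e 0 φ 0 0)]
    intro b hb
    obtain ⟨s₀, s, t, rfl⟩ := exists_eq_trivector u e hA huA hvol hb
    rw [(anticommutingTriples u e).trivector_mul_trivector]
    have h0 : f t = 0 := hNf ⟨(s₀, s, t, 0), hb, rfl⟩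
    rw [hfφ] at h0
    have h1 : ∑ i, ∑ j, φ i j * t i j = 0 := by simpa only [mul_comm] using h0
    simp [h1]
  ext t
  simp [hfφ, hφ]

/-- Transversality guarantees a lift, so the choice in `segreLift` is not a junk value. -/
theorem segreLift_spec (hA : IsLagrangian A) (huA : U.map (ExteriorAlgebra.ι ℂ) ^ 3 ≤ A)
    (hT : IsTransversal u e A) (hvol : vol ≠ 0) (i j : Fin 3) :
    ∃ (s₀ : ℂ) (s : Fin 3 → Fin 3 → ℂ), segreLift u e A i j ∈ A ∧ segreLift u e A i j =
      trivector (uVec u) (eVec e) s₀ s (fun k l => if k = i ∧ l = j then 1 else 0) (0 : ℂ) := by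
  have h : segreLift u e A i j ∈ A ∧ segreLift u e A i j - segreVec u e i j ∈ filt U 2 := by
    apply Classical.epsilon_spec (p := fun a => a ∈ A ∧ a - segreVec u e i j ∈ filt U 2)
    obtain ⟨s₀, s, hs⟩ := exists_trivector_mem u e hA huA hT hvol
      (fun k l => if k = i ∧ l = j then 1 else 0)
    refine ⟨_, hs, ?_⟩
    rw [mem_filt_two_iff u e]
    refine ⟨s₀, s, ?_⟩
    rw [segreVec_eq_trivector]
    simp only [← trivectorₗ_apply, ← map_sub]
    simp [Prod.zero_eq_mk]
  obtain ⟨s₀, s, hs⟩ := (mem_filt_two_iff u e _).1 h.2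
  refine ⟨s₀, s, h.1, ?_⟩
  rw [eq_add_of_sub_eq hs, segreVec_eq_trivector]
  simp only [← trivectorₗ_apply, ← map_add]
  simp

/-- `A` is the graph of a symmetric form. -/
theorem exists_symmetric_form (hA : IsLagrangian A) (huA : U.map (ExteriorAlgebra.ι ℂ) ^ 3 ≤ A)
    (hT : IsTransversal u e A) (hvol : vol ≠ 0) :
    ∃ (c : Fin 3 → Fin 3 → ℂ) (G : Fin 3 → Fin 3 → Fin 3 → Fin 3 → ℂ),
      (∀ i j k l, G i j k l = G k l i j) ∧ ∀ i j, segreLift u e A i j ∈ A ∧ segreLift u e A i j =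
        trivector (uVec u) (eVec e) (c i j) (G i j) (fun k l => if k = i ∧ l = j then 1 else 0)
          (0 : ℂ) := by
  choose c G hG using segreLift_spec u e hA huA hT hvol
  refine ⟨c, G, fun i j k l => ?_, hG⟩
  -- Symmetry of `G` is isotropy of `A`: the product of two lifts is `G k l i j - G i j k l`, up to
  -- sign, times the top vector.
  have h := (hA.2 _ (hA.1 (hG i j).1)).1 (hG i j).1 _ (hG k l).1
  rw [(hG i j).2, (hG k l).2, (anticommutingTriples u e).trivector_mul_trivector] at h
  have h1 := (smul_eq_zero.1 h).resolve_right (top_ne_zero u e hvol)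
  simp [ite_and, Finset.sum_sub_distrib, Finset.sum_ite_irrel] at h1
  exact (sub_eq_zero.1 h1).symm

/-- A trivector in `U ⊗ ⋀² E` pairs only with the `⋀² U ⊗ E` component of the lift. In particular
the ambiguity of the lift by `⋀³ U` does not matter. -/
theorem verraForm_eq {c : Fin 3 → Fin 3 → ℂ} {G : Fin 3 → Fin 3 → Fin 3 → Fin 3 → ℂ}
    (hsymm : ∀ i j k l, G i j k l = G k l i j)
    (hG : ∀ i j, segreLift u e A i j =
        trivector (uVec u) (eVec e) (c i j) (G i j) (fun k l => if k = i ∧ l = j then 1 else 0)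
          (0 : ℂ)) :
    verraForm u e A vol = ∑ i, ∑ j, ∑ k, ∑ l,
      MvPolynomial.C (G i j k l *
        topForm vol (uVec u 0 * uVec u 1 * uVec u 2 * (eVec e 0 * eVec e 1 * eVec e 2))) *
      (MvPolynomial.X (Sum.inl i) * MvPolynomial.X (Sum.inr j) *
        (MvPolynomial.X (Sum.inl k) * MvPolynomial.X (Sum.inr l))) := by
  rw [verraForm]
  refine Finset.sum_congr rfl fun i _ => Finset.sum_congr rfl fun j _ =>
    Finset.sum_congr rfl fun k _ => Finset.sum_congr rfl fun l _ => ?_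
  rw [hG, segreVec_eq_trivector, (anticommutingTriples u e).trivector_mul_trivector, map_smul,
    smul_eq_mul]
  congr 3
  simp [ite_and, Finset.sum_ite_irrel, hsymm i j k l]

variable {R : Type} [CommRing R] [Algebra ℂ R]

/-- The vectors `uᵢ` in `R ⊗ ⋀ W`. -/
def uVecR (i : Fin 3) : R ⊗[ℂ] ExteriorAlgebra ℂ W := 1 ⊗ₜ uVec u i

/-- The vectors `eⱼ` in `R ⊗ ⋀ W`. -/
def eVecR (j : Fin 3) : R ⊗[ℂ] ExteriorAlgebra ℂ W := 1 ⊗ₜ eVec e j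

theorem anticommutingTriplesR : AnticommutingTriples (uVecR (R := R) u) (eVecR (R := R) e) :=
  (anticommutingTriples u e).map
    (Algebra.TensorProduct.includeRight : ExteriorAlgebra ℂ W →ₐ[ℂ] R ⊗[ℂ] _).toRingHom

/-- Pairing with elements of `A` yields the equations, and `trivector_eq_sum_smul` shows that they
suffice. The coefficient `s₀` is unconstrained because `⋀³ U ⊆ A`. -/
theorem trivector_mem_baseChange_iff (hA : IsLagrangian A)
    (huA : U.map (ExteriorAlgebra.ι ℂ) ^ 3 ≤ A) (hvol : vol ≠ 0)
    {c : Fin 3 → Fin 3 → ℂ} {G : Fin 3 → Fin 3 → Fin 3 → Fin 3 → ℂ}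
    (hsymm : ∀ i j k l, G i j k l = G k l i j)
    (hG : ∀ i j, segreLift u e A i j ∈ A ∧ segreLift u e A i j =
        trivector (uVec u) (eVec e) (c i j) (G i j) (fun k l => if k = i ∧ l = j then 1 else 0)
          (0 : ℂ)) (s₀ : R) (s t : Fin 3 → Fin 3 → R) (t₀ : R) :
    trivector (uVecR u) (eVecR e) s₀ s t t₀ ∈ A.baseChange R ↔
      t₀ = 0 ∧ ∀ k l, s k l = ∑ i, ∑ j, algebraMap ℂ R (G i j k l) * t i j := by
  have hκ := topForm_ne_zero u e vol hvol
  have hκR : IsUnit (algebraMap ℂ R (topForm vol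
      (uVec u 0 * uVec u 1 * uVec u 2 * (eVec e 0 * eVec e 1 * eVec e 2)))) :=
    (IsUnit.mk0 _ hκ).map _
  have hmap : ∀ (s₀ : ℂ) (s t : Fin 3 → Fin 3 → ℂ) (t₀ : ℂ),
      (1 : R) ⊗ₜ[ℂ] trivector (uVec u) (eVec e) s₀ s t t₀ = trivector (uVecR u) (eVecR e)
        (algebraMap ℂ R s₀) (fun i j => algebraMap ℂ R (s i j)) (fun i j => algebraMap ℂ R (t i j))
        (algebraMap ℂ R t₀) := by
    intro s₀ s t t₀
    simp only [trivector, uVecR, eVecR, Algebra.TensorProduct.tmul_mul_tmul, mul_one,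
      TensorProduct.tmul_add, TensorProduct.tmul_sum, TensorProduct.tmul_smul, algebraMap_smul]
  constructor
  · intro h
    have key : ∀ b ∈ A, ∀ z ∈ A.baseChange R, ((topForm vol).baseChange R) (z * (1 ⊗ₜ b)) = 0 := by
      rintro b hb _ ⟨z, rfl⟩
      induction z using TensorProduct.induction_on with
      | zero => simp
      | tmul r a =>
        have h1 : (a : ExteriorAlgebra ℂ W) * b = 0 := (hA.2 _ (hA.1 a.2)).1 a.2 _ hb
        simp [h1]
      | add x y hx hy => rw [map_add, add_mul, map_add, hx, hy, add_zero]
    have h1 := key _ (uTop_mem u huA) _ h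
    rw [uTop_eq_trivector u e, hmap, (anticommutingTriplesR u e).trivector_mul_trivector,
      map_smul] at h1
    have hval : ((topForm vol).baseChange R) (uVecR u 0 * uVecR u 1 * uVecR u 2 *
        (eVecR e 0 * eVecR e 1 * eVecR e 2)) = 1 ⊗ₜ (topForm vol
      (uVec u 0 * uVec u 1 * uVec u 2 * (eVec e 0 * eVec e 1 * eVec e 2))) := by
      simp only [uVecR, eVecR, Algebra.TensorProduct.tmul_mul_tmul, mul_one,
        LinearMap.baseChange_tmul]
    -- The value of the volume form is a nonzero complex number, hence a unit in `R`.
    have hcancel : ∀ r : R, r • ((topForm vol).baseChange R) (uVecR u 0 * uVecR u 1 * uVecR u 2 *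
        (eVecR e 0 * eVecR e 1 * eVecR e 2)) = 0 → r = 0 := by
      intro r hr
      rw [hval] at hr
      have h2 := congrArg (TensorProduct.rid ℂ R) hr
      rw [TensorProduct.smul_tmul', TensorProduct.rid_tmul, map_zero, Algebra.smul_def,
        smul_eq_mul, mul_one] at h2
      exact (hκR.mul_right_eq_zero).1 h2
    refine ⟨?_, fun k l => ?_⟩
    · simpa using hcancel _ h1
    · have h2 := key _ (hG k l).1 _ h
      rw [(hG k l).2, hmap, (anticommutingTriplesR u e).trivector_mul_trivector, map_smul] at h2
      have h3 := hcancel _ h2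
      have ht₀ : t₀ = 0 := by simpa using hcancel _ h1
      simp [ht₀, ite_and, Finset.sum_sub_distrib, Finset.sum_ite_irrel, apply_ite (algebraMap ℂ R)] at h3
      rw [← sub_eq_zero.1 h3]
      refine Finset.sum_congr rfl fun i _ => Finset.sum_congr rfl fun j _ => ?_
      rw [hsymm, mul_comm]
  · rintro ⟨rfl, hs⟩
    have h1 : trivector (uVecR u) (eVecR e) s₀ s t 0 =
        (s₀ - ∑ i, ∑ j, t i j * algebraMap ℂ R (c i j)) • (1 ⊗ₜ (uVec u 0 * uVec u 1 * uVec u 2)) +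
          ∑ i, ∑ j, t i j • ((1 : R) ⊗ₜ[ℂ] segreLift u e A i j) := by
      simp only [fun i j => (hG i j).2, hmap]
      have h2 : (1 : R) ⊗ₜ[ℂ] (uVec u 0 * uVec u 1 * uVec u 2) =
          uVecR (R := R) u 0 * uVecR u 1 * uVecR u 2 := by
        simp only [uVecR, Algebra.TensorProduct.tmul_mul_tmul, mul_one]
      have h3 : s = fun k l => ∑ i, ∑ j, t i j * algebraMap ℂ R (G i j k l) := by
        ext k l
        rw [hs]; simp only [mul_comm]
      rw [h2, h3, trivector_eq_sum_smul _ _ _ _ fun i j => algebraMap ℂ R (c i j)]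
      simp only [apply_ite (algebraMap ℂ R), map_one, map_zero]
    rw [h1]
    exact add_mem (Submodule.smul_mem _ _ (Submodule.tmul_mem_baseChange_of_mem _ (uTop_mem u huA)))
      (Submodule.sum_mem _ fun i _ => Submodule.sum_mem _ fun j _ => Submodule.smul_mem _ _
        (Submodule.tmul_mem_baseChange_of_mem _ (hG i j).1))

end SymmetricForm

/-! ### Ranks of quotients -/

section QuotientRank

variable {R : Type*} [CommRing R] {M : Type*} [AddCommGroup M] [Module R M]

/-- The surjection of quotients splits, and its kernel is finite projective of rank `k - k = 0`,
hence zero. -/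
theorem _root_.Module.Grassmannian.eq_of_le {k : ℕ} {N N' : Grassmannian R M k}
    (h : N.toSubmodule ≤ N'.toSubmodule) : N = N' := by
  let f : (M ⧸ N.toSubmodule) →ₗ[R] (M ⧸ N'.toSubmodule) := Submodule.factor h
  have hf : Function.Surjective f := Submodule.factor_surjective h
  obtain ⟨g, hg⟩ := f.exists_rightInverse_of_surjective (LinearMap.range_eq_top.2 hf)
  have hex : Function.Exact (LinearMap.ker f).subtype f := LinearMap.exact_subtype_ker_map f
  let E := (hex.splitSurjectiveEquiv (Submodule.injective_subtype _) ⟨g, hg⟩).1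
  have : Module.Finite R (LinearMap.ker f) :=
    Module.Finite.of_surjective (LinearMap.fst R _ _ ∘ₗ E.toLinearMap)
      (Prod.fst_surjective.comp E.surjective)
  have : Module.Projective R (LinearMap.ker f) :=
    Module.Projective.of_split (E.symm.toLinearMap ∘ₗ LinearMap.inl R _ _)
      (LinearMap.fst R _ _ ∘ₗ E.toLinearMap) (by ext x; simp)
  have hr : rankAtStalk (R := R) (LinearMap.ker f) = 0 := by
    have h1 := rankAtStalk_eq_of_equiv E
    rw [rankAtStalk_prod] at h1
    ext p
    have h2 := congrFun h1 p
    rw [Pi.add_apply, N.rankAtStalk_eq, N'.rankAtStalk_eq] at h2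
    simpa using h2
  have hs := (rankAtStalk_eq_zero_iff_subsingleton (R := R)).1 hr
  ext x
  refine ⟨fun hx => h hx, fun hx => ?_⟩
  have h1 : N.toSubmodule.mkQ x ∈ LinearMap.ker f := by
    rw [LinearMap.mem_ker, Submodule.mkQ_apply]
    exact (Submodule.Quotient.mk_eq_zero _).2 hx
  have h2 := congrArg Subtype.val (Subsingleton.elim (⟨_, h1⟩ : LinearMap.ker f) 0)
  exact (Submodule.Quotient.mk_eq_zero _).1 h2

/-- If `L ∩ P = ℓ` and `L` has image `H` in `Q = M / P`, and if `Q / H` is projective, then `M / L` is the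
direct sum of `P / ℓ` and `Q / H`. -/
theorem exists_quotient_equiv_prod {P Q : Type*} [AddCommGroup P] [Module R P] [AddCommGroup Q]
    [Module R Q] (i : P →ₗ[R] M) (π : M →ₗ[R] Q) (hπ : Function.Surjective π)
    (hex : Function.Exact i π) (L : Submodule R M) [Module.Projective R (Q ⧸ L.map π)] :
    Nonempty ((M ⧸ L) ≃ₗ[R] (P ⧸ L.comap i) × (Q ⧸ L.map π)) := by
  let f := (L.comap i).mapQ L i le_rfl
  let g := L.mapQ (L.map π) π (Submodule.le_comap_map _ _)
  have hf : Function.Injective f := by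
    rw [← LinearMap.ker_eq_bot, Submodule.ker_mapQ, Submodule.mkQ_map_self]
  have hg : Function.Surjective g := by
    intro y
    obtain ⟨y, rfl⟩ := Submodule.mkQ_surjective _ y
    obtain ⟨x, rfl⟩ := hπ y
    exact ⟨L.mkQ x, rfl⟩
  have hfg : Function.Exact f g := by
    intro x
    obtain ⟨x, rfl⟩ := Submodule.mkQ_surjective _ x
    constructor
    · intro hx
      obtain ⟨y, hy, hyx⟩ := (Submodule.Quotient.mk_eq_zero _).1 hx
      obtain ⟨z, hz⟩ := (hex (x - y)).1 (by rw [map_sub, hyx, sub_self])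
      refine ⟨(L.comap i).mkQ z, ?_⟩
      change L.mkQ (i z) = L.mkQ x
      rw [hz, map_sub, Submodule.mkQ_apply L y, (Submodule.Quotient.mk_eq_zero _).2 hy, sub_zero]
    · rintro ⟨z, hz⟩
      obtain ⟨z, rfl⟩ := Submodule.mkQ_surjective _ z
      rw [← hz]
      change (L.map π).mkQ (π (i z)) = 0
      rw [(hex _).2 ⟨z, rfl⟩, map_zero]
  obtain ⟨s, hs⟩ := g.exists_rightInverse_of_surjective (LinearMap.range_eq_top.2 hg)
  exact ⟨(hfg.splitSurjectiveEquiv hf ⟨s, hs⟩).1⟩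

end QuotientRank

/-! ### Lines and planes in `R³` through cross products -/

section LinesAndPlanes

variable {R : Type*} [CommRing R]

/-- A rank one direct summand of `R³`. -/
structure IsLine (ℓ : Submodule R (Fin 3 → R)) : Prop where
  cross_eq_zero : ∀ a ∈ ℓ, ∀ b ∈ ℓ, a ⨯₃ b = 0
  span_eq_top : Ideal.span {r | ∃ a ∈ ℓ, ∃ i, r = a i} = ⊤

/-- A rank two direct summand of `R³`. -/
structure IsPlane (H : Submodule R (Fin 3 → R)) : Prop where
  det_eq_zero : ∀ a ∈ H, ∀ b ∈ H, ∀ c ∈ H, a ⬝ᵥ b ⨯₃ c = 0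
  span_eq_top : Ideal.span {r | ∃ a ∈ H, ∃ b ∈ H, ∃ i, r = (a ⨯₃ b) i} = ⊤

theorem apply_eq_dotProduct (φ : (Fin 3 → R) →ₗ[R] R) (v : Fin 3 → R) :
    φ v = v ⬝ᵥ fun i => φ (Pi.single i 1) := by
  conv_lhs => rw [pi_eq_sum_univ' v]
  simp only [map_sum, map_smul, smul_eq_mul, dotProduct]

/-- Over a local ring the split sequence consists of free modules, so `N` is free of rank `3 - 2`.
The functional `ξ` is the coordinate on `N` extended by the splitting. -/
theorem exists_span_singleton_of_isLocalRing [IsLocalRing R] (N : Submodule R (Fin 3 → R))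
    [Module.Projective R ((Fin 3 → R) ⧸ N)]
    (hN : ∀ p, rankAtStalk (R := R) ((Fin 3 → R) ⧸ N) p = 2) :
    ∃ x ξ : Fin 3 → R, x ⬝ᵥ ξ = 1 ∧ N = Submodule.span R {x} := by
  obtain ⟨g, hg⟩ := N.mkQ.exists_rightInverse_of_surjective
    (LinearMap.range_eq_top.2 N.mkQ_surjective)
  have hex : Function.Exact N.subtype N.mkQ := LinearMap.exact_subtype_mkQ N
  obtain ⟨E, hE⟩ := hex.splitSurjectiveEquiv (Submodule.injective_subtype _) ⟨g, hg⟩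
  have hE1 : ∀ n : N, E n = (n, 0) := fun n => by
    have := LinearMap.congr_fun hE.1 n
    rw [Submodule.subtype_apply, LinearMap.comp_apply, LinearEquiv.coe_coe,
      LinearEquiv.eq_symm_apply] at this
    exact this
  have : Module.Finite R N :=
    Module.Finite.of_surjective (LinearMap.fst R _ _ ∘ₗ E.toLinearMap)
      (Prod.fst_surjective.comp E.surjective)
  have : Module.Projective R N :=
    Module.Projective.of_split (E.symm.toLinearMap ∘ₗ LinearMap.inl R _ _)
      (LinearMap.fst R _ _ ∘ₗ E.toLinearMap) (by ext x; simp)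
  have : Module.Free R N := free_of_flat_of_isLocalRing
  have : Module.Free R ((Fin 3 → R) ⧸ N) := free_of_flat_of_isLocalRing
  have h2 : finrank R ((Fin 3 → R) ⧸ N) = 2 := by
    have := hN (IsLocalRing.closedPoint R)
    rwa [rankAtStalk_eq_finrank_of_free] at this
  have h1 : finrank R N = 1 := by
    have := E.finrank_eq
    rw [finrank_prod, h2, finrank_fin_fun] at this
    omega
  let b : Basis (Fin 1) R N := Module.finBasisOfFinrankEq R N h1
  let φ : (Fin 3 → R) →ₗ[R] R := b.coord 0 ∘ₗ LinearMap.fst R _ _ ∘ₗ E.toLinearMap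
  refine ⟨b 0, fun i => φ (Pi.single i 1), ?_, ?_⟩
  · have h3 : φ (b 0 : Fin 3 → R) = 1 := by simp [φ, hE1]
    exact (apply_eq_dotProduct φ _).symm.trans h3
  · apply le_antisymm
    · intro n hn
      rw [Submodule.mem_span_singleton]
      refine ⟨b.repr ⟨n, hn⟩ 0, ?_⟩
      have := congrArg Subtype.val (b.sum_repr ⟨n, hn⟩)
      simpa using this
    · rw [Submodule.span_singleton_le_iff_mem]
      exact (b 0).2

/-- The quotient is free of rank one: `y` is the quotient map and `η` a lift of a generator. -/
theorem exists_equation_of_isLocalRing [IsLocalRing R] (N : Submodule R (Fin 3 → R))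
    [Module.Projective R ((Fin 3 → R) ⧸ N)]
    (hN : ∀ p, rankAtStalk (R := R) ((Fin 3 → R) ⧸ N) p = 1) :
    ∃ y η : Fin 3 → R, y ⬝ᵥ η = 1 ∧ ∀ v, v ∈ N ↔ v ⬝ᵥ y = 0 := by
  have : Module.Free R ((Fin 3 → R) ⧸ N) := free_of_flat_of_isLocalRing
  have h1 : finrank R ((Fin 3 → R) ⧸ N) = 1 := by
    have := hN (IsLocalRing.closedPoint R)
    rwa [rankAtStalk_eq_finrank_of_free] at this
  let b : Basis (Fin 1) R _ := Module.finBasisOfFinrankEq R ((Fin 3 → R) ⧸ N) h1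
  let φ : (Fin 3 → R) →ₗ[R] R := b.coord 0 ∘ₗ N.mkQ
  have hφ := apply_eq_dotProduct φ
  obtain ⟨η, hη⟩ := N.mkQ_surjective (b 0)
  refine ⟨fun i => φ (Pi.single i 1), η, ?_, fun v => ?_⟩
  · rw [dotProduct_comm, ← hφ, LinearMap.comp_apply, hη]
    simp
  · rw [← hφ, LinearMap.comp_apply, ← Submodule.Quotient.mk_eq_zero, ← Submodule.mkQ_apply]
    constructor
    · intro h; rw [h, map_zero]
    · intro h
      apply b.ext_elem
      intro i
      rw [Subsingleton.elim i 0]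
      simpa using h

/-- The identity `(a × b) × (v × e) = v ((a × b) · e) - e ((a × b) · v)`. -/
theorem IsPlane.smul_sub_mem {H : Submodule R (Fin 3 → R)} {a b : Fin 3 → R} (ha : a ∈ H)
    (hb : b ∈ H) (v : Fin 3 → R) (i : Fin 3) :
    (a ⨯₃ b) i • v - (v ⬝ᵥ a ⨯₃ b) • Pi.single i 1 ∈ H := by
  have h : (a ⨯₃ b) i • v - (v ⬝ᵥ a ⨯₃ b) • Pi.single i 1 =
      (a ⬝ᵥ v ⨯₃ Pi.single i 1) • b - (b ⬝ᵥ v ⨯₃ Pi.single i 1) • a := by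
    ext j
    fin_cases i <;> fin_cases j <;>
      simp [cross_apply, dotProduct, Fin.sum_univ_three] <;> ring
  rw [h]
  exact sub_mem (H.smul_mem _ hb) (H.smul_mem _ ha)

/-- The scalars `r` for which `r • id` on the quotient lifts to `R³` form an ideal. It contains
every `(a × b) i`, hence `1`, and the quotient map splits. -/
theorem IsPlane.projective {H : Submodule R (Fin 3 → R)} (h : IsPlane H) :
    Module.Projective R ((Fin 3 → R) ⧸ H) := by
  have key : ∀ r ∈ Ideal.span {r | ∃ a ∈ H, ∃ b ∈ H, ∃ i, r = (a ⨯₃ b) i},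
      ∃ Q : (Fin 3 → R) →ₗ[R] (Fin 3 → R), (∀ v ∈ H, Q v = 0) ∧ ∀ v, r • v - Q v ∈ H := by
    intro r hr
    induction hr using Submodule.span_induction with
    | mem r hr =>
      obtain ⟨a, ha, b, hb, i, rfl⟩ := hr
      -- The lift `v ↦ (v · (a × b)) eᵢ` comes from `IsPlane.smul_sub_mem`.
      refine ⟨(dotProductBilin R R (a ⨯₃ b)).smulRight (Pi.single i 1), fun v hv => ?_,
        fun v => ?_⟩
      · have := h.det_eq_zero v hv a ha b hb
        rw [dotProduct_comm] at this
        simp [this]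
      · have := IsPlane.smul_sub_mem ha hb v i
        rw [dotProduct_comm] at this
        simpa using this
    | zero => exact ⟨0, fun _ _ => rfl, fun v => by simp⟩
    | add r s _ _ hr hs =>
      obtain ⟨Q, hQ, hQ'⟩ := hr
      obtain ⟨Q', hQ1, hQ1'⟩ := hs
      refine ⟨Q + Q', fun v hv => by simp [hQ v hv, hQ1 v hv], fun v => ?_⟩
      have := add_mem (hQ' v) (hQ1' v)
      rw [LinearMap.add_apply, add_smul]
      convert this using 1
      abel
    | smul c r _ hr =>
      obtain ⟨Q, hQ, hQ'⟩ := hr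
      refine ⟨c • Q, fun v hv => by simp [hQ v hv], fun v => ?_⟩
      have := H.smul_mem c (hQ' v)
      rwa [smul_sub, smul_smul] at this
  obtain ⟨Q, hQ, hQ'⟩ := key 1 (by rw [h.span_eq_top]; trivial)
  refine Module.Projective.of_split (H.liftQ Q hQ) H.mkQ ?_
  apply Submodule.linearMap_qext
  apply LinearMap.ext
  intro v
  have := hQ' v
  rw [one_smul] at this
  exact ((Submodule.Quotient.eq H).2 this).symm

/-- Some `(a × b) i` is invertible at `p`. The maps `v ↦ v · (a × b)` and `r ↦ r eᵢ` between the
quotient and `R` are inverse up to this scalar. -/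
theorem IsPlane.rankAtStalk_eq {H : Submodule R (Fin 3 → R)} (h : IsPlane H) (p : PrimeSpectrum R) :
    rankAtStalk (R := R) ((Fin 3 → R) ⧸ H) p = 1 := by
  obtain ⟨r, ⟨a, ha, b, hb, i, rfl⟩, hr⟩ :
      ∃ r ∈ {r | ∃ a ∈ H, ∃ b ∈ H, ∃ i, r = (a ⨯₃ b) i}, r ∉ p.asIdeal := by
    by_contra! hc
    have := Ideal.span_le.2 hc
    rw [h.span_eq_top] at this
    exact p.isPrime.ne_top (top_le_iff.1 this)
  rw [rankAtStalk_eq_finrank_tensorProduct]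
  let S := Localization.AtPrime p.asIdeal
  have hu : IsUnit (algebraMap R S ((a ⨯₃ b) i)) :=
    IsLocalization.map_units S (⟨_, hr⟩ : p.asIdeal.primeCompl)
  obtain ⟨c, hc⟩ := hu.exists_left_inv
  let φ : ((Fin 3 → R) ⧸ H) →ₗ[R] R := H.liftQ (dotProductBilin R R (a ⨯₃ b)) (fun v hv => by
    have := h.det_eq_zero v hv a ha b hb
    rw [dotProduct_comm] at this
    simpa using this)
  let ψ : R →ₗ[R] ((Fin 3 → R) ⧸ H) := LinearMap.toSpanSingleton R _ (H.mkQ (Pi.single i 1))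
  have h1 : φ ∘ₗ ψ = (a ⨯₃ b) i • LinearMap.id := by
    ext
    simp [φ, ψ]
  have h2 : ψ ∘ₗ φ = (a ⨯₃ b) i • LinearMap.id := by
    apply Submodule.linearMap_qext
    apply LinearMap.ext
    intro v
    have := IsPlane.smul_sub_mem ha hb v i
    rw [dotProduct_comm] at this
    exact ((Submodule.Quotient.eq H).2 this).symm
  have hS : ∀ {N : Type _} [AddCommGroup N] [Module R N] (z : S ⊗[R] N),
      c • ((a ⨯₃ b) i • LinearMap.id (R := R) (M := N)).baseChange S z = z := by
    intro N _ _ z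
    rw [LinearMap.baseChange_smul, LinearMap.baseChange_id, LinearMap.smul_apply,
      ← algebraMap_smul S ((a ⨯₃ b) i), smul_smul, hc, one_smul, LinearMap.id_apply]
  let E : S ⊗[R] ((Fin 3 → R) ⧸ H) ≃ₗ[S] S ⊗[R] R :=
    LinearEquiv.ofLinearMap (φ.baseChange S) (c • ψ.baseChange S)
      (by
        apply LinearMap.ext
        intro z
        rw [LinearMap.comp_apply, LinearMap.smul_apply, map_smul, ← LinearMap.comp_apply,
          ← LinearMap.baseChange_comp, h1, hS, LinearMap.id_apply])
      (by
        apply LinearMap.ext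
        intro z
        rw [LinearMap.comp_apply, LinearMap.smul_apply, ← LinearMap.comp_apply,
          ← LinearMap.baseChange_comp, h2, hS, LinearMap.id_apply])
  rw [(E ≪≫ₗ TensorProduct.AlgebraTensorModule.rid R S S).finrank_eq, finrank_self]

end LinesAndPlanes

/-! ### Cross-product identities -/

section Planes

variable {R : Type*} [CommRing R]

/-- Cramer's relation among three dependent vectors, with explicit coefficients. It stands in for
writing an element of a plane in a basis. -/
theorem smul_add_smul_add_smul_eq_zero {a b c : Fin 3 → R} (h : a ⬝ᵥ b ⨯₃ c = 0) (i j : Fin 3) :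
    (b ⨯₃ c) j * a i + (c ⨯₃ a) j * b i + (a ⨯₃ b) j * c i = 0 := by
  simp only [cross_apply, dotProduct, Fin.sum_univ_three, Matrix.cons_val_zero, Matrix.cons_val_one,
    Matrix.cons_val] at h
  fin_cases i <;> fin_cases j <;> simp [cross_apply] <;>
    first | ring1 | linear_combination h

theorem cross_eq_zero_iff {a b : Fin 3 → R} : a ⨯₃ b = 0 ↔ ∀ i j, a i * b j = a j * b i := by
  constructor
  · intro h i j
    have h0 := congrFun h 0
    have h1 := congrFun h 1
    have h2 := congrFun h 2
    simp [cross_apply] at h0 h1 h2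
    fin_cases i <;> fin_cases j <;> simp <;>
      first
        | linear_combination h0 | linear_combination h1 | linear_combination h2
        | linear_combination -h0 | linear_combination -h1 | linear_combination -h2
  · intro h
    ext i
    fin_cases i <;> simp [cross_apply]
    · linear_combination h 1 2
    · linear_combination h 2 0
    · linear_combination h 0 1

theorem IsLine.mul_comm_apply {ℓ : Submodule R (Fin 3 → R)} (h : IsLine ℓ) {a b : Fin 3 → R}
    (ha : a ∈ ℓ) (hb : b ∈ ℓ) (i j : Fin 3) : a i * b j = a j * b i :=
  cross_eq_zero_iff.1 (h.cross_eq_zero a ha b hb) i j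

/-- Proportionality gives `a i • v = v i • a ∈ ℓ`, and the scalars `a i` generate the unit ideal. -/
theorem IsLine.mem_of_cross_eq_zero {ℓ : Submodule R (Fin 3 → R)} (h : IsLine ℓ) {v : Fin 3 → R}
    (hv : ∀ a ∈ ℓ, a ⨯₃ v = 0) : v ∈ ℓ := by
  apply Submodule.mem_of_span_top_of_smul_mem _ _ h.span_eq_top
  rintro ⟨_, a, ha, i, rfl⟩
  have : a i • v = v i • a := by
    ext j
    have := cross_eq_zero_iff.1 (hv a ha) i j
    simp [this, mul_comm]
  rw [this]
  exact ℓ.smul_mem _ ha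

theorem IsPlane.eq_zero_of_pow_mul_eq_zero {H : Submodule R (Fin 3 → R)} (h : IsPlane H) {r : R}
    (n : ℕ) (hr : ∀ a ∈ H, ∀ b ∈ H, ∀ i, (a ⨯₃ b) i ^ n * r = 0) : r = 0 := by
  have := Submodule.mem_of_span_eq_top_of_smul_pow_mem (⊥ : Submodule R R) _ h.span_eq_top r (by
    rintro ⟨_, a, ha, b, hb, i, rfl⟩
    exact ⟨n, hr a ha b hb i⟩)
  simpa using this

theorem IsPlane.mem_of_dotProduct_eq_zero {H : Submodule R (Fin 3 → R)} (h : IsPlane H)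
    {v : Fin 3 → R} (hv : ∀ a ∈ H, ∀ b ∈ H, v ⬝ᵥ a ⨯₃ b = 0) : v ∈ H := by
  apply Submodule.mem_of_span_top_of_smul_mem _ _ h.span_eq_top
  rintro ⟨_, a, ha, b, hb, i, rfl⟩
  have := IsPlane.smul_sub_mem ha hb v i
  rwa [hv a ha b hb, zero_smul, sub_zero] at this

/-- `⋀² H` has rank one: `(a × b) × (c × d)` is a combination of vectors whose coefficients are
determinants of triples from `H`. -/
theorem IsPlane.mul_comm_apply {H : Submodule R (Fin 3 → R)} (h : IsPlane H)
    {a b c d : Fin 3 → R} (ha : a ∈ H) (hb : b ∈ H) (hc : c ∈ H) (hd : d ∈ H) (i j : Fin 3) :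
    (a ⨯₃ b) i * (c ⨯₃ d) j = (a ⨯₃ b) j * (c ⨯₃ d) i := by
  refine cross_eq_zero_iff.1 ?_ i j
  rw [cross_cross_eq_smul_sub_smul, h.det_eq_zero a ha c hc d hd, h.det_eq_zero b hb c hc d hd,
    zero_smul, zero_smul, sub_zero]

theorem mul_eq_zero_of_dotProduct_eq_zero {y a b c : Fin 3 → R} (ha : a ⬝ᵥ y = 0)
    (hb : b ⬝ᵥ y = 0) (hc : c ⬝ᵥ y = 0) (i : Fin 3) : y i * (a ⬝ᵥ b ⨯₃ c) = 0 := by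
  simp only [dotProduct, Fin.sum_univ_three] at ha hb hc ⊢
  simp only [cross_apply, Matrix.cons_val_zero, Matrix.cons_val_one, Matrix.cons_val]
  fin_cases i <;> simp
  · linear_combination (b 1 * c 2 - b 2 * c 1) * ha + (c 1 * a 2 - c 2 * a 1) * hb +
      (a 1 * b 2 - a 2 * b 1) * hc
  · linear_combination (b 2 * c 0 - b 0 * c 2) * ha + (c 2 * a 0 - c 0 * a 2) * hb +
      (a 2 * b 0 - a 0 * b 2) * hc
  · linear_combination (b 0 * c 1 - b 1 * c 0) * ha + (c 0 * a 1 - c 1 * a 0) * hb +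
      (a 0 * b 1 - a 1 * b 0) * hc

theorem cross_eq_smul_of_dotProduct_eq_zero {y η a b : Fin 3 → R} (hy : y ⬝ᵥ η = 1)
    (ha : a ⬝ᵥ y = 0) (hb : b ⬝ᵥ y = 0) : a ⨯₃ b = (a ⨯₃ b ⬝ᵥ η) • y := by
  have h1 : (a ⨯₃ b) ⨯₃ y = 0 := by
    rw [cross_cross_eq_smul_sub_smul, ha, hb, zero_smul, zero_smul, sub_zero]
  ext i
  have h2 := cross_eq_zero_iff.1 h1 i
  rw [Pi.smul_apply, smul_eq_mul, dotProduct, Finset.sum_mul]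
  calc (a ⨯₃ b) i = (a ⨯₃ b) i * (y ⬝ᵥ η) := by rw [hy, mul_one]
    _ = _ := by
      rw [dotProduct, Finset.mul_sum]
      refine Finset.sum_congr rfl fun j _ => ?_
      linear_combination η j * h2 j

end Planes

/-! ### Subspaces whose triple products lie in the graph -/

section Graph

variable {R : Type*} [CommRing R]

/-- The triple products of elements of `L ⊆ U ⊕ E` have no component in `⋀³ E`, and their components
in `⋀² U ⊗ E` are the images under `G` of their components in `U ⊗ ⋀² E`. -/
def InGraph (G : Fin 3 → Fin 3 → Fin 3 → Fin 3 → R) (L : Submodule R ((Fin 3 → R) × (Fin 3 → R))) :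
    Prop :=
  ∀ w₁ ∈ L, ∀ w₂ ∈ L, ∀ w₃ ∈ L, w₁.2 ⬝ᵥ w₂.2 ⨯₃ w₃.2 = 0 ∧ ∀ k l,
    mix w₁.2 w₁.1 w₂.2 w₂.1 w₃.2 w₃.1 l k =
      ∑ i, ∑ j, G i j k l * mix w₁.1 w₁.2 w₂.1 w₂.2 w₃.1 w₃.2 i j

/-- The contraction of `G` with `x ⊗ y`. -/
def contr (G : Fin 3 → Fin 3 → Fin 3 → Fin 3 → R) (x y : Fin 3 → R) (k l : Fin 3) : R :=
  ∑ i, ∑ j, G i j k l * (x i * y j)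

variable {G : Fin 3 → Fin 3 → Fin 3 → Fin 3 → R}

theorem contr_smul_left (c : R) (x y : Fin 3 → R) (k l : Fin 3) :
    contr G (c • x) y k l = c * contr G x y k l := by
  simp only [contr, Finset.mul_sum, Pi.smul_apply, smul_eq_mul]
  refine Finset.sum_congr rfl fun i _ => Finset.sum_congr rfl fun j _ => ?_
  ring

theorem contr_smul_right (c : R) (x y : Fin 3 → R) (k l : Fin 3) :
    contr G x (c • y) k l = c * contr G x y k l := by
  simp only [contr, Finset.mul_sum, Pi.smul_apply, smul_eq_mul]
  refine Finset.sum_congr rfl fun i _ => Finset.sum_congr rfl fun j _ => ?_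
  ring

theorem mix_zero_left (x : Fin 3 → R) (h m h' m' : Fin 3 → R) (l k : Fin 3) :
    mix 0 x h m h' m' l k = h l * (m' ⨯₃ x) k + h' l * (x ⨯₃ m) k := by
  simp [mix]

theorem mix_zero_right (x : Fin 3 → R) (h m h' m' : Fin 3 → R) (l k : Fin 3) :
    mix x 0 m h m' h' l k = x l * (h ⨯₃ h') k := by
  simp [mix]

/-- The basic equation of the correspondence, obtained by taking one of the three vectors in `U`. -/
theorem InGraph.eq_contr {L : Submodule R ((Fin 3 → R) × (Fin 3 → R))} (hL : InGraph G L)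
    {x m h m' h' : Fin 3 → R} (hx : (x, 0) ∈ L) (hw : (m, h) ∈ L) (hw' : (m', h') ∈ L)
    (k l : Fin 3) :
    h l * (m' ⨯₃ x) k + h' l * (x ⨯₃ m) k = contr G x (h ⨯₃ h') k l := by
  have := (hL _ hx _ hw _ hw').2 k l
  simp only [mix_zero_left, mix_zero_right] at this
  exact this

/-- In `InGraph.eq_contr` the left side is built from cross products with `x` in the index `k` and
from vectors orthogonal to `y` in the index `l`. Hence contraction with `x` or `y` gives zero; this
is how points of `F_A` become singular points. -/
theorem InGraph.contr_dotProduct {L : Submodule R ((Fin 3 → R) × (Fin 3 → R))}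
    (hL : InGraph G L) {x y η : Fin 3 → R} (hy : y ⬝ᵥ η = 1) (hx : (x, 0) ∈ L)
    (hH : ∀ v, v ⬝ᵥ y = 0 → ∃ m, (m, v) ∈ L) :
    (∀ l, (fun k => contr G x y k l) ⬝ᵥ x = 0) ∧ ∀ k, contr G x y k ⬝ᵥ y = 0 := by
  -- Take `h = y × e_{n+1}` and `h' = y × e_{n+2}`, both orthogonal to `y`, for which `h × h' = y n
  -- • y`.
  have key : ∀ n, ∃ h m h' m' : Fin 3 → R, h ⬝ᵥ y = 0 ∧ h' ⬝ᵥ y = 0 ∧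
      ∀ k l, h l * (m' ⨯₃ x) k + h' l * (x ⨯₃ m) k = y n * contr G x y k l := by
    intro n
    have h1 : (y ⨯₃ Pi.single (n + 1) 1) ⬝ᵥ y = 0 := by
      rw [dotProduct_comm, dot_self_cross]
    have h2 : (y ⨯₃ Pi.single (n + 2) 1) ⬝ᵥ y = 0 := by
      rw [dotProduct_comm, dot_self_cross]
    obtain ⟨m, hm⟩ := hH _ h1
    obtain ⟨m', hm'⟩ := hH _ h2
    have h3 : (y ⨯₃ Pi.single (n + 1) 1) ⨯₃ (y ⨯₃ Pi.single (n + 2) 1) = y n • y := by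
      ext j
      fin_cases n <;> fin_cases j <;> simp [cross_apply] <;> ring
    refine ⟨_, m, _, m', h1, h2, fun k l => ?_⟩
    rw [hL.eq_contr hx hm hm', h3, contr_smul_right]
  have hmul : ∀ r : R, (∀ n, y n * r = 0) → r = 0 := by
    intro r hr
    have : (y ⬝ᵥ η) * r = 0 := by
      rw [dotProduct, Finset.sum_mul]
      refine Finset.sum_eq_zero fun n _ => ?_
      rw [mul_right_comm, hr, zero_mul]
    rwa [hy, one_mul] at this
  constructor
  · intro l
    apply hmul
    intro n
    obtain ⟨h, m, h', m', -, -, he⟩ := key n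
    simp only [dotProduct, Fin.sum_univ_three]
    have e0 := he 0 l
    have e1 := he 1 l
    have e2 := he 2 l
    simp [cross_apply] at e0 e1 e2
    linear_combination -x 0 * e0 - x 1 * e1 - x 2 * e2
  · intro k
    apply hmul
    intro n
    obtain ⟨h, m, h', m', hh, hh', he⟩ := key n
    simp only [dotProduct, Fin.sum_univ_three] at hh hh' ⊢
    linear_combination -y 0 * he k 0 - y 1 * he k 1 - y 2 * he k 2 + (m' ⨯₃ x) k * hh +
      (x ⨯₃ m) k * hh'

/-- If `w.2 l ≠ 0`, proportionality places the kernel of the `l`-th `E`-coordinate, of dimension at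
least two, inside `U`. For independent `x`, `y` there, the product of `w`, `x`, `y` has the nonzero
component `w.2 ⊗ (x × y)` in `⋀² U ⊗ E` but none in `U ⊗ ⋀² E`, contradicting the graph condition.
-/
theorem InGraph.snd_eq_zero {K : Type*} [Field K] {G : Fin 3 → Fin 3 → Fin 3 → Fin 3 → K}
    {L : Submodule K ((Fin 3 → K) × (Fin 3 → K))} (hL : InGraph G L) (hr : finrank K L = 3)
    (hc : ∀ w ∈ L, ∀ w' ∈ L, w.2 ⨯₃ w'.2 = 0) {w : (Fin 3 → K) × (Fin 3 → K)} (hw : w ∈ L) :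
    w.2 = 0 := by
  ext l
  by_contra hl
  let φ : L →ₗ[K] K := LinearMap.proj l ∘ₗ LinearMap.snd K _ _ ∘ₗ L.subtype
  have h2 : 1 < finrank K (LinearMap.ker φ) := by
    have h3 := φ.finrank_range_add_finrank_ker
    have h4 := (LinearMap.range φ).finrank_le
    rw [finrank_self] at h4
    omega
  have hz : ∀ z : LinearMap.ker φ, (z : (Fin 3 → K) × (Fin 3 → K)).2 = 0 := by
    intro z
    have hzl : (z : (Fin 3 → K) × (Fin 3 → K)).2 l = 0 := z.2
    ext m
    have := cross_eq_zero_iff.1 (hc w hw z z.1.2) l m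
    rw [hzl, mul_zero] at this
    exact (mul_eq_zero.1 this).resolve_left hl
  have : Nontrivial (LinearMap.ker φ) := nontrivial_of_finrank_pos (R := K) (by omega)
  obtain ⟨x, hx⟩ := exists_ne (0 : LinearMap.ker φ)
  obtain ⟨y, hxy⟩ := exists_linearIndependent_pair_of_one_lt_finrank (R := K)
    (M := LinearMap.ker φ) h2 hx
  let ψ : LinearMap.ker φ →ₗ[K] (Fin 3 → K) :=
    LinearMap.fst K _ _ ∘ₗ L.subtype ∘ₗ (LinearMap.ker φ).subtype
  have hψ : LinearMap.ker ψ = ⊥ := by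
    rw [LinearMap.ker_eq_bot']
    intro z h0
    exact Subtype.ext (Subtype.ext (Prod.ext h0 (hz z)))
  have hli := hxy.map' ψ hψ
  have heq : ψ ∘ ![x, y] = ![ψ x, ψ y] := by
    ext i; fin_cases i <;> rfl
  rw [heq, ← crossProduct_ne_zero_iff_linearIndependent] at hli
  apply hli
  ext k
  have h5 := (hL _ hw _ x.1.2 _ y.1.2).2 k l
  rw [hz x, hz y] at h5
  simp only [mix, map_zero, LinearMap.zero_apply, Pi.zero_apply, zero_mul, mul_zero, add_zero,
    Finset.sum_const_zero] at h5
  exact (mul_eq_zero.1 h5).resolve_left hl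

/-- Subtracting the basic equations for two lifts leaves a homogeneous one. Eliminating `h'` from it
shows that `(h × h') j` times the difference of the lifts of `h` lies in `ℓ`. -/
theorem InGraph.le {ℓ H : Submodule R (Fin 3 → R)} (hℓ : IsLine ℓ) (hH : IsPlane H)
    {L L' : Submodule R ((Fin 3 → R) × (Fin 3 → R))} (hL : InGraph G L) (hL' : InGraph G L')
    (h1 : L.comap (LinearMap.inl R _ _) = ℓ) (h1' : L'.comap (LinearMap.inl R _ _) = ℓ)
    (h2 : L.map (LinearMap.snd R _ _) = H) (h2' : L'.map (LinearMap.snd R _ _) = H) : L ≤ L' := by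
  have hmem : ∀ x ∈ ℓ, (x, 0) ∈ L := fun x hx => by rw [← h1] at hx; exact hx
  have hmem' : ∀ x ∈ ℓ, (x, 0) ∈ L' := fun x hx => by rw [← h1'] at hx; exact hx
  have hlift : ∀ w ∈ L, ∃ m', (m', w.2) ∈ L' := by
    intro w hw
    have : w.2 ∈ H := h2 ▸ ⟨w, hw, rfl⟩
    rw [← h2'] at this
    obtain ⟨⟨m', b⟩, hm', rfl⟩ := this
    exact ⟨m', hm'⟩
  have key : ∀ w ∈ L, ∀ w' ∈ L, ∀ j, (w.2 ⨯₃ w'.2) j • w ∈ L' := by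
    rintro ⟨m, h⟩ hw ⟨m', h'⟩ hw' j
    obtain ⟨n, hn⟩ := hlift _ hw
    obtain ⟨n', hn'⟩ := hlift _ hw'
    have hδ : (h ⨯₃ h') j • (m - n) ∈ ℓ := by
      apply hℓ.mem_of_cross_eq_zero
      intro x hx
      have e1 := fun k l => hL.eq_contr (hmem x hx) hw hw' k l
      have e2 := fun k l => hL'.eq_contr (hmem' x hx) hn hn' k l
      have e3 : ∀ k l, h l * ((m' - n') ⨯₃ x) k + h' l * (x ⨯₃ (m - n)) k = 0 := by
        intro k l
        have := (e1 k l).trans (e2 k l).symm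
        simp only [map_sub, LinearMap.sub_apply, Pi.sub_apply]
        linear_combination this
      rw [map_smul]
      ext k
      have f0 := e3 k 0
      have f1 := e3 k 1
      have f2 := e3 k 2
      simp only [Pi.smul_apply, smul_eq_mul, Pi.zero_apply]
      generalize (x ⨯₃ (m - n)) k = X at *
      generalize ((m' - n') ⨯₃ x) k = Y at *
      fin_cases j <;> simp [cross_apply]
      · linear_combination h 1 * f2 - h 2 * f1
      · linear_combination h 2 * f0 - h 0 * f2
      · linear_combination h 0 * f1 - h 1 * f0
    have := add_mem (hmem' _ hδ) (L'.smul_mem ((h ⨯₃ h') j) hn)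
    convert this using 1
    simp [smul_sub]
  intro w hw
  apply Submodule.mem_of_span_eq_top_of_smul_pow_mem _ _ hH.span_eq_top
  rintro ⟨_, b, hb, b', hb', j, rfl⟩
  -- One factor `(v × v') j` expresses `w` through `ℓ`, `v` and `v'` by Cramer's relation; the other
  -- moves `v` and `v'` into `L'` by `key`.
  refine ⟨2, ?_⟩
  rw [← h2] at hb hb'
  obtain ⟨v, hv, rfl⟩ := hb
  obtain ⟨v', hv', rfl⟩ := hb'
  simp only [LinearMap.snd_apply]
  have hdet := (hL w hw v hv v' hv').1
  have hx : (v.2 ⨯₃ v'.2) j • w + (v'.2 ⨯₃ w.2) j • v + (w.2 ⨯₃ v.2) j • v' ∈ L :=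
    add_mem (add_mem (L.smul_mem _ hw) (L.smul_mem _ hv)) (L.smul_mem _ hv')
  have hx0 : ((v.2 ⨯₃ v'.2) j • w + (v'.2 ⨯₃ w.2) j • v + (w.2 ⨯₃ v.2) j • v').2 = 0 := by
    ext i
    simpa using smul_add_smul_add_smul_eq_zero hdet i j
  have hx' : (v.2 ⨯₃ v'.2) j • w + (v'.2 ⨯₃ w.2) j • v + (w.2 ⨯₃ v.2) j • v' ∈ L' := by
    generalize (v.2 ⨯₃ v'.2) j • w + (v'.2 ⨯₃ w.2) j • v + (w.2 ⨯₃ v.2) j • v' = z at hx hx0 ⊢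
    obtain ⟨x, y⟩ := z
    obtain rfl : y = 0 := hx0
    apply hmem'
    rw [← h1]
    exact hx
  have hv1 := key v hv v' hv' j
  have hv2 := key v' hv' v hv j
  have h5 : (v'.2 ⨯₃ v.2) j = -(v.2 ⨯₃ v'.2) j := by
    rw [← cross_anticomm]; rfl
  rw [h5] at hv2
  have := sub_mem (sub_mem (L'.smul_mem ((v.2 ⨯₃ v'.2) j) hx') (L'.smul_mem ((v'.2 ⨯₃ w.2) j) hv1))
    (L'.smul_mem (-(w.2 ⨯₃ v.2) j) hv2)
  convert this using 1
  module

end Graph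

/-! ### Recovering `Λ` from a singular point -/

section Reconstruction

variable {R : Type*} [CommRing R] {G : Fin 3 → Fin 3 → Fin 3 → Fin 3 → R}
  {ℓ H : Submodule R (Fin 3 → R)}

/-- The singularity condition for the line `ℓ` and the plane `H`. -/
structure IsSingular (G : Fin 3 → Fin 3 → Fin 3 → Fin 3 → R) (ℓ H : Submodule R (Fin 3 → R)) :
    Prop where
  left : ∀ x ∈ ℓ, ∀ x' ∈ ℓ, ∀ h ∈ H, ∀ h' ∈ H, ∀ l,
    (fun k => contr G x (h ⨯₃ h') k l) ⬝ᵥ x' = 0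
  right : ∀ x ∈ ℓ, ∀ h ∈ H, ∀ h' ∈ H, ∀ g ∈ H, ∀ g' ∈ H, ∀ k,
    contr G x (h ⨯₃ h') k ⬝ᵥ g ⨯₃ g' = 0

/-- The submodule of `U ⊕ E` reconstructed from a singular point `(ℓ, H)`. -/
def reconstruct (G : Fin 3 → Fin 3 → Fin 3 → Fin 3 → R) (ℓ H : Submodule R (Fin 3 → R)) :
    Submodule R ((Fin 3 → R) × (Fin 3 → R)) where
  -- The cross product of `InGraph.eq_contr` with `h` eliminates the second vector `m'` and leaves a
  -- condition linear in the single vector `w`.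
  carrier := {w | w.2 ∈ H ∧ ∀ x ∈ ℓ, ∀ g ∈ H, ∀ g' ∈ H, ∀ k j,
    (g ⨯₃ g') j * (x ⨯₃ w.1) k = (w.2 ⨯₃ contr G x (g ⨯₃ g') k) j}
  add_mem' := by
    rintro w w' ⟨h1, h2⟩ ⟨h1', h2'⟩
    refine ⟨add_mem h1 h1', fun x hx g hg g' hg' k j => ?_⟩
    simp only [Prod.fst_add, Prod.snd_add, map_add, LinearMap.add_apply, Pi.add_apply, mul_add,
      h2 x hx g hg g' hg' k j, h2' x hx g hg g' hg' k j]
  zero_mem' := ⟨H.zero_mem, fun x hx g hg g' hg' k j => by simp⟩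
  smul_mem' := by
    rintro c w ⟨h1, h2⟩
    refine ⟨H.smul_mem c h1, fun x hx g hg g' hg' k j => ?_⟩
    simp only [Prod.smul_fst, Prod.smul_snd, map_smul, LinearMap.smul_apply, Pi.smul_apply,
      smul_eq_mul, ← h2 x hx g hg g' hg' k j]
    ring

theorem IsSingular.contr_mem (h : IsSingular G ℓ H) (hH : IsPlane H) {x g g' : Fin 3 → R}
    (hx : x ∈ ℓ) (hg : g ∈ H) (hg' : g' ∈ H) (k : Fin 3) : contr G x (g ⨯₃ g') k ∈ H :=
  hH.mem_of_dotProduct_eq_zero fun a ha b hb => h.right x hx g hg g' hg' a ha b hb k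

theorem IsLine.mul_contr (hℓ : IsLine ℓ) {x x' : Fin 3 → R} (hx : x ∈ ℓ) (hx' : x' ∈ ℓ)
    (y : Fin 3 → R) (i k l : Fin 3) : x' i * contr G x y k l = x i * contr G x' y k l := by
  rw [← contr_smul_left, ← contr_smul_left]
  have : x' i • x = x i • x' := by
    ext j
    simpa [mul_comm] using hℓ.mul_comm_apply hx' hx i j
  rw [this]

theorem IsPlane.mul_contr (hH : IsPlane H) {a b c d : Fin 3 → R} (ha : a ∈ H) (hb : b ∈ H)
    (hc : c ∈ H) (hd : d ∈ H) (x : Fin 3 → R) (i k l : Fin 3) :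
    (c ⨯₃ d) i * contr G x (a ⨯₃ b) k l = (a ⨯₃ b) i * contr G x (c ⨯₃ d) k l := by
  rw [← contr_smul_right, ← contr_smul_right]
  have : (c ⨯₃ d) i • (a ⨯₃ b) = (a ⨯₃ b) i • (c ⨯₃ d) := by
    ext j
    simpa [mul_comm] using hH.mul_comm_apply hc hd ha hb i j
  rw [this]

/-- For `w.2 = 0` the defining equation reduces to `(g × g') j * (x × m) k = 0`, that is, `m ∈ ℓ`.
-/
theorem comap_inl_reconstruct (hℓ : IsLine ℓ) (hH : IsPlane H) :
    (reconstruct G ℓ H).comap (LinearMap.inl R _ _) = ℓ := by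
  ext m
  constructor
  · rintro ⟨-, hm⟩
    apply hℓ.mem_of_cross_eq_zero
    intro x hx
    ext k
    apply hH.eq_zero_of_pow_mul_eq_zero 1
    intro g hg g' hg' j
    simpa using hm x hx g hg g' hg' k j
  · intro hm
    refine ⟨H.zero_mem, fun x hx g hg g' hg' k j => ?_⟩
    simp [hℓ.cross_eq_zero x hx m hm]

/-- Solvability is where both halves of the singularity condition enter. It suffices to lift `h`
after multiplication by `x i` and `(g × g') j`, where the solution is explicit. -/
theorem map_snd_reconstruct (hℓ : IsLine ℓ) (hH : IsPlane H) (hs : IsSingular G ℓ H) :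
    (reconstruct G ℓ H).map (LinearMap.snd R _ _) = H := by
  apply le_antisymm
  · rintro _ ⟨w, hw, rfl⟩
    exact hw.1
  intro h hh
  apply Submodule.mem_of_span_top_of_smul_mem _ _ hℓ.span_eq_top
  rintro ⟨_, x, hx, i, rfl⟩
  apply Submodule.mem_of_span_top_of_smul_mem _ _ hH.span_eq_top
  rintro ⟨_, g, hg, g', hg', j, rfl⟩
  simp only
  let B := contr G x (g ⨯₃ g')
  -- Crossing with `eᵢ` inverts `x' × ·` up to the factor `x' i`: `x' × (b × eᵢ) = x' i b - (b · x')
  -- eᵢ`, and `b · x' = 0` for the columns `b` of `B` by `IsSingular.left`.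
  let n : Fin 3 → Fin 3 → R := fun k l => ((fun k => B k l) ⨯₃ Pi.single i 1) k
  let m : Fin 3 → R := fun k => (h ⨯₃ n k) j
  refine ⟨(m, (g ⨯₃ g') j • x i • h), ⟨H.smul_mem _ (H.smul_mem _ hh), ?_⟩, rfl⟩
  intro x' hx' f hf f' hf' k' j'
  have e1 : (x' ⨯₃ m) k' = x' i * (h ⨯₃ B k') j := by
    have h1 : ∀ l, (x' ⨯₃ fun k => n k l) k' = x' i * B k' l := by
      intro l
      have h2 := hs.left x hx x' hx' g hg g' hg' l
      have h3 : x' ⨯₃ ((fun k => B k l) ⨯₃ Pi.single i 1) =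
          x' i • (fun k => B k l) - ((fun k => B k l) ⬝ᵥ x') • Pi.single i 1 := by
        ext k
        fin_cases i <;> fin_cases k <;>
          simp [cross_apply, dotProduct, Fin.sum_univ_three] <;> ring
      have h4 := congrFun h3 k'
      rw [h2, zero_smul, sub_zero] at h4
      exact h4
    have h5 : ∀ l l' : Fin 3, (x' ⨯₃ fun k => h l * n k l' - h l' * n k l) k' =
        x' i * (h l * B k' l' - h l' * B k' l) := by
      intro l l'
      have h6 : (fun k => h l * n k l' - h l' * n k l) =
          h l • (fun k => n k l') - h l' • fun k => n k l := rfl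
      rw [h6, map_sub, map_smul, map_smul, Pi.sub_apply, Pi.smul_apply, Pi.smul_apply, h1, h1,
        smul_eq_mul, smul_eq_mul]
      ring
    fin_cases j
    · exact h5 1 2
    · exact h5 2 0
    · exact h5 0 1
  -- `IsSingular.right` puts `B k'` in `H`, so `h × B k'` belongs to the rank one module `⋀² H`.
  have e2 : (h ⨯₃ B k') j * (f ⨯₃ f') j' = (h ⨯₃ B k') j' * (f ⨯₃ f') j :=
    hH.mul_comm_apply hh (hs.contr_mem hH hx hg hg' k') hf hf' j j'
  have e3 : (x' i * (f ⨯₃ f') j) • B k' = (x i * (g ⨯₃ g') j) • contr G x' (f ⨯₃ f') k' := by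
    ext l
    have h1 := hℓ.mul_contr (G := G) hx hx' (g ⨯₃ g') i k' l
    have h2 := hH.mul_contr (G := G) hg hg' hf hf' x' j k' l
    simp only [Pi.smul_apply, smul_eq_mul, B]
    linear_combination (f ⨯₃ f') j * h1 + x i * h2
  have e4 := congrFun (congrArg (fun v => h ⨯₃ v) e3) j'
  simp only [map_smul, Pi.smul_apply, smul_eq_mul] at e4
  rw [e1]
  simp only [map_smul, LinearMap.smul_apply, Pi.smul_apply, smul_eq_mul]
  linear_combination x' i * e2 + e4

/-- Expand the product of three vectors `α w + β w' + x` with `x` in `U`. Terms without `x` repeat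
`w` or `w'`, and terms with two `x` have at most one factor in `E`; only those with exactly one `x`
remain. -/
theorem mix_combination_left (a b a' b' x₁ x₂ x₃ : Fin 3 → R) (α₁ α₂ α₃ β₁ β₂ β₃ : R)
    (i j : Fin 3) :
    mix (α₁ • a + β₁ • a' + x₁) (α₁ • b + β₁ • b') (α₂ • a + β₂ • a' + x₂) (α₂ • b + β₂ • b')
      (α₃ • a + β₃ • a' + x₃) (α₃ • b + β₃ • b') i j =
    (α₂ * β₃ - α₃ * β₂) * mix x₁ 0 a b a' b' i j + (α₃ * β₁ - α₁ * β₃) * mix x₂ 0 a b a' b' i j +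
      (α₁ * β₂ - α₂ * β₁) * mix x₃ 0 a b a' b' i j := by
  fin_cases j <;> simp [mix, cross_apply] <;> ring

/-- The same expansion in `⋀² U ⊗ E`; here the terms with two `x` vanish because the `x` are
proportional. -/
theorem mix_combination_right (a b a' b' x₁ x₂ x₃ : Fin 3 → R) (α₁ α₂ α₃ β₁ β₂ β₃ : R)
    (h₁ : x₂ ⨯₃ x₃ = 0) (h₂ : x₃ ⨯₃ x₁ = 0) (h₃ : x₁ ⨯₃ x₂ = 0) (l k : Fin 3) :
    mix (α₁ • b + β₁ • b') (α₁ • a + β₁ • a' + x₁) (α₂ • b + β₂ • b') (α₂ • a + β₂ • a' + x₂)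
      (α₃ • b + β₃ • b') (α₃ • a + β₃ • a' + x₃) l k =
    (α₂ * β₃ - α₃ * β₂) * mix 0 x₁ b a b' a' l k + (α₃ * β₁ - α₁ * β₃) * mix 0 x₂ b a b' a' l k +
      (α₁ * β₂ - α₂ * β₁) * mix 0 x₃ b a b' a' l k := by
  have e1 := congrFun h₁ k
  have e2 := congrFun h₂ k
  have e3 := congrFun h₃ k
  simp only [mix, map_add, map_smul, LinearMap.add_apply, LinearMap.smul_apply, Pi.add_apply,
    Pi.smul_apply, smul_eq_mul, e1, e2, e3, cross_self, Pi.zero_apply, ← cross_anticomm a' a,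
    ← cross_anticomm a x₁, ← cross_anticomm a x₂, ← cross_anticomm a x₃, ← cross_anticomm a' x₁,
    ← cross_anticomm a' x₂, ← cross_anticomm a' x₃, Pi.neg_apply]
  ring

theorem mix_smul (r : R) (a₁ b₁ a₂ b₂ a₃ b₃ : Fin 3 → R) (i j : Fin 3) :
    mix (r • a₁) (r • b₁) (r • a₂) (r • b₂) (r • a₃) (r • b₃) i j =
      r ^ 3 * mix a₁ b₁ a₂ b₂ a₃ b₃ i j := by
  simp only [mix, map_smul, LinearMap.smul_apply, Pi.smul_apply, smul_eq_mul]
  ring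

/-- By the two expansions above it suffices to treat products with one factor in `ℓ`. For these, the
defining equations of the two other vectors combine by Cramer's relation for `h`, `h'` and the
contraction, all in `H`. -/
theorem inGraph_reconstruct (hℓ : IsLine ℓ) (hH : IsPlane H) (hs : IsSingular G ℓ H) :
    InGraph G (reconstruct G ℓ H) := by
  have key : ∀ x ∈ ℓ, ∀ w ∈ reconstruct G ℓ H, ∀ w' ∈ reconstruct G ℓ H, ∀ k l,
      mix 0 x w.2 w.1 w'.2 w'.1 l k = ∑ i, ∑ j, G i j k l * mix x 0 w.1 w.2 w'.1 w'.2 i j := by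
    rintro x hx ⟨m, h⟩ hw ⟨m', h'⟩ hw' k l
    simp only [mix_zero_left, mix_zero_right]
    change _ = contr G x (h ⨯₃ h') k l
    rw [← sub_eq_zero]
    apply hH.eq_zero_of_pow_mul_eq_zero 1
    intro g hg g' hg' j
    have e1 := hw.2 x hx g hg g' hg' k j
    have e2 := hw'.2 x hx g hg g' hg' k j
    have hB := hs.contr_mem hH hx hg hg' k
    have e3 := smul_add_smul_add_smul_eq_zero (hH.det_eq_zero h hw.1 h' hw'.1 _ hB) l j
    have e4 := hH.mul_contr (G := G) hw.1 hw'.1 hg hg' x j k l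
    have e5 : (m' ⨯₃ x) k = -(x ⨯₃ m') k := by rw [← cross_anticomm]; rfl
    have e6 : (contr G x (g ⨯₃ g') k ⨯₃ h) j = -(h ⨯₃ contr G x (g ⨯₃ g') k) j := by
      rw [← cross_anticomm]; rfl
    rw [e6] at e3
    rw [e5]
    simp only at e1 e2
    linear_combination h' l * e1 - h l * e2 - e3 - e4
  intro w₁ hw₁ w₂ hw₂ w₃ hw₃
  refine ⟨hH.det_eq_zero _ hw₁.1 _ hw₂.1 _ hw₃.1, fun k l => ?_⟩
  rw [← sub_eq_zero]
  -- Each of the three vectors must be multiplied by `(b × b') n` before it decomposes as in `hdec`.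
  apply hH.eq_zero_of_pow_mul_eq_zero 3
  intro b hb b' hb' n
  have hlift : ∀ b ∈ H, ∃ a, (a, b) ∈ reconstruct G ℓ H := by
    intro b hb
    rw [← map_snd_reconstruct hℓ hH hs] at hb
    obtain ⟨⟨a, b⟩, h, rfl⟩ := hb
    exact ⟨a, h⟩
  obtain ⟨a, hw⟩ := hlift b hb
  obtain ⟨a', hw'⟩ := hlift b' hb'
  have hdec : ∀ w ∈ reconstruct G ℓ H, ∃ α β : R, ∃ x ∈ ℓ,
      (b ⨯₃ b') n • w.1 = α • a + β • a' + x ∧ (b ⨯₃ b') n • w.2 = α • b + β • b' := by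
    intro w hw0
    have h2 : (b ⨯₃ b') n • w.2 = -(b' ⨯₃ w.2) n • b + -(w.2 ⨯₃ b) n • b' := by
      ext i
      have := smul_add_smul_add_smul_eq_zero (hH.det_eq_zero _ hw0.1 _ hb _ hb') i n
      simp only [Pi.smul_apply, smul_eq_mul, Pi.add_apply]
      linear_combination this
    refine ⟨-(b' ⨯₃ w.2) n, -(w.2 ⨯₃ b) n,
      (b ⨯₃ b') n • w.1 - (-(b' ⨯₃ w.2) n • a + -(w.2 ⨯₃ b) n • a'), ?_, by abel, h2⟩
    rw [← comap_inl_reconstruct (G := G) hℓ hH, Submodule.mem_comap]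
    have h3 := sub_mem ((reconstruct G ℓ H).smul_mem ((b ⨯₃ b') n) hw0)
      (add_mem ((reconstruct G ℓ H).smul_mem (-(b' ⨯₃ w.2) n) hw)
        ((reconstruct G ℓ H).smul_mem (-(w.2 ⨯₃ b) n) hw'))
    convert h3 using 1
    apply Prod.ext
    · rfl
    · simp only [LinearMap.inl_apply, Prod.snd_sub, Prod.snd_add, Prod.smul_snd, h2, sub_self]
  obtain ⟨α₁, β₁, x₁, hx₁, f₁, g₁⟩ := hdec w₁ hw₁
  obtain ⟨α₂, β₂, x₂, hx₂, f₂, g₂⟩ := hdec w₂ hw₂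
  obtain ⟨α₃, β₃, x₃, hx₃, f₃, g₃⟩ := hdec w₃ hw₃
  rw [mul_sub, Finset.mul_sum]
  simp only [Finset.mul_sum, mul_left_comm _ (G _ _ _ _), ← mix_smul, f₁, g₁, f₂, g₂, f₃, g₃]
  rw [mix_combination_right _ _ _ _ _ _ _ _ _ _ _ _ _ (hℓ.cross_eq_zero _ hx₂ _ hx₃)
    (hℓ.cross_eq_zero _ hx₃ _ hx₁) (hℓ.cross_eq_zero _ hx₁ _ hx₂)]
  simp only [mix_combination_left, mul_add, Finset.sum_add_distrib, mul_left_comm (G _ _ _ _),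
    ← Finset.mul_sum]
  rw [key x₁ hx₁ _ hw _ hw', key x₂ hx₂ _ hw _ hw', key x₃ hx₃ _ hw _ hw']
  ring

/-- The components in `U ⊗ ⋀² E` of the triple products of elements of `L` are proportional to the
products of elements of `ℓ` and of `⋀² H`. -/
theorem InGraph.exists_mem_mul_mix {L : Submodule R ((Fin 3 → R) × (Fin 3 → R))}
    (hL : InGraph G L) (h1 : L.comap (LinearMap.inl R _ _) = ℓ)
    (h2 : L.map (LinearMap.snd R _ _) = H) (hH : IsPlane H) {w₁ w₂ w₃ : (Fin 3 → R) × (Fin 3 → R)}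
    (hw₁ : w₁ ∈ L) (hw₂ : w₂ ∈ L) (hw₃ : w₃ ∈ L) {h h' : Fin 3 → R} (hh : h ∈ H) (hh' : h' ∈ H)
    (n : Fin 3) : ∃ x ∈ ℓ, ∀ i j,
      (h ⨯₃ h') n * mix w₁.1 w₁.2 w₂.1 w₂.2 w₃.1 w₃.2 i j = x i * (h ⨯₃ h') j := by
  have hmem : ∀ w ∈ L, w.2 ∈ H := fun w hw => h2 ▸ ⟨w, hw, rfl⟩
  refine ⟨(w₂.2 ⨯₃ w₃.2) n • w₁.1 + (w₃.2 ⨯₃ w₁.2) n • w₂.1 + (w₁.2 ⨯₃ w₂.2) n • w₃.1, ?_,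
    fun i j => ?_⟩
  · rw [← h1, Submodule.mem_comap]
    have := add_mem (add_mem (L.smul_mem ((w₂.2 ⨯₃ w₃.2) n) hw₁)
      (L.smul_mem ((w₃.2 ⨯₃ w₁.2) n) hw₂)) (L.smul_mem ((w₁.2 ⨯₃ w₂.2) n) hw₃)
    convert this using 1
    apply Prod.ext
    · rfl
    · ext i
      have := smul_add_smul_add_smul_eq_zero (hL w₁ hw₁ w₂ hw₂ w₃ hw₃).1 i n
      simpa using this.symm
  · have e1 := hH.mul_comm_apply hh hh' (hmem _ hw₂) (hmem _ hw₃) n j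
    have e2 := hH.mul_comm_apply hh hh' (hmem _ hw₃) (hmem _ hw₁) n j
    have e3 := hH.mul_comm_apply hh hh' (hmem _ hw₁) (hmem _ hw₂) n j
    simp only [mix, Pi.add_apply, Pi.smul_apply, smul_eq_mul]
    linear_combination w₁.1 i * e1 + w₂.1 i * e2 + w₃.1 i * e3

end Reconstruction

/-! ### Points of Grassmannians in coordinates -/

section Coordinates

variable {V : Type v} [AddCommGroup V] [Module ℂ V] {ι : Type*} [Fintype ι] (b : Basis ι ℂ V)
variable {R : Type} [CommRing R] [Algebra ℂ R]
variable {S : Type} [CommRing S] [Algebra ℂ S]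

/-- The coordinates on `R ⊗ V` given by a basis of `V`. -/
def tensorCoord (R : Type) [CommRing R] [Algebra ℂ R] : (R ⊗[ℂ] V) ≃ₗ[R] (ι → R) :=
  (b.baseChange R).equivFun

theorem tensorCoord_tmul (r : R) (v : V) (i : ι) :
    tensorCoord b R (r ⊗ₜ v) i = algebraMap ℂ R (b.repr v i) * r := by
  rw [tensorCoord, Basis.equivFun_apply, Basis.baseChange_repr_tmul, Algebra.smul_def]

theorem tensorCoord_symm_apply (a : ι → R) :
    (tensorCoord b R).symm a = ∑ i, a i ⊗ₜ[ℂ] b i := by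
  rw [tensorCoord, Basis.equivFun_symm_apply]
  refine Finset.sum_congr rfl fun i _ => ?_
  rw [Basis.baseChange_apply, TensorProduct.smul_tmul', smul_eq_mul, mul_one]

theorem tensorCoord_rTensor (f : R →ₐ[ℂ] S) (z : R ⊗[ℂ] V) :
    tensorCoord b S (f.toLinearMap.rTensor V z) = f ∘ tensorCoord b R z := by
  ext i
  induction z using TensorProduct.induction_on with
  | zero => simp
  | tmul r m => simp [tensorCoord_tmul]
  | add x y hx hy =>
    rw [map_add, map_add, Pi.add_apply, hx, hy, map_add]
    simp

/-- The submodule of `R ⊗ V` in coordinates. -/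
def coordSubmodule (N : Submodule R (R ⊗[ℂ] V)) : Submodule R (ι → R) :=
  N.map (tensorCoord b R).toLinearMap

theorem mem_coordSubmodule {N : Submodule R (R ⊗[ℂ] V)} {a : ι → R} :
    a ∈ coordSubmodule b N ↔ (tensorCoord b R).symm a ∈ N :=
  Submodule.mem_map_equiv N (e := tensorCoord b R)

theorem coordSubmodule_injective :
    Function.Injective (coordSubmodule b (R := R)) :=
  Submodule.map_injective_of_injective (tensorCoord b R).injective

/-- The quotients by a submodule and by its submodule of coordinates agree. -/
def coordQuotientEquiv (N : Submodule R (R ⊗[ℂ] V)) :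
    ((R ⊗[ℂ] V) ⧸ N) ≃ₗ[R] ((ι → R) ⧸ coordSubmodule b N) :=
  Submodule.Quotient.equiv N _ (tensorCoord b R) rfl

theorem coordSubmodule_map {k : ℕ} (f : R →ₐ[ℂ] S) (N : Grassmannian R (R ⊗[ℂ] V) k) :
    coordSubmodule b (Grassmannian.map f N).toSubmodule =
      Submodule.span S ((fun a => f ∘ a) '' (coordSubmodule b N.toSubmodule : Set (ι → R))) := by
  rw [toSubmodule_map, coordSubmodule, Submodule.map_span]
  congr 1
  ext a
  constructor
  · rintro ⟨_, ⟨z, hz, rfl⟩, rfl⟩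
    exact ⟨_, ⟨z, hz, rfl⟩, (tensorCoord_rTensor b f z).symm⟩
  · rintro ⟨_, ⟨z, hz, rfl⟩, rfl⟩
    exact ⟨_, ⟨z, hz, rfl⟩, tensorCoord_rTensor b f z⟩

/-- A submodule of `R ⊗ V` whose coordinates have a locally free quotient. -/
def grassmannianOfCoord (N : Submodule R (R ⊗[ℂ] V)) (k : ℕ)
    (hp : Module.Projective R ((ι → R) ⧸ coordSubmodule b N))
    (hr : ∀ p, rankAtStalk (R := R) ((ι → R) ⧸ coordSubmodule b N) p = k) :
    Grassmannian R (R ⊗[ℂ] V) k where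
  toSubmodule := N
  finite_quotient := Module.Finite.equiv (coordQuotientEquiv b N).symm
  projective_quotient := Module.Projective.of_equiv (coordQuotientEquiv b N).symm
  rankAtStalk_eq p := by rw [rankAtStalk_eq_of_equiv (coordQuotientEquiv b N), hr]

theorem projective_coordSubmodule {k : ℕ} (N : Grassmannian R (R ⊗[ℂ] V) k) :
    Module.Projective R ((ι → R) ⧸ coordSubmodule b N.toSubmodule) :=
  Module.Projective.of_equiv (coordQuotientEquiv b N.toSubmodule)

theorem rankAtStalk_coordSubmodule {k : ℕ} (N : Grassmannian R (R ⊗[ℂ] V) k)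
    (p : PrimeSpectrum R) :
    rankAtStalk (R := R) ((ι → R) ⧸ coordSubmodule b N.toSubmodule) p = k := by
  rw [← rankAtStalk_eq_of_equiv (coordQuotientEquiv b N.toSubmodule), N.rankAtStalk_eq]

theorem comp_cross (f : R →ₐ[ℂ] S) (a a' : Fin 3 → R) :
    f ∘ (a ⨯₃ a') = (f ∘ a) ⨯₃ (f ∘ a') := by
  ext i; fin_cases i <;> simp [cross_apply]

theorem map_dotProduct' (f : R →ₐ[ℂ] S) (a a' : Fin 3 → R) :
    f (a ⬝ᵥ a') = (f ∘ a) ⬝ᵥ (f ∘ a') := by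
  simp [dotProduct]

/-- A ring element vanishing over all local algebras is zero. -/
theorem eq_zero_of_local {r : R} (h : ∀ (S : Type) [CommRing S] [Algebra ℂ S] [IsLocalRing S]
    (f : R →ₐ[ℂ] S), f r = 0) : r = 0 := by
  apply eq_zero_of_localization
  intro J hJ
  exact h (Localization.AtPrime J) (IsScalarTower.toAlgHom ℂ R (Localization.AtPrime J))

/-- A set of ring elements not vanishing identically over any field generates the unit ideal. -/
theorem span_eq_top_of_field {s : Set R} (h : ∀ (K : Type) [Field K] [Algebra ℂ K]
    (f : R →ₐ[ℂ] K), (∀ r ∈ s, f r = 0) → False) : Ideal.span s = ⊤ := by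
  by_contra hs
  obtain ⟨J, hJ, hsJ⟩ := Ideal.exists_le_maximal _ hs
  let : Field (R ⧸ J) := Ideal.Quotient.field J
  exact h (R ⧸ J) (Ideal.Quotient.mkₐ ℂ J) fun r hr =>
    Ideal.Quotient.eq_zero_iff_mem.2 (hsJ (Ideal.subset_span hr))

variable (c : Basis (Fin 3) ℂ V)

theorem exists_line_coord [IsLocalRing R] (N : Grassmannian R (R ⊗[ℂ] V) 2) :
    ∃ x ξ : Fin 3 → R, x ⬝ᵥ ξ = 1 ∧ coordSubmodule c N.toSubmodule = Submodule.span R {x} :=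
  have := projective_coordSubmodule c N
  exists_span_singleton_of_isLocalRing _ (rankAtStalk_coordSubmodule c N)

theorem exists_plane_coord [IsLocalRing R] (N : Grassmannian R (R ⊗[ℂ] V) 1) :
    ∃ y η : Fin 3 → R, y ⬝ᵥ η = 1 ∧ ∀ v, v ∈ coordSubmodule c N.toSubmodule ↔ v ⬝ᵥ y = 0 :=
  have := projective_coordSubmodule c N
  exists_equation_of_isLocalRing _ (rankAtStalk_coordSubmodule c N)

theorem comp_mem_coordSubmodule_map {k : ℕ} (f : R →ₐ[ℂ] S) (N : Grassmannian R (R ⊗[ℂ] V) k)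
    {a : ι → R} (ha : a ∈ coordSubmodule b N.toSubmodule) :
    f ∘ a ∈ coordSubmodule b (Grassmannian.map f N).toSubmodule := by
  rw [coordSubmodule_map]
  exact Submodule.subset_span ⟨a, ha, rfl⟩

/-- Equations may be tested over local algebras and generation of the unit ideal over fields; in
both cases the line has a generator. -/
theorem isLine_coordSubmodule (N : Grassmannian R (R ⊗[ℂ] V) 2) :
    IsLine (coordSubmodule c N.toSubmodule) where
  cross_eq_zero a ha a' ha' := by
    ext i
    apply eq_zero_of_local
    intro S _ _ _ f
    obtain ⟨x, ξ, -, hx⟩ := exists_line_coord c (Grassmannian.map f N)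
    have h1 := comp_mem_coordSubmodule_map c f N ha
    have h2 := comp_mem_coordSubmodule_map c f N ha'
    rw [hx, Submodule.mem_span_singleton] at h1 h2
    obtain ⟨r, hr⟩ := h1
    obtain ⟨r', hr'⟩ := h2
    change (f ∘ (a ⨯₃ a')) i = 0
    rw [comp_cross, ← hr, ← hr']
    simp
  span_eq_top := by
    apply span_eq_top_of_field
    intro K _ _ f hf
    obtain ⟨x, ξ, hxξ, hx⟩ := exists_line_coord c (Grassmannian.map f N)
    have h0 : Submodule.span K {x} = ⊥ := by
      rw [← hx, coordSubmodule_map, Submodule.span_eq_bot]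
      rintro _ ⟨a, ha, rfl⟩
      ext i
      exact hf _ ⟨a, ha, i, rfl⟩
    rw [Submodule.span_singleton_eq_bot] at h0
    simp [h0] at hxξ

theorem isPlane_coordSubmodule (N : Grassmannian R (R ⊗[ℂ] V) 1) :
    IsPlane (coordSubmodule c N.toSubmodule) where
  det_eq_zero a ha a' ha' a'' ha'' := by
    apply eq_zero_of_local
    intro S _ _ _ f
    obtain ⟨y, η, hy, hN⟩ := exists_plane_coord c (Grassmannian.map f N)
    have h1 := (hN _).1 (comp_mem_coordSubmodule_map c f N ha)
    have h2 := (hN _).1 (comp_mem_coordSubmodule_map c f N ha')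
    have h3 := (hN _).1 (comp_mem_coordSubmodule_map c f N ha'')
    have h4 := mul_eq_zero_of_dotProduct_eq_zero h1 h2 h3
    rw [map_dotProduct', comp_cross]
    generalize (f ∘ a) ⬝ᵥ (f ∘ a') ⨯₃ (f ∘ a'') = r at h4 ⊢
    calc r = (y ⬝ᵥ η) * r := by rw [hy, one_mul]
      _ = 0 := by
        rw [dotProduct, Finset.sum_mul]
        exact Finset.sum_eq_zero fun i _ => by rw [mul_right_comm, h4, zero_mul]
  span_eq_top := by
    apply span_eq_top_of_field
    intro K _ _ f hf
    obtain ⟨y, η, hy, hN⟩ := exists_plane_coord c (Grassmannian.map f N)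
    have h0 : ∀ v ∈ coordSubmodule c (Grassmannian.map f N).toSubmodule,
        ∀ w ∈ coordSubmodule c (Grassmannian.map f N).toSubmodule, v ⨯₃ w = 0 := by
      rw [coordSubmodule_map]
      intro v hv w hw
      induction hv, hw using Submodule.span_induction₂ with
      | mem_mem v w hv hw =>
        obtain ⟨a, ha, rfl⟩ := hv
        obtain ⟨a', ha', rfl⟩ := hw
        simp only
        rw [← comp_cross]
        ext i
        exact hf _ ⟨a, ha, a', ha', i, rfl⟩
      | zero_left => simp
      | zero_right => simp
      | add_left _ _ _ _ _ _ h h' => rw [map_add, LinearMap.add_apply, h, h', add_zero]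
      | add_right _ _ _ _ _ _ h h' => rw [map_add, h, h', add_zero]
      | smul_left _ _ _ _ _ h => rw [map_smul, LinearMap.smul_apply, h, smul_zero]
      | smul_right _ _ _ _ _ h => rw [map_smul, h, smul_zero]
    have h1 : ∀ z : Fin 3 → K, y ⨯₃ z ∈ coordSubmodule c (Grassmannian.map f N).toSubmodule := by
      intro z
      rw [hN, dotProduct_comm, dot_self_cross]
    -- The `n`-th coordinate of `(y × e_{n+1}) × (y × e_{n+2})` is `(y n)²`.
    have hy0 : y = 0 := by
      ext n
      have h2 := congrFun (h0 _ (h1 (Pi.single (n + 1) 1)) _ (h1 (Pi.single (n + 2) 1))) n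
      fin_cases n <;> simpa [cross_apply] using h2
    simp [hy0] at hy

end Coordinates

/-! ### Coordinates on `R ⊗ W` compatible with `U` -/

section SplitCoordinates

variable {W : Type v} [AddCommGroup W] [Module ℂ W] {U : Submodule ℂ W}
variable (u : Basis (Fin 3) ℂ U) (e : Basis (Fin 3) ℂ (W ⧸ U))
variable (R : Type) [CommRing R] [Algebra ℂ R]

/-- The coordinates on `R ⊗ W` with respect to the vectors `uᵢ` and `eⱼ`. -/
def splitCoord : (R ⊗[ℂ] W) ≃ₗ[R] (Fin 3 → R) × (Fin 3 → R) :=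
  tensorCoord (adaptedBasis u e) R ≪≫ₗ LinearEquiv.sumArrowLequivProdArrow (Fin 3) (Fin 3) R R

variable {R} {S : Type} [CommRing S] [Algebra ℂ S]

theorem splitCoord_symm_apply (w : (Fin 3 → R) × (Fin 3 → R)) :
    (splitCoord u e R).symm w =
      ∑ i, w.1 i ⊗ₜ[ℂ] (u i : W) + ∑ j, w.2 j ⊗ₜ[ℂ] liftVec e j := by
  rw [splitCoord, LinearEquiv.symm_trans_apply, tensorCoord_symm_apply, Fintype.sum_sum_type]
  simp only [adaptedBasis_inl, adaptedBasis_inr]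
  rfl

theorem splitCoord_rTensor (f : R →ₐ[ℂ] S) (z : R ⊗[ℂ] W) :
    splitCoord u e S (f.toLinearMap.rTensor W z) =
      (f ∘ (splitCoord u e R z).1, f ∘ (splitCoord u e R z).2) := by
  rw [splitCoord, LinearEquiv.trans_apply, tensorCoord_rTensor]
  rfl

theorem mkQ_liftVec (j : Fin 3) : U.mkQ (liftVec e j) = e j :=
  Function.surjInv_eq U.mkQ_surjective (e j)

theorem subtype_tensorCoord_symm (a : Fin 3 → R) :
    U.subtype.baseChange R ((tensorCoord u R).symm a) = (splitCoord u e R).symm (a, 0) := by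
  rw [tensorCoord_symm_apply, splitCoord_symm_apply]
  simp

theorem mkQ_splitCoord_symm (w : (Fin 3 → R) × (Fin 3 → R)) :
    U.mkQ.baseChange R ((splitCoord u e R).symm w) = (tensorCoord e R).symm w.2 := by
  rw [tensorCoord_symm_apply, splitCoord_symm_apply]
  have h : ∀ i, U.mkQ (u i : W) = 0 := fun i => by simp
  simp only [map_add, map_sum, LinearMap.baseChange_tmul, mkQ_liftVec, h, TensorProduct.tmul_zero,
    Finset.sum_const_zero, zero_add]

theorem splitCoord_subtype (z : R ⊗[ℂ] U) :
    splitCoord u e R (U.subtype.baseChange R z) = (tensorCoord u R z, 0) := by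
  rw [← LinearEquiv.eq_symm_apply, ← subtype_tensorCoord_symm, LinearEquiv.symm_apply_apply]

theorem tensorCoord_mkQ (z : R ⊗[ℂ] W) :
    tensorCoord e R (U.mkQ.baseChange R z) = (splitCoord u e R z).2 := by
  rw [← LinearEquiv.eq_symm_apply, ← mkQ_splitCoord_symm u, LinearEquiv.symm_apply_apply]

theorem mem_baseChange_iff (z : R ⊗[ℂ] W) :
    z ∈ U.baseChange R ↔ (splitCoord u e R z).2 = 0 := by
  constructor
  · rintro ⟨t, rfl⟩
    have := splitCoord_subtype u e t
    exact congrArg Prod.snd this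
  · intro h
    have : z = U.subtype.baseChange R ((tensorCoord u R).symm (splitCoord u e R z).1) := by
      rw [subtype_tensorCoord_symm u e, ← h, LinearEquiv.symm_apply_apply]
    rw [this]
    exact ⟨_, rfl⟩

/-- The submodule of `R ⊗ W` in coordinates. -/
def splitSubmodule (N : Submodule R (R ⊗[ℂ] W)) : Submodule R ((Fin 3 → R) × (Fin 3 → R)) :=
  N.map (splitCoord u e R).toLinearMap

theorem mem_splitSubmodule {N : Submodule R (R ⊗[ℂ] W)} {w : (Fin 3 → R) × (Fin 3 → R)} :
    w ∈ splitSubmodule u e N ↔ (splitCoord u e R).symm w ∈ N :=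
  Submodule.mem_map_equiv N (e := splitCoord u e R)

theorem splitCoord_mem {N : Submodule R (R ⊗[ℂ] W)} {z : R ⊗[ℂ] W} :
    splitCoord u e R z ∈ splitSubmodule u e N ↔ z ∈ N := by
  rw [mem_splitSubmodule, LinearEquiv.symm_apply_apply]

theorem splitSubmodule_le {N N' : Submodule R (R ⊗[ℂ] W)} :
    splitSubmodule u e N ≤ splitSubmodule u e N' ↔ N ≤ N' :=
  Submodule.map_le_map_iff_of_injective (splitCoord u e R).injective N N'

theorem splitSubmodule_map {k : ℕ} (f : R →ₐ[ℂ] S) (N : Grassmannian R (R ⊗[ℂ] W) k) :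
    splitSubmodule u e (Grassmannian.map f N).toSubmodule =
      Submodule.span S ((fun w => (f ∘ w.1, f ∘ w.2)) ''
        (splitSubmodule u e N.toSubmodule : Set ((Fin 3 → R) × (Fin 3 → R)))) := by
  rw [toSubmodule_map, splitSubmodule, Submodule.map_span]
  congr 1
  ext a
  constructor
  · rintro ⟨_, ⟨z, hz, rfl⟩, rfl⟩
    exact ⟨_, ⟨z, hz, rfl⟩, (splitCoord_rTensor u e f z).symm⟩
  · rintro ⟨_, ⟨z, hz, rfl⟩, rfl⟩
    exact ⟨_, ⟨z, hz, rfl⟩, splitCoord_rTensor u e f z⟩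

theorem comp_mem_splitSubmodule_map {k : ℕ} (f : R →ₐ[ℂ] S) (N : Grassmannian R (R ⊗[ℂ] W) k)
    {w : (Fin 3 → R) × (Fin 3 → R)} (hw : w ∈ splitSubmodule u e N.toSubmodule) :
    (f ∘ w.1, f ∘ w.2) ∈ splitSubmodule u e (Grassmannian.map f N).toSubmodule := by
  rw [splitSubmodule_map]
  exact Submodule.subset_span ⟨w, hw, rfl⟩

theorem coordSubmodule_comap (N : Submodule R (R ⊗[ℂ] W)) :
    coordSubmodule u (N.comap (U.subtype.baseChange R)) =
      (splitSubmodule u e N).comap (LinearMap.inl R _ _) := by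
  ext a
  rw [mem_coordSubmodule, Submodule.mem_comap, Submodule.mem_comap, mem_splitSubmodule,
    subtype_tensorCoord_symm u e]
  rfl

theorem coordSubmodule_map_mkQ (N : Submodule R (R ⊗[ℂ] W)) :
    coordSubmodule e (N.map (U.mkQ.baseChange R)) =
      (splitSubmodule u e N).map (LinearMap.snd R _ _) := by
  ext a
  constructor
  · rintro ⟨_, ⟨w, hw, rfl⟩, rfl⟩
    exact ⟨_, ⟨w, hw, rfl⟩, (tensorCoord_mkQ u e w).symm⟩
  · rintro ⟨_, ⟨w, hw, rfl⟩, rfl⟩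
    exact ⟨_, ⟨w, hw, rfl⟩, tensorCoord_mkQ u e w⟩

/-- The quotients by a submodule and by its submodule of coordinates agree. -/
def splitQuotientEquiv (N : Submodule R (R ⊗[ℂ] W)) :
    ((R ⊗[ℂ] W) ⧸ N) ≃ₗ[R] (((Fin 3 → R) × (Fin 3 → R)) ⧸ splitSubmodule u e N) :=
  Submodule.Quotient.equiv N _ (splitCoord u e R) rfl

theorem ι_baseChange_eq_sum (z : R ⊗[ℂ] W) :
    (ExteriorAlgebra.ι ℂ).baseChange R z = ∑ i, (splitCoord u e R z).1 i • uVecR u i +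
      ∑ j, (splitCoord u e R z).2 j • eVecR e j := by
  conv_lhs => rw [← (splitCoord u e R).symm_apply_apply z, splitCoord_symm_apply]
  simp only [map_add, map_sum, LinearMap.baseChange_tmul, uVecR, eVecR, TensorProduct.smul_tmul',
    smul_eq_mul, mul_one]
  rfl

/-- The product of three vectors of `R ⊗ W` in coordinates. -/
theorem ι_mul_mul_eq_trivector (z₁ z₂ z₃ : R ⊗[ℂ] W) :
    (ExteriorAlgebra.ι ℂ).baseChange R z₁ * (ExteriorAlgebra.ι ℂ).baseChange R z₂ *
      (ExteriorAlgebra.ι ℂ).baseChange R z₃ =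
    trivector (uVecR u) (eVecR e)
      ((splitCoord u e R z₁).1 ⬝ᵥ (splitCoord u e R z₂).1 ⨯₃ (splitCoord u e R z₃).1)
      (fun k l => mix (splitCoord u e R z₁).2 (splitCoord u e R z₁).1 (splitCoord u e R z₂).2
        (splitCoord u e R z₂).1 (splitCoord u e R z₃).2 (splitCoord u e R z₃).1 l k)
      (mix (splitCoord u e R z₁).1 (splitCoord u e R z₁).2 (splitCoord u e R z₂).1
        (splitCoord u e R z₂).2 (splitCoord u e R z₃).1 (splitCoord u e R z₃).2)
      ((splitCoord u e R z₁).2 ⬝ᵥ (splitCoord u e R z₂).2 ⨯₃ (splitCoord u e R z₃).2) := by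
  rw [ι_baseChange_eq_sum u e z₁, ι_baseChange_eq_sum u e z₂, ι_baseChange_eq_sum u e z₃,
    (anticommutingTriplesR u e).mul_mul_eq_trivector]

theorem wedgePow_three_le_iff {N : Submodule R (R ⊗[ℂ] W)}
    {P : Submodule R (R ⊗[ℂ] ExteriorAlgebra ℂ W)} :
    wedgePow R 3 N ≤ P ↔ ∀ z₁ ∈ N, ∀ z₂ ∈ N, ∀ z₃ ∈ N,
      (ExteriorAlgebra.ι ℂ).baseChange R z₁ * (ExteriorAlgebra.ι ℂ).baseChange R z₂ *
      (ExteriorAlgebra.ι ℂ).baseChange R z₃ ∈ P := by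
  rw [wedgePow, pow_succ, pow_two]
  constructor
  · intro h z₁ h₁ z₂ h₂ z₃ h₃
    exact h (Submodule.mul_mem_mul (Submodule.mul_mem_mul ⟨_, h₁, rfl⟩ ⟨_, h₂, rfl⟩) ⟨_, h₃, rfl⟩)
  · intro h
    rw [Submodule.mul_le]
    intro m hm n hn
    obtain ⟨z₃, h₃, rfl⟩ := hn
    induction hm using Submodule.mul_induction_on' with
    | add x _ y _ hx hy => rw [add_mul]; exact add_mem hx hy
    | mem_mul_mem x hx y hy =>
      obtain ⟨z₁, h₁, rfl⟩ := hx
      obtain ⟨z₂, h₂, rfl⟩ := hy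
      exact h z₁ h₁ z₂ h₂ z₃ h₃

/-- `A` is the graph of the form `G` over every `ℂ`-algebra. -/
def IsGraphOf (A : Submodule ℂ (ExteriorAlgebra ℂ W)) (G : Fin 3 → Fin 3 → Fin 3 → Fin 3 → ℂ) :
    Prop :=
  ∀ (R : Type) [CommRing R] [Algebra ℂ R] (s₀ : R) (s t : Fin 3 → Fin 3 → R) (t₀ : R),
    trivector (uVecR u) (eVecR e) s₀ s t t₀ ∈ A.baseChange R ↔
      t₀ = 0 ∧ ∀ k l, s k l = ∑ i, ∑ j, algebraMap ℂ R (G i j k l) * t i j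

/-- The form `G` with coefficients in `R`. -/
def formOver (R : Type) [CommRing R] [Algebra ℂ R] (G : Fin 3 → Fin 3 → Fin 3 → Fin 3 → ℂ) :
    Fin 3 → Fin 3 → Fin 3 → Fin 3 → R :=
  fun i j k l => algebraMap ℂ R (G i j k l)

variable {u e} {A : Submodule ℂ (ExteriorAlgebra ℂ W)} {G : Fin 3 → Fin 3 → Fin 3 → Fin 3 → ℂ}

/-- This turns the scheme `F_A` into the coordinate condition on which the preceding algebra
operates. -/
theorem IsGraphOf.wedgePow_le_iff (hG : IsGraphOf u e A G) {N : Submodule R (R ⊗[ℂ] W)} :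
    wedgePow R 3 N ≤ A.baseChange R ↔ InGraph (formOver R G) (splitSubmodule u e N) := by
  rw [wedgePow_three_le_iff]
  constructor
  · rintro h _ ⟨z₁, h₁, rfl⟩ _ ⟨z₂, h₂, rfl⟩ _ ⟨z₃, h₃, rfl⟩
    have := h z₁ h₁ z₂ h₂ z₃ h₃
    rw [ι_mul_mul_eq_trivector u e, hG] at this
    exact this
  · intro h z₁ h₁ z₂ h₂ z₃ h₃
    rw [ι_mul_mul_eq_trivector u e, hG]
    exact h _ ⟨z₁, h₁, rfl⟩ _ ⟨z₂, h₂, rfl⟩ _ ⟨z₃, h₃, rfl⟩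

end SplitCoordinates

/-! ### Local freeness of `Λ` against that of `ℓ` and `H` -/

section QuotientOfSum

variable {R : Type*} [CommRing R] {L : Submodule R ((Fin 3 → R) × (Fin 3 → R))}

theorem exact_inl_snd : Function.Exact (LinearMap.inl R (Fin 3 → R) (Fin 3 → R))
    (LinearMap.snd R (Fin 3 → R) (Fin 3 → R)) := by
  intro w
  constructor
  · intro h
    exact ⟨w.1, Prod.ext rfl (Eq.symm h)⟩
  · rintro ⟨a, rfl⟩
    rfl

theorem projective_comap_inl (hH : IsPlane (L.map (LinearMap.snd R _ _)))
    (hp : Module.Projective R (((Fin 3 → R) × (Fin 3 → R)) ⧸ L))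
    (hr : ∀ p, rankAtStalk (R := R) (((Fin 3 → R) × (Fin 3 → R)) ⧸ L) p = 3) :
    Module.Projective R ((Fin 3 → R) ⧸ L.comap (LinearMap.inl R _ _)) ∧
      ∀ p, rankAtStalk (R := R) ((Fin 3 → R) ⧸ L.comap (LinearMap.inl R _ _)) p = 2 := by
  have := hH.projective
  obtain ⟨E⟩ := exists_quotient_equiv_prod (LinearMap.inl R (Fin 3 → R) (Fin 3 → R))
    (LinearMap.snd R _ _) Prod.snd_surjective exact_inl_snd L
  have h1 : Module.Projective R ((Fin 3 → R) ⧸ L.comap (LinearMap.inl R _ _)) :=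
    Module.Projective.of_split (E.symm.toLinearMap ∘ₗ LinearMap.inl R _ _)
      (LinearMap.fst R _ _ ∘ₗ E.toLinearMap) (by apply LinearMap.ext; intro x; simp)
  refine ⟨h1, fun p => ?_⟩
  have h2 := hr p
  rw [rankAtStalk_eq_of_equiv E, rankAtStalk_prod, Pi.add_apply, hH.rankAtStalk_eq] at h2
  omega

theorem projective_of_comap_inl (hH : IsPlane (L.map (LinearMap.snd R _ _)))
    (hp : Module.Projective R ((Fin 3 → R) ⧸ L.comap (LinearMap.inl R _ _)))
    (hr : ∀ p, rankAtStalk (R := R) ((Fin 3 → R) ⧸ L.comap (LinearMap.inl R _ _)) p = 2) :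
    Module.Projective R (((Fin 3 → R) × (Fin 3 → R)) ⧸ L) ∧
      ∀ p, rankAtStalk (R := R) (((Fin 3 → R) × (Fin 3 → R)) ⧸ L) p = 3 := by
  have := hH.projective
  obtain ⟨E⟩ := exists_quotient_equiv_prod (LinearMap.inl R (Fin 3 → R) (Fin 3 → R))
    (LinearMap.snd R _ _) Prod.snd_surjective exact_inl_snd L
  refine ⟨Module.Projective.of_equiv E.symm, fun p => ?_⟩
  rw [rankAtStalk_eq_of_equiv E, rankAtStalk_prod, Pi.add_apply, hH.rankAtStalk_eq, hr]

end QuotientOfSum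

/-! ### The correspondence `Λ ↔ (Λ ∩ U, image of Λ in W / U)` -/

section Projection

variable {W : Type v} [AddCommGroup W] [Module ℂ W] {U : Submodule ℂ W}
variable {R S : CommAlgCat.{0} ℂ}

/-- The point `p = (ℓ, H)` is the pair of the intersection of `Λ` with `U` and its image in
`W / U`. -/
def IsProjection (Λ : (Gr W 3).obj R) (p : (planeProd U).obj R) : Prop :=
  p.1.toSubmodule = Λ.toSubmodule.comap (U.subtype.baseChange R) ∧
    p.2.toSubmodule = Λ.toSubmodule.map (U.mkQ.baseChange R)

theorem IsProjection.unique {Λ : (Gr W 3).obj R} {p p' : (planeProd U).obj R}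
    (h : IsProjection Λ p) (h' : IsProjection Λ p') : p = p' :=
  Prod.ext (Grassmannian.ext (h.1.trans h'.1.symm)) (Grassmannian.ext (h.2.trans h'.2.symm))

variable (u : Basis (Fin 3) ℂ U) (e : Basis (Fin 3) ℂ (W ⧸ U))

theorem isProjection_iff {Λ : (Gr W 3).obj R} {p : (planeProd U).obj R} :
    IsProjection Λ p ↔ (splitSubmodule u e Λ.toSubmodule).comap (LinearMap.inl R _ _) =
        coordSubmodule u p.1.toSubmodule ∧
      (splitSubmodule u e Λ.toSubmodule).map (LinearMap.snd R _ _) =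
        coordSubmodule e p.2.toSubmodule := by
  rw [← coordSubmodule_comap, ← coordSubmodule_map_mkQ, (coordSubmodule_injective u).eq_iff,
    (coordSubmodule_injective e).eq_iff]
  exact and_congr eq_comm eq_comm

variable {u e}
variable {A : Submodule ℂ (ExteriorAlgebra ℂ W)} {G : Fin 3 → Fin 3 → Fin 3 → Fin 3 → ℂ}

theorem IsGraphOf.mem_schemeF_iff (hG : IsGraphOf u e A G) {Λ : (Gr W 3).obj R} :
    Λ ∈ (schemeF A).obj R ↔ InGraph (formOver R G) (splitSubmodule u e Λ.toSubmodule) :=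
  hG.wedgePow_le_iff

/-- If the cross products did not generate the unit ideal, they would all vanish over some field;
there `InGraph.snd_eq_zero` gives `Λ = U`, which removing `u` excludes. -/
theorem IsGraphOf.isPlane (hG : IsGraphOf u e A G) {Λ : (Gr W 3).obj R}
    (hΛ : Λ ∈ (schemeFMinus A U).obj R) :
    IsPlane ((splitSubmodule u e Λ.toSubmodule).map (LinearMap.snd R _ _)) where
  det_eq_zero := by
    rintro _ ⟨w, hw, rfl⟩ _ ⟨w', hw', rfl⟩ _ ⟨w'', hw'', rfl⟩
    exact (hG.mem_schemeF_iff.1 hΛ.1 w hw w' hw' w'' hw'').1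
  span_eq_top := by
    apply span_eq_top_of_field
    intro K _ _ f hf
    let N : Grassmannian K (K ⊗[ℂ] W) 3 := Grassmannian.map f Λ
    apply hΛ.2 (CommAlgCat.of ℂ K) (CommAlgCat.ofHom f) (Field.toIsField K)
    change N.toSubmodule = U.baseChange K
    have h1 : InGraph (formOver K G) (splitSubmodule u e N.toSubmodule) := by
      have := (schemeF A).map (CommAlgCat.ofHom f) hΛ.1
      exact hG.wedgePow_le_iff.1 this
    have h2 : ∀ w ∈ splitSubmodule u e N.toSubmodule, ∀ w' ∈ splitSubmodule u e N.toSubmodule,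
        w.2 ⨯₃ w'.2 = 0 := by
      have hN : splitSubmodule u e N.toSubmodule = _ := splitSubmodule_map u e f Λ
      rw [hN]
      intro v hv w hw
      induction hv, hw using Submodule.span_induction₂ with
      | mem_mem v w hv hw =>
        obtain ⟨a, ha, rfl⟩ := hv
        obtain ⟨a', ha', rfl⟩ := hw
        simp only
        rw [← comp_cross]
        ext i
        exact hf _ ⟨_, ⟨a, ha, rfl⟩, _, ⟨a', ha', rfl⟩, i, rfl⟩
      | zero_left => simp
      | zero_right => simp
      | add_left _ _ _ _ _ _ h h' =>
        rw [Prod.snd_add, map_add, LinearMap.add_apply, h, h', add_zero]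
      | add_right _ _ _ _ _ _ h h' => rw [Prod.snd_add, map_add, h, h', add_zero]
      | smul_left _ _ _ _ _ h => rw [Prod.smul_snd, map_smul, LinearMap.smul_apply, h, smul_zero]
      | smul_right _ _ _ _ _ h => rw [Prod.smul_snd, map_smul, h, smul_zero]
    have h3 : finrank K (splitSubmodule u e N.toSubmodule) = 3 := by
      have h4 := N.rankAtStalk_eq (IsLocalRing.closedPoint K)
      rw [rankAtStalk_eq_of_equiv (splitQuotientEquiv u e N.toSubmodule),
        rankAtStalk_eq_finrank_of_free] at h4
      have h5 := Submodule.finrank_quotient_add_finrank (splitSubmodule u e N.toSubmodule)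
      rw [finrank_prod, finrank_fin_fun] at h5
      simp only [Pi.natCast_def, Nat.cast_id] at h4
      omega
    have h4 : splitSubmodule u e N.toSubmodule = LinearMap.range (LinearMap.inl K _ _) := by
      apply Submodule.eq_of_le_of_finrank_eq
      · intro w hw
        exact ⟨w.1, Prod.ext rfl (h1.snd_eq_zero h3 h2 hw).symm⟩
      · rw [h3, LinearMap.finrank_range_of_inj LinearMap.inl_injective, finrank_fin_fun]
    ext z
    rw [mem_baseChange_iff u e, ← splitCoord_mem u e, h4]
    constructor
    · rintro ⟨a, ha⟩
      rw [← ha]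
      rfl
    · intro hz
      exact ⟨_, Prod.ext rfl hz.symm⟩

theorem IsGraphOf.exists_isProjection (hG : IsGraphOf u e A G) {Λ : (Gr W 3).obj R}
    (hΛ : Λ ∈ (schemeFMinus A U).obj R) : ∃ p : (planeProd U).obj R, IsProjection Λ p := by
  have hH := hG.isPlane hΛ
  have hp : Module.Projective R
      (((Fin 3 → R) × (Fin 3 → R)) ⧸ splitSubmodule u e Λ.toSubmodule) :=
    have := Λ.projective_quotient
    Module.Projective.of_equiv (splitQuotientEquiv u e Λ.toSubmodule)
  have hr : ∀ p, rankAtStalk (R := R)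
      (((Fin 3 → R) × (Fin 3 → R)) ⧸ splitSubmodule u e Λ.toSubmodule) p = 3 := fun p => by
    rw [← rankAtStalk_eq_of_equiv (splitQuotientEquiv u e Λ.toSubmodule)]
    exact Λ.rankAtStalk_eq p
  obtain ⟨hp', hr'⟩ := projective_comap_inl hH hp hr
  rw [← coordSubmodule_comap] at hp' hr'
  have hp'' := hH.projective
  have hr'' := hH.rankAtStalk_eq
  rw [← coordSubmodule_map_mkQ] at hp'' hr''
  exact ⟨(grassmannianOfCoord u _ 2 hp' hr', grassmannianOfCoord e _ 1 hp'' hr''), rfl, rfl⟩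

/-- Intersections need not commute with base change, but the pullback of `p` is contained in the
projection of the pullback of `Λ`. Both are points of the same Grassmannians, so
`Grassmannian.eq_of_le` gives equality. -/
theorem IsGraphOf.isProjection_map (hG : IsGraphOf u e A G) {Λ : (Gr W 3).obj R}
    (hΛ : Λ ∈ (schemeFMinus A U).obj R) {p : (planeProd U).obj R} (h : IsProjection Λ p)
    (f : R ⟶ S) : IsProjection ((Gr W 3).map f Λ) ((planeProd U).map f p) := by
  obtain ⟨q, hq⟩ := hG.exists_isProjection ((schemeFMinus A U).map f hΛ)
  suffices hpq : (planeProd U).map f p = q by rw [hpq]; exact hq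
  rw [isProjection_iff u e] at h hq
  have hΛf : splitSubmodule u e ((Gr W 3).map f Λ).toSubmodule = _ :=
    splitSubmodule_map u e f.hom Λ
  have h1 : coordSubmodule u ((planeProd U).map f p).1.toSubmodule = _ :=
    coordSubmodule_map u f.hom p.1
  have h2 : coordSubmodule e ((planeProd U).map f p).2.toSubmodule = _ :=
    coordSubmodule_map e f.hom p.2
  apply Prod.ext
  · apply Grassmannian.eq_of_le
    refine (Submodule.map_le_map_iff_of_injective (tensorCoord u S).injective _ _).1 ?_
    change coordSubmodule u _ ≤ coordSubmodule u _
    rw [h1, ← hq.1, Submodule.span_le, ← h.1]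
    rintro _ ⟨a, ha, rfl⟩
    have := comp_mem_splitSubmodule_map u e f.hom Λ ha
    have h0 : (f.hom ∘ (0 : Fin 3 → R)) = 0 := by ext i; simp
    simp only [LinearMap.inl_apply, h0] at this
    exact this
  · apply Grassmannian.eq_of_le
    refine (Submodule.map_le_map_iff_of_injective (tensorCoord e S).injective _ _).1 ?_
    change coordSubmodule e _ ≤ coordSubmodule e _
    rw [h2, ← hq.2, Submodule.span_le, ← h.2]
    rintro _ ⟨_, ⟨w, hw, rfl⟩, rfl⟩
    exact ⟨_, comp_mem_splitSubmodule_map u e f.hom Λ hw, rfl⟩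

theorem IsGraphOf.injective (hG : IsGraphOf u e A G) {Λ Λ' : (Gr W 3).obj R}
    (hΛ : Λ ∈ (schemeF A).obj R) (hΛ' : Λ' ∈ (schemeF A).obj R)
    {p : (planeProd U).obj R} (h : IsProjection Λ p) (h' : IsProjection Λ' p) : Λ = Λ' := by
  rw [isProjection_iff u e] at h h'
  apply Grassmannian.eq_of_le
  rw [← splitSubmodule_le u e]
  exact InGraph.le (isLine_coordSubmodule u p.1) (isPlane_coordSubmodule e p.2)
    (hG.mem_schemeF_iff.1 hΛ) (hG.mem_schemeF_iff.1 hΛ') h.1 h'.1 h.2 h'.2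

theorem IsGraphOf.surjective (hG : IsGraphOf u e A G) {p : (planeProd U).obj R}
    (hs : IsSingular (formOver R G) (coordSubmodule u p.1.toSubmodule)
      (coordSubmodule e p.2.toSubmodule)) :
    ∃ Λ ∈ (schemeFMinus A U).obj R, IsProjection Λ p := by
  have hℓ := isLine_coordSubmodule u p.1
  have hH := isPlane_coordSubmodule e p.2
  let N : Submodule R (R ⊗[ℂ] W) := (reconstruct (formOver R G) (coordSubmodule u p.1.toSubmodule)
      (coordSubmodule e p.2.toSubmodule)).comap (splitCoord u e R).toLinearMap
  have hN : splitSubmodule u e N = reconstruct (formOver R G) (coordSubmodule u p.1.toSubmodule)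
      (coordSubmodule e p.2.toSubmodule) :=
    Submodule.map_comap_eq_of_surjective (splitCoord u e R).surjective _
  have h1 := comap_inl_reconstruct (G := formOver R G) hℓ hH
  have h2 := map_snd_reconstruct hℓ hH hs
  rw [← hN] at h1 h2
  have hH' : IsPlane ((splitSubmodule u e N).map (LinearMap.snd R _ _)) := by rw [h2]; exact hH
  obtain ⟨hp, hr⟩ := projective_of_comap_inl hH'
    (by rw [h1]; exact projective_coordSubmodule u p.1)
    (by rw [h1]; exact rankAtStalk_coordSubmodule u p.1)
  let Λ : (Gr W 3).obj R := show Grassmannian R (R ⊗[ℂ] W) 3 from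
    { toSubmodule := N
      finite_quotient := Module.Finite.equiv (splitQuotientEquiv u e N).symm
      projective_quotient := Module.Projective.of_equiv (splitQuotientEquiv u e N).symm
      rankAtStalk_eq := fun q => by rw [rankAtStalk_eq_of_equiv (splitQuotientEquiv u e N), hr] }
  refine ⟨Λ, ⟨?_, ?_⟩, ?_⟩
  · refine hG.mem_schemeF_iff.2 ?_
    change InGraph _ (splitSubmodule u e N)
    rw [hN]
    exact inGraph_reconstruct hℓ hH hs
  -- If `Λ` became `U` over a field, then `H` would map to zero there, although its cross products
  -- generate the unit ideal.
  · intro K f hK hU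
    have h0 : ∀ b ∈ coordSubmodule e p.2.toSubmodule, f.hom ∘ b = 0 := by
      intro b hb
      rw [← h2] at hb
      obtain ⟨w, hw, rfl⟩ := hb
      have h3 := comp_mem_splitSubmodule_map u e f.hom Λ hw
      rw [mem_splitSubmodule] at h3
      have h4 : (splitCoord u e K).symm (f.hom ∘ w.1, f.hom ∘ w.2) ∈ U.baseChange K := hU ▸ h3
      rw [mem_baseChange_iff u e, LinearEquiv.apply_symm_apply] at h4
      exact h4
    have h5 : Ideal.span {r | ∃ a ∈ coordSubmodule e p.2.toSubmodule,
        ∃ b ∈ coordSubmodule e p.2.toSubmodule, ∃ i, r = (a ⨯₃ b) i} ≤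
          RingHom.ker f.hom.toRingHom := by
      rw [Ideal.span_le]
      rintro _ ⟨a, ha, b, hb, i, rfl⟩
      change (f.hom ∘ (a ⨯₃ b)) i = 0
      rw [comp_cross, h0 a ha]
      simp
    rw [hH.span_eq_top] at h5
    have h6 : f.hom 1 = 0 := h5 (Submodule.mem_top (x := (1 : R)))
    rw [map_one] at h6
    have := hK.nontrivial
    exact one_ne_zero h6
  · exact (isProjection_iff u e).2 ⟨h1, h2⟩

theorem ι_mul_mem_baseChange_filt (u : Basis (Fin 3) ℂ U) (e : Basis (Fin 3) ℂ (W ⧸ U)) (s₀ : R)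
    (s : Fin 3 → Fin 3 → R) :
    trivector (uVecR u) (eVecR e) s₀ s (0 : Fin 3 → Fin 3 → R) (0 : R) ∈ (filt U 2).baseChange R := by
  have hp : ∀ i, uVec u i ∈ U.map (ExteriorAlgebra.ι ℂ) := fun i => ⟨u i, (u i).2, rfl⟩
  have hr : ∀ w : W, ExteriorAlgebra.ι ℂ w ∈ ⋀[ℂ]^(3 - 2) W := fun w => by
    rw [ExteriorAlgebra.exteriorPower, pow_one]; exact ⟨w, rfl⟩
  have hmem : ∀ (i j : Fin 3) (w : W), uVec u i * uVec u j * ExteriorAlgebra.ι ℂ w ∈ filt U 2 := by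
    intro i j w
    rw [filt, pow_two]
    exact Submodule.mul_mem_mul (Submodule.mul_mem_mul (hp i) (hp j)) (hr w)
  simp only [trivector, Pi.zero_apply, zero_smul, Finset.sum_const_zero, add_zero, uVecR, eVecR,
    Algebra.TensorProduct.tmul_mul_tmul, mul_one]
  exact add_mem (Submodule.smul_mem _ _ (Submodule.tmul_mem_baseChange_of_mem _ (hmem _ _ _)))
    (Submodule.sum_mem _ fun _ _ => Submodule.sum_mem _ fun _ _ => Submodule.smul_mem _ _
      (Submodule.tmul_mem_baseChange_of_mem _ (hmem _ _ _)))

/-- Modulo the image of `⋀² U ⊗ W`, only the component in `U ⊗ ⋀² E` matters. -/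
theorem trivector_mem_of_trivector_mem (u : Basis (Fin 3) ℂ U) (e : Basis (Fin 3) ℂ (W ⧸ U))
    {P : Submodule R (R ⊗[ℂ] ExteriorAlgebra ℂ W)} (hP : (filt U 2).baseChange R ≤ P)
    {s₀ s₀' : R} {s s' t : Fin 3 → Fin 3 → R}
    (h : trivector (uVecR (R := R) u) (eVecR (R := R) e) s₀' s' t (0 : R) ∈ P) :
    trivector (uVecR (R := R) u) (eVecR (R := R) e) s₀ s t (0 : R) ∈ P := by
  have : trivector (uVecR (R := R) u) (eVecR (R := R) e) s₀ s t (0 : R) =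
      trivector (uVecR (R := R) u) (eVecR (R := R) e) (s₀ - s₀') (s - s')
          (0 : Fin 3 → Fin 3 → R) (0 : R) +
        trivector (uVecR (R := R) u) (eVecR (R := R) e) s₀' s' t (0 : R) := by
    simp only [trivector, Pi.sub_apply, Pi.zero_apply, zero_smul, sub_smul, Finset.sum_sub_distrib,
      Finset.sum_const_zero]
    abel
  rw [this]
  exact add_mem (hP (ι_mul_mem_baseChange_filt u e _ _)) h

/-- One inclusion holds after multiplication by each `(b × b') n`, by `InGraph.exists_mem_mul_mix`.
For the other, vectors over `H` are replaced by elements of `Λ` with the same image, which does not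
change the component in `U ⊗ ⋀² E`. -/
theorem IsGraphOf.isTangentialProjection (hG : IsGraphOf u e A G) {Λ : (Gr W 3).obj R}
    (hΛ : Λ ∈ (schemeF A).obj R) {p : (planeProd U).obj R} (h : IsProjection Λ p) :
    IsTangentialProjection Λ p := by
  have hH := isPlane_coordSubmodule e p.2
  have h12 := (isProjection_iff u e).1 h
  have hL := hG.mem_schemeF_iff.1 hΛ
  have hpair : ∀ z₁ ∈ p.1.toSubmodule, ∀ z₂ ∈ p.2.toSubmodule.comap (U.mkQ.baseChange R),
      ∀ z₃ ∈ p.2.toSubmodule.comap (U.mkQ.baseChange R),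
      (ExteriorAlgebra.ι ℂ).baseChange R (U.subtype.baseChange R z₁) *
        (ExteriorAlgebra.ι ℂ).baseChange R z₂ * (ExteriorAlgebra.ι ℂ).baseChange R z₃ ∈
      wedgePow R 1 (p.1.toSubmodule.map (U.subtype.baseChange R)) *
      wedgePow R 2 (p.2.toSubmodule.comap (U.mkQ.baseChange R)) := by
    intro z₁ h₁ z₂ h₂ z₃ h₃
    rw [mul_assoc, wedgePow, wedgePow, pow_one, pow_two]
    exact Submodule.mul_mem_mul ⟨_, ⟨_, h₁, rfl⟩, rfl⟩
      (Submodule.mul_mem_mul ⟨_, h₂, rfl⟩ ⟨_, h₃, rfl⟩)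
  apply le_antisymm
  · refine sup_le ?_ le_sup_right
    rw [wedgePow_three_le_iff]
    intro z₁ h₁ z₂ h₂ z₃ h₃
    apply Submodule.mem_of_span_top_of_smul_mem _ _ hH.span_eq_top
    rintro ⟨_, b, hb, b', hb', n, rfl⟩
    obtain ⟨x, hx, hxm⟩ := hL.exists_mem_mul_mix h12.1 h12.2 hH ((splitCoord_mem u e).2 h₁)
      ((splitCoord_mem u e).2 h₂) ((splitCoord_mem u e).2 h₃) hb hb' n
    have hlift : ∀ b ∈ coordSubmodule e p.2.toSubmodule, (splitCoord u e R).symm (0, b) ∈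
        p.2.toSubmodule.comap (U.mkQ.baseChange R) := by
      intro b hb
      rw [Submodule.mem_comap, mkQ_splitCoord_symm, ← mem_coordSubmodule]
      exact hb
    have h4 := hpair _ ((mem_coordSubmodule u).1 hx) _ (hlift b hb) _ (hlift b' hb')
    have h5 := (hL _ ((splitCoord_mem u e).2 h₁) _ ((splitCoord_mem u e).2 h₂) _
      ((splitCoord_mem u e).2 h₃)).1
    rw [ι_mul_mul_eq_trivector u e] at h4 ⊢
    rw [h5]
    simp only [subtype_tensorCoord_symm u e, LinearEquiv.apply_symm_apply, zero_dotProduct] at h4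
    have h6 : mix x 0 0 b 0 b' = fun i j => x i * (b ⨯₃ b') j := by
      ext i j; exact mix_zero_right ..
    rw [h6] at h4
    have h7 : ∀ (s₀ : R) (s t : Fin 3 → Fin 3 → R), (b ⨯₃ b') n • trivector (uVecR (R := R) u) (eVecR (R := R) e) s₀ s t
        (0 : R) = trivector (uVecR (R := R) u) (eVecR (R := R) e) ((b ⨯₃ b') n * s₀) (fun k l => (b ⨯₃ b') n * s k l)
          (fun k l => (b ⨯₃ b') n * t k l) (0 : R) := by
      intro s₀ s t
      simp only [trivector, smul_add, Finset.smul_sum, smul_smul, zero_smul, smul_zero]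
    simp only
    rw [h7]
    simp only [hxm]
    exact trivector_mem_of_trivector_mem u e le_sup_right (Submodule.mem_sup_left h4)
  · refine sup_le ?_ le_sup_right
    rw [wedgePow, wedgePow, pow_one, pow_two, Submodule.mul_le]
    rintro _ ⟨_, ⟨z₁, h₁, rfl⟩, rfl⟩ n hn
    induction hn using Submodule.mul_induction_on' with
    | add x _ y _ hx hy => rw [mul_add]; exact add_mem hx hy
    | mem_mul_mem x hx y hy =>
      obtain ⟨z₂, h₂, rfl⟩ := hx
      obtain ⟨z₃, h₃, rfl⟩ := hy
      have hlift : ∀ z ∈ p.2.toSubmodule.comap (U.mkQ.baseChange R), ∃ w ∈ Λ.toSubmodule,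
          (splitCoord u e R w).2 = (splitCoord u e R z).2 := by
        intro z hz
        rw [Submodule.mem_comap, h.2] at hz
        obtain ⟨w, hw, hwz⟩ := hz
        refine ⟨w, hw, ?_⟩
        rw [← tensorCoord_mkQ u e, ← tensorCoord_mkQ u e, hwz]
      obtain ⟨w₂, hw₂, e₂⟩ := hlift z₂ h₂
      obtain ⟨w₃, hw₃, e₃⟩ := hlift z₃ h₃
      have hw₁ : U.subtype.baseChange R z₁ ∈ Λ.toSubmodule := by
        rw [h.1] at h₁
        exact h₁
      have h4 := wedgePow_three_le_iff.1 le_rfl _ hw₁ _ hw₂ _ hw₃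
      rw [← mul_assoc]
      rw [ι_mul_mul_eq_trivector u e] at h4 ⊢
      rw [splitCoord_subtype u e, e₂, e₃] at h4
      rw [splitCoord_subtype u e]
      simp only [zero_dotProduct] at h4 ⊢
      have h6 : ∀ x a b a' b' : Fin 3 → R, mix x 0 a b a' b' = fun i j => x i * (b ⨯₃ b') j := by
        intro x a b a' b'
        ext i j; exact mix_zero_right ..
      rw [h6] at h4 ⊢
      exact trivector_mem_of_trivector_mem u e le_sup_right (Submodule.mem_sup_left h4)

end Projection

/-! ### The tangent space of `F_A` at `u` -/

section Tangent

variable {W : Type v} [AddCommGroup W] [Module ℂ W] {U : Submodule ℂ W}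
variable (u : Basis (Fin 3) ℂ U) (e : Basis (Fin 3) ℂ (W ⧸ U))
variable {R : Type} [CommRing R] [Algebra ℂ R] {A : Submodule ℂ (ExteriorAlgebra ℂ W)}

theorem trivectorR_eq_smul_add_smul (s₀ r : R) (s : Fin 3 → Fin 3 → ℂ) :
    trivector (uVecR (R := R) u) (eVecR (R := R) e) s₀ (fun k l => r * algebraMap ℂ R (s k l))
        (0 : Fin 3 → Fin 3 → R) (0 : R) =
      s₀ • (1 : R) ⊗ₜ[ℂ] (uVec u 0 * uVec u 1 * uVec u 2) + r • (1 : R) ⊗ₜ[ℂ]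
        trivector (uVec u) (eVec e) (0 : ℂ) s (0 : Fin 3 → Fin 3 → ℂ) (0 : ℂ) := by
  simp only [trivector, uVecR, eVecR, Algebra.TensorProduct.tmul_mul_tmul, mul_one, Pi.zero_apply,
    zero_smul, Finset.sum_const_zero, add_zero, zero_add, TensorProduct.tmul_sum, Finset.smul_sum,
    TensorProduct.tmul_smul, mul_smul, algebraMap_smul]

/-- The graph of the homomorphism with matrix `ε M`. -/
def graphEps (M : Matrix (Fin 3) (Fin 3) (DualNumber ℂ)) :
    (Fin 3 → DualNumber ℂ) × (Fin 3 → DualNumber ℂ) →ₗ[DualNumber ℂ] Fin 3 → DualNumber ℂ :=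
  LinearMap.snd _ _ _ - (DualNumber.eps : DualNumber ℂ) • (M.mulVecLin ∘ₗ LinearMap.fst _ _ _)

theorem mem_ker_graphEps {M : Matrix (Fin 3) (Fin 3) (DualNumber ℂ)}
    {w : (Fin 3 → DualNumber ℂ) × (Fin 3 → DualNumber ℂ)} :
    w ∈ LinearMap.ker (graphEps M) ↔ w.2 = (DualNumber.eps : DualNumber ℂ) • (M *ᵥ w.1) := by
  rw [LinearMap.mem_ker, graphEps, LinearMap.sub_apply, sub_eq_zero]
  rfl

theorem graphEps_surjective (M : Matrix (Fin 3) (Fin 3) (DualNumber ℂ)) :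
    Function.Surjective (graphEps M) := fun b => ⟨(0, b), by simp [graphEps]⟩

/-- The cyclic sum of `aᵢ ⊗ (aᵢ₊₁ × aᵢ₊₂)` is the determinant times the identity. This is the
identification of `Hom (U, E)` with `⋀² U ⊗ E`, tensored with `⋀³ U`. -/
theorem mix_smul_mulVec {R : Type*} [CommRing R] (c : R) (M : Matrix (Fin 3) (Fin 3) R)
    (a₁ a₂ a₃ : Fin 3 → R) (l k : Fin 3) :
    mix (c • (M *ᵥ a₁)) a₁ (c • (M *ᵥ a₂)) a₂ (c • (M *ᵥ a₃)) a₃ l k =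
      c * (a₁ ⬝ᵥ a₂ ⨯₃ a₃) * M l k := by
  fin_cases k <;>
  · simp [mix, cross_apply, Matrix.mulVec, dotProduct, Fin.sum_univ_three]
    ring

theorem eps_smul_cross_eps_smul (a b : Fin 3 → DualNumber ℂ) :
    ((DualNumber.eps : DualNumber ℂ) • a) ⨯₃ ((DualNumber.eps : DualNumber ℂ) • b) = 0 := by
  rw [map_smul, map_smul, LinearMap.smul_apply, smul_smul, DualNumber.eps_mul_eps, zero_smul]

/-- The point of the Grassmannian over the dual numbers given by a homomorphism `U → W / U`. -/
def deformation (M : Matrix (Fin 3) (Fin 3) (DualNumber ℂ)) :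
    Grassmannian (DualNumber ℂ) (DualNumber ℂ ⊗[ℂ] W) 3 :=
  let E := (graphEps M ∘ₗ (splitCoord u e (DualNumber ℂ)).toLinearMap).quotKerEquivOfSurjective
    ((graphEps_surjective M).comp (splitCoord u e _).surjective)
  { toSubmodule := LinearMap.ker (graphEps M ∘ₗ (splitCoord u e (DualNumber ℂ)).toLinearMap)
    finite_quotient := Module.Finite.equiv E.symm
    projective_quotient := Module.Projective.of_equiv E.symm
    rankAtStalk_eq := fun p => by
      rw [rankAtStalk_eq_of_equiv E, rankAtStalk_eq_finrank_of_free, finrank_fin_fun]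
      rfl }

theorem mem_deformation {M : Matrix (Fin 3) (Fin 3) (DualNumber ℂ)} {z : DualNumber ℂ ⊗[ℂ] W} :
    z ∈ (deformation u e M).toSubmodule ↔ (splitCoord u e (DualNumber ℂ) z).2 =
      (DualNumber.eps : DualNumber ℂ) • (M *ᵥ (splitCoord u e (DualNumber ℂ) z).1) :=
  mem_ker_graphEps

theorem map_fst_deformation (M : Matrix (Fin 3) (Fin 3) (DualNumber ℂ)) :
    (Grassmannian.map (TrivSqZeroExt.fstHom ℂ ℂ ℂ) (deformation u e M)).toSubmodule =
      U.baseChange ℂ := by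
  ext z
  rw [mem_baseChange_iff u e, ← splitCoord_mem u e, splitSubmodule_map]
  constructor
  · intro h
    have hle : Submodule.span ℂ ((fun w => (TrivSqZeroExt.fstHom ℂ ℂ ℂ ∘ w.1,
        TrivSqZeroExt.fstHom ℂ ℂ ℂ ∘ w.2)) '' (splitSubmodule u e
          (deformation u e M).toSubmodule : Set ((Fin 3 → DualNumber ℂ) × (Fin 3 → DualNumber ℂ))))
        ≤ LinearMap.ker (LinearMap.snd ℂ (Fin 3 → ℂ) (Fin 3 → ℂ)) := by
      rw [Submodule.span_le]
      rintro _ ⟨_, ⟨w, hw, rfl⟩, rfl⟩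
      ext i
      have h1 := congrFun ((mem_deformation u e).1 hw) i
      change TrivSqZeroExt.fst ((splitCoord u e (DualNumber ℂ) w).2 i) = 0
      rw [h1, Pi.smul_apply, smul_eq_mul, TrivSqZeroExt.fst_mul, DualNumber.fst_eps, zero_mul]
    exact hle h
  · intro h
    let a : Fin 3 → DualNumber ℂ := fun i => TrivSqZeroExt.inl ((splitCoord u e ℂ z).1 i)
    refine Submodule.subset_span ⟨(a, (DualNumber.eps : DualNumber ℂ) • (M *ᵥ a)), ?_, Prod.ext ?_ ?_⟩
    · rw [SetLike.mem_coe, mem_splitSubmodule, mem_deformation, LinearEquiv.apply_symm_apply]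
    · ext i
      simp [a]
    · rw [h]
      ext i
      simp

/-- An element of `A` in `⋀² U ⊗ E` defines a homomorphism whose graph over the dual numbers is a
deformation of `u` inside `F_A`; it must be constant. -/
theorem TangentZeroAt.isTransversal (hsm : TangentZeroAt A U)
    (huA : U.map (ExteriorAlgebra.ι ℂ) ^ 3 ≤ A) : IsTransversal u e A := by
  intro s hs
  -- Transposed: column `k` holds the `E`-coordinates of the image of `u k`.
  let M : Matrix (Fin 3) (Fin 3) (DualNumber ℂ) := fun l k => algebraMap ℂ (DualNumber ℂ) (s k l)
  have h1 := hsm (deformation u e M) ?_ (map_fst_deformation u e M)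
  · ext k l
    let a : Fin 3 → DualNumber ℂ := Pi.single k 1
    have h2 : (splitCoord u e (DualNumber ℂ)).symm (a, (DualNumber.eps : DualNumber ℂ) • (M *ᵥ a)) ∈
        U.baseChange (DualNumber ℂ) := by
      rw [← h1, mem_deformation, LinearEquiv.apply_symm_apply]
    rw [mem_baseChange_iff u e, LinearEquiv.apply_symm_apply] at h2
    have h3 := congrArg TrivSqZeroExt.snd (congrFun h2 l)
    rw [show M *ᵥ a = fun l => M l k from Matrix.mulVec_single_one M k] at h3
    simpa [M, TrivSqZeroExt.algebraMap_eq_inl] using h3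
  · change wedgePow (DualNumber ℂ) 3 (deformation u e M).toSubmodule ≤ _
    rw [wedgePow_three_le_iff]
    intro z₁ h₁ z₂ h₂ z₃ h₃
    rw [mem_deformation] at h₁ h₂ h₃
    -- Components with two or more factors in `E` contain `ε² = 0`.
    rw [ι_mul_mul_eq_trivector u e, h₁, h₂, h₃, eps_smul_cross_eps_smul, dotProduct_zero]
    have h4 : ∀ a₁ a₂ a₃ : Fin 3 → DualNumber ℂ, mix a₁ ((DualNumber.eps : DualNumber ℂ) • (M *ᵥ a₁)) a₂
        ((DualNumber.eps : DualNumber ℂ) • (M *ᵥ a₂)) a₃ ((DualNumber.eps : DualNumber ℂ) • (M *ᵥ a₃)) = 0 := by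
      intro a₁ a₂ a₃
      ext i j : 2
      simp only [mix, eps_smul_cross_eps_smul, Pi.zero_apply, mul_zero, add_zero]
    simp only [h4, mix_smul_mulVec]
    rw [trivectorR_eq_smul_add_smul]
    exact add_mem
      (Submodule.smul_mem _ _ (Submodule.tmul_mem_baseChange_of_mem _ (uTop_mem u huA)))
      (Submodule.smul_mem _ _ (Submodule.tmul_mem_baseChange_of_mem _ hs))

end Tangent

/-! ### First order deformations and partial derivatives -/

section Partials

open MvPolynomial

variable {S : Type} [CommRing S]

theorem addEps_mul (a b c d : S) : addEps a b * addEps c d = addEps (a * c) (a * d + b * c) := by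
  ext <;> simp [addEps, mul_comm b c]

theorem addEps_eq_zero_iff {a b : S} : addEps a b = 0 ↔ a = 0 ∧ b = 0 := by
  simp [addEps, TrivSqZeroExt.ext_iff]

variable [Algebra ℂ S]

/-- Taylor expansion to first order. -/
theorem aeval_addEps {σ : Type*} [Fintype σ] (f : MvPolynomial σ ℂ) (z v : σ → S) :
    aeval (fun i => addEps (z i) (v i)) f =
      addEps (aeval z f) (∑ i, v i * aeval z (pderiv i f)) := by
  classical
  induction f using MvPolynomial.induction_on with
  | C c =>
    simp [addEps, TrivSqZeroExt.algebraMap_eq_inl']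
  | add p q hp hq =>
    rw [map_add, hp, hq]
    simp only [addEps, map_add, mul_add, Finset.sum_add_distrib, TrivSqZeroExt.inl_add,
      TrivSqZeroExt.inr_add]
    abel
  | mul_X p k hp =>
    rw [map_mul, hp, aeval_X, addEps_mul, map_mul, aeval_X]
    congr 1
    simp only [Derivation.leibniz, pderiv_X, smul_eq_mul, map_add, map_mul, aeval_X, mul_add,
      Finset.sum_add_distrib, Finset.sum_mul]
    congr 1
    · rw [Finset.sum_eq_single k]
      · simp [mul_comm]
      · intro b _ hb
        simp [hb.symm]
      · simp
    · exact Finset.sum_congr rfl fun i _ => by ring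

/-- Deforming one coordinate gives one partial derivative. Conversely, Euler's relation recovers the
vanishing of `f` itself, as `n` is invertible in `ℂ`. -/
theorem aeval_addEps_eq_zero_iff {σ : Type*} [Fintype σ] {f : MvPolynomial σ ℂ} {n : ℕ}
    (hf : f.IsHomogeneous n) (hn : n ≠ 0) (z : σ → S) :
    (∀ v : σ → S, aeval (fun i => addEps (z i) (v i)) f = 0) ↔
      ∀ k, aeval z (pderiv k f) = 0 := by
  classical
  constructor
  · intro h k
    have h1 := h (Pi.single k 1)
    rw [aeval_addEps, addEps_eq_zero_iff] at h1
    have h2 := h1.2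
    rw [Finset.sum_eq_single k] at h2
    · simpa using h2
    · intro b _ hb
      simp [hb]
    · simp
  · intro h v
    rw [aeval_addEps, addEps_eq_zero_iff]
    refine ⟨?_, by simp [h]⟩
    have h1 := congrArg (aeval z) hf.sum_X_mul_pderiv
    simp only [map_sum, map_mul, h, mul_zero, Finset.sum_const_zero, map_nsmul] at h1
    have h2 : (n : ℂ) • aeval z f = 0 := by rw [Nat.cast_smul_eq_nsmul, ← h1]
    rw [← one_smul ℂ (aeval z f), ← inv_mul_cancel₀ (Nat.cast_ne_zero.2 hn : (n : ℂ) ≠ 0),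
      mul_smul, h2, smul_zero]

theorem sum_symm {R : Type*} [CommRing R] {G : Fin 3 → Fin 3 → Fin 3 → Fin 3 → R}
    (hsymm : ∀ i j k l, G i j k l = G k l i j) (t t' : Fin 3 → Fin 3 → R) :
    ∑ i, ∑ j, ∑ k, ∑ l, G i j k l * (t i j * t' k l) =
      ∑ i, ∑ j, ∑ k, ∑ l, G i j k l * (t' i j * t k l) := by
  calc _ = ∑ i, ∑ k, ∑ j, ∑ l, G i j k l * (t i j * t' k l) :=
        Finset.sum_congr rfl fun i _ => Finset.sum_comm
    _ = ∑ k, ∑ i, ∑ j, ∑ l, G i j k l * (t i j * t' k l) := Finset.sum_comm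
    _ = ∑ k, ∑ i, ∑ l, ∑ j, G i j k l * (t i j * t' k l) :=
        Finset.sum_congr rfl fun k _ => Finset.sum_congr rfl fun i _ => Finset.sum_comm
    _ = ∑ k, ∑ l, ∑ i, ∑ j, G i j k l * (t i j * t' k l) :=
        Finset.sum_congr rfl fun k _ => Finset.sum_comm
    _ = _ := Finset.sum_congr rfl fun k _ => Finset.sum_congr rfl fun l _ =>
        Finset.sum_congr rfl fun i _ => Finset.sum_congr rfl fun j _ => by
          rw [hsymm i j k l]; ring

theorem sum_eq_sum_contr {R : Type*} [CommRing R] (G : Fin 3 → Fin 3 → Fin 3 → Fin 3 → R)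
    (x y : Fin 3 → R) (t : Fin 3 → Fin 3 → R) :
    ∑ i, ∑ j, ∑ k, ∑ l, G i j k l * ((x i * y j) * t k l) =
      ∑ k, ∑ l, contr G x y k l * t k l := by
  calc _ = ∑ i, ∑ k, ∑ j, ∑ l, G i j k l * ((x i * y j) * t k l) :=
        Finset.sum_congr rfl fun i _ => Finset.sum_comm
    _ = ∑ k, ∑ i, ∑ j, ∑ l, G i j k l * ((x i * y j) * t k l) := Finset.sum_comm
    _ = ∑ k, ∑ i, ∑ l, ∑ j, G i j k l * ((x i * y j) * t k l) :=
        Finset.sum_congr rfl fun k _ => Finset.sum_congr rfl fun i _ => Finset.sum_comm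
    _ = ∑ k, ∑ l, ∑ i, ∑ j, G i j k l * ((x i * y j) * t k l) :=
        Finset.sum_congr rfl fun k _ => Finset.sum_comm
    _ = _ := by simp only [contr, Finset.sum_mul, mul_assoc]

/-- The biquadratic form attached to `G`. -/
def biquadratic (κ : ℂ) (G : Fin 3 → Fin 3 → Fin 3 → Fin 3 → ℂ) :
    MvPolynomial (Fin 3 ⊕ Fin 3) ℂ :=
  ∑ i, ∑ j, ∑ k, ∑ l, C (G i j k l * κ) *
    (X (Sum.inl i) * X (Sum.inr j) * (X (Sum.inl k) * X (Sum.inr l)))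

variable {κ : ℂ} {G : Fin 3 → Fin 3 → Fin 3 → Fin 3 → ℂ}

/-- By the product rule each of the two arguments `x ⊗ y` is differentiated once; symmetry of `G`
makes the contributions equal, whence the factor `2`. -/
theorem aeval_pderiv_biquadratic (hsymm : ∀ i j k l, G i j k l = G k l i j) (x y : Fin 3 → S)
    (m : Fin 3 ⊕ Fin 3) :
    aeval (Sum.elim x y) (pderiv m (biquadratic κ G)) = (2 * κ) •
      ∑ k, ∑ l, contr (formOver S G) x y k l *
        (x k * (Pi.single m 1 : Fin 3 ⊕ Fin 3 → S) (Sum.inr l) +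
          y l * (Pi.single m 1 : Fin 3 ⊕ Fin 3 → S) (Sum.inl k)) := by
  have h1 : ∀ n' : Fin 3 ⊕ Fin 3, aeval (Sum.elim x y) (pderiv m (X n' : MvPolynomial _ ℂ)) =
      (Pi.single m 1 : Fin 3 ⊕ Fin 3 → S) n' := by
    intro n'
    rw [pderiv_X, Pi.single_apply, Pi.single_apply]
    simp only [eq_comm]
    split_ifs <;> simp
  have hsymm' : ∀ i j k l, formOver S G i j k l = formOver S G k l i j := fun i j k l => by
    rw [formOver, formOver, hsymm]
  have h2 := sum_symm hsymm' (fun k l => x k * (Pi.single m 1 : Fin 3 ⊕ Fin 3 → S) (Sum.inr l) +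
          y l * (Pi.single m 1 : Fin 3 ⊕ Fin 3 → S) (Sum.inl k)) (fun i j => x i * y j)
  have h3 := sum_eq_sum_contr (formOver S G) x y
    (fun k l => x k * (Pi.single m 1 : Fin 3 ⊕ Fin 3 → S) (Sum.inr l) +
          y l * (Pi.single m 1 : Fin 3 ⊕ Fin 3 → S) (Sum.inl k))
  rw [← h3, Algebra.smul_def, map_mul, map_ofNat, mul_right_comm, two_mul]
  nth_rw 1 [← h2]
  rw [← Finset.sum_add_distrib, Finset.sum_mul, biquadratic]
  simp only [← Finset.sum_add_distrib, Finset.sum_mul, map_sum]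
  refine Finset.sum_congr rfl fun i _ => Finset.sum_congr rfl fun j _ =>
    Finset.sum_congr rfl fun k _ => Finset.sum_congr rfl fun l _ => ?_
  simp only [Derivation.leibniz, pderiv_C, smul_eq_mul, mul_zero, add_zero, map_mul, map_add,
    h1, aeval_X, aeval_C, Sum.elim_inl, Sum.elim_inr, formOver]
  ring

/-- The partial derivatives of the biquadratic form vanish at `(x, y)`. -/
def SingularAt (G : Fin 3 → Fin 3 → Fin 3 → Fin 3 → S) (x y : Fin 3 → S) : Prop :=
  (∀ l, (fun k => contr G x y k l) ⬝ᵥ x = 0) ∧ ∀ k, contr G x y k ⬝ᵥ y = 0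

theorem singularAt_iff (hκ : κ ≠ 0) (hsymm : ∀ i j k l, G i j k l = G k l i j) (x y : Fin 3 → S) :
    SingularAt (formOver S G) x y ↔
      ∀ m, aeval (Sum.elim x y) (pderiv m (biquadratic κ G)) = 0 := by
  have hc : ∀ s : S, (2 * κ) • s = 0 ↔ s = 0 := by
    intro s
    constructor
    · intro h
      rw [← one_smul ℂ s, ← inv_mul_cancel₀ (mul_ne_zero two_ne_zero hκ), mul_smul, h, smul_zero]
    · rintro rfl
      rw [smul_zero]
  simp only [aeval_pderiv_biquadratic hsymm, hc, Sum.forall, SingularAt, dotProduct]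
  rw [and_comm]
  simp [Pi.single_apply]

theorem isHomogeneous_biquadratic : (biquadratic κ G).IsHomogeneous 4 := by
  refine IsHomogeneous.sum _ _ _ fun i _ => IsHomogeneous.sum _ _ _ fun j _ =>
    IsHomogeneous.sum _ _ _ fun k _ => IsHomogeneous.sum _ _ _ fun l _ => ?_
  exact (isHomogeneous_C _ _).mul (((isHomogeneous_X _ _).mul (isHomogeneous_X _ _)).mul
    ((isHomogeneous_X _ _).mul (isHomogeneous_X _ _)))

theorem isBihomogeneous_biquadratic : IsBihomogeneous (biquadratic κ G) (2, 2) := by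
  refine IsWeightedHomogeneous.sum _ _ _ fun i _ => IsWeightedHomogeneous.sum _ _ _ fun j _ =>
    IsWeightedHomogeneous.sum _ _ _ fun k _ => IsWeightedHomogeneous.sum _ _ _ fun l _ => ?_
  exact (isWeightedHomogeneous_C _ _).mul
    (((isWeightedHomogeneous_X _ _ _).mul (isWeightedHomogeneous_X _ _ _)).mul
      ((isWeightedHomogeneous_X _ _ _).mul (isWeightedHomogeneous_X _ _ _)))

end Partials

/-! ### Homogeneous coordinates and the singular scheme -/

section Coord

variable {W : Type v} [AddCommGroup W] [Module ℂ W] {U : Submodule ℂ W}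
variable {u : Basis (Fin 3) ℂ U} {e : Basis (Fin 3) ℂ (W ⧸ U)}

theorem coordSubmodule_span_singleton {V : Type v} [AddCommGroup V] [Module ℂ V]
    {R : Type} [CommRing R] [Algebra ℂ R] (c : Basis (Fin 3) ℂ V) (x : Fin 3 → R) :
    coordSubmodule c (Submodule.span R {∑ i, x i ⊗ₜ[ℂ] c i}) = Submodule.span R {x} := by
  rw [coordSubmodule, Submodule.map_span, Set.image_singleton, ← tensorCoord_symm_apply,
    LinearEquiv.coe_coe, LinearEquiv.apply_symm_apply]

theorem mem_coordSubmodule_ker {V : Type v} [AddCommGroup V] [Module ℂ V]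
    {R : Type} [CommRing R] [Algebra ℂ R] (c : Basis (Fin 3) ℂ V) (y a : Fin 3 → R) :
    a ∈ coordSubmodule c (LinearMap.ker ((c.baseChange R).constr R y)) ↔ a ⬝ᵥ y = 0 := by
  rw [mem_coordSubmodule, LinearMap.mem_ker, Basis.constr_apply_fintype]
  change ∑ i, (tensorCoord c R) ((tensorCoord c R).symm a) i • y i = 0 ↔ _
  rw [LinearEquiv.apply_symm_apply]
  rfl

theorem isCoord_iff {R : CommAlgCat.{0} ℂ} {p : (planeProd U).obj R} {x y : Fin 3 → R} :
    IsCoord u e p x y ↔ coordSubmodule u p.1.toSubmodule = Submodule.span R {x} ∧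
      (∃ η, y ⬝ᵥ η = 1) ∧ ∀ a, a ∈ coordSubmodule e p.2.toSubmodule ↔ a ⬝ᵥ y = 0 := by
  rw [IsCoord, ← coordSubmodule_span_singleton u, (coordSubmodule_injective u).eq_iff,
    ← (coordSubmodule_injective e).eq_iff, SetLike.ext_iff (p := coordSubmodule e _)]
  simp only [mem_coordSubmodule_ker]
  rw [Ideal.eq_top_iff_one, Ideal.mem_span_range_iff_exists_fun]
  simp only [dotProduct, mul_comm]

theorem exists_isCoord {R : CommAlgCat.{0} ℂ} [IsLocalRing R] (p : (planeProd U).obj R) :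
    ∃ x y, IsCoord u e p x y := by
  obtain ⟨x, -, -, hx⟩ := exists_line_coord u p.1
  obtain ⟨y, η, hη, hy⟩ := exists_plane_coord e p.2
  exact ⟨x, y, isCoord_iff.2 ⟨hx, ⟨η, hη⟩, hy⟩⟩

theorem forall_sum_elim {f : MvPolynomial (Fin 3 ⊕ Fin 3) ℂ} {S : Type} [CommRing S] [Algebra ℂ S]
    {x y : Fin 3 → S} :
    (∀ v w : Fin 3 → S, MvPolynomial.aeval
        (Sum.elim (fun i => addEps (x i) (v i)) fun j => addEps (y j) (w j)) f = 0) ↔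
      ∀ v : Fin 3 ⊕ Fin 3 → S,
        MvPolynomial.aeval (fun i => addEps (Sum.elim x y i) (v i)) f = 0 := by
  have h : ∀ v w : Fin 3 → S,
      (fun i => addEps (Sum.elim x y i) (Sum.elim v w i)) =
        Sum.elim (fun i => addEps (x i) (v i)) fun j => addEps (y j) (w j) := by
    intro v w
    ext i : 1
    cases i <;> rfl
  constructor
  · intro H v
    rw [← Sum.elim_comp_inl_inr v, h]
    exact H _ _
  · intro H v w
    rw [← h]
    exact H _

theorem singScheme_eq_zeroScheme {f : MvPolynomial (Fin 3 ⊕ Fin 3) ℂ} {n : ℕ}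
    (hf : f.IsHomogeneous n) (hn : n ≠ 0) :
    singScheme u e f = zeroScheme u e (Set.range fun k => MvPolynomial.pderiv k f) := by
  ext R p
  refine forall₅_congr fun S h x y _ => ?_
  rw [forall_sum_elim, aeval_addEps_eq_zero_iff hf hn, Set.forall_mem_range]

variable {κ : ℂ} {G : Fin 3 → Fin 3 → Fin 3 → Fin 3 → ℂ}

theorem mem_singScheme_iff (hκ : κ ≠ 0) (hsymm : ∀ i j k l, G i j k l = G k l i j)
    {R : CommAlgCat.{0} ℂ} {p : (planeProd U).obj R} :
    p ∈ (singScheme u e (biquadratic κ G)).obj R ↔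
      ∀ (S : CommAlgCat.{0} ℂ) (h : R ⟶ S) (x y : Fin 3 → S),
        IsCoord u e ((planeProd U).map h p) x y → SingularAt (formOver S G) x y := by
  rw [singScheme_eq_zeroScheme isHomogeneous_biquadratic four_ne_zero]
  refine forall₅_congr fun S h x y _ => ?_
  rw [Set.forall_mem_range, singularAt_iff hκ hsymm]

theorem map_contr {R S : Type} [CommRing R] [Algebra ℂ R] [CommRing S] [Algebra ℂ S]
    (f : R →ₐ[ℂ] S) (x y : Fin 3 → R) (k l : Fin 3) :
    f (contr (formOver R G) x y k l) = contr (formOver S G) (f ∘ x) (f ∘ y) k l := by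
  simp [contr, formOver]

/-- The required identities can be tested over local algebras. There coordinates exist, elements of
`ℓ` are multiples of `x`, cross products from `H` are multiples of `y`, and the identities become
multiples of `SingularAt`. -/
theorem isSingular_of_mem_singScheme (hκ : κ ≠ 0) (hsymm : ∀ i j k l, G i j k l = G k l i j)
    {R : CommAlgCat.{0} ℂ} {p : (planeProd U).obj R}
    (hp : p ∈ (singScheme u e (biquadratic κ G)).obj R) :
    IsSingular (formOver R G) (coordSubmodule u p.1.toSubmodule)
      (coordSubmodule e p.2.toSubmodule) := by
  rw [mem_singScheme_iff hκ hsymm] at hp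
  have key : ∀ (S : Type) [CommRing S] [Algebra ℂ S] [IsLocalRing S] (f : R →ₐ[ℂ] S),
      ∃ x y : Fin 3 → S, SingularAt (formOver S G) x y ∧
        (∀ a ∈ coordSubmodule u p.1.toSubmodule, ∃ r : S, f ∘ a = r • x) ∧
        ∀ a ∈ coordSubmodule e p.2.toSubmodule, ∀ b ∈ coordSubmodule e p.2.toSubmodule,
          ∃ r : S, (f ∘ a) ⨯₃ (f ∘ b) = r • y := by
    intro S _ _ _ f
    let T : CommAlgCat.{0} ℂ := CommAlgCat.of ℂ S
    have : IsLocalRing T := inferInstanceAs (IsLocalRing S)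
    obtain ⟨x, y, hxy⟩ := exists_isCoord (u := u) (e := e)
      ((planeProd U).map (CommAlgCat.ofHom f : R ⟶ T) p)
    have hs : SingularAt (formOver T G) x y := hp T (CommAlgCat.ofHom f) x y hxy
    refine ⟨x, y, hs, ?_, ?_⟩
    · intro a ha
      have h1 : f ∘ a ∈ coordSubmodule u
          ((planeProd U).map (CommAlgCat.ofHom f : R ⟶ T) p).1.toSubmodule :=
        comp_mem_coordSubmodule_map u f p.1 ha
      rw [(isCoord_iff.1 hxy).1, Submodule.mem_span_singleton] at h1
      obtain ⟨r, hr⟩ := h1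
      exact ⟨r, hr.symm⟩
    · intro a ha b hb
      obtain ⟨-, ⟨η, hη⟩, h⟩ := isCoord_iff.1 hxy
      have h1 : ∀ a ∈ coordSubmodule e p.2.toSubmodule, f ∘ a ∈ coordSubmodule e
          ((planeProd U).map (CommAlgCat.ofHom f : R ⟶ T) p).2.toSubmodule :=
        fun a ha => comp_mem_coordSubmodule_map e f p.2 ha
      exact ⟨_, cross_eq_smul_of_dotProduct_eq_zero hη ((h _).1 (h1 a ha)) ((h _).1 (h1 b hb))⟩
  constructor
  · intro x hx x' hx' h hh h' hh' l
    apply eq_zero_of_local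
    intro S _ _ _ f
    obtain ⟨x₀, y₀, hs, hℓ, hH⟩ := key S f
    obtain ⟨r, hr⟩ := hℓ x hx
    obtain ⟨r', hr'⟩ := hℓ x' hx'
    obtain ⟨t, ht⟩ := hH h hh h' hh'
    rw [map_dotProduct', hr', dotProduct_smul]
    have h1 : (f ∘ fun k => contr (formOver R G) x (h ⨯₃ h') k l) =
        (r * t) • fun k => contr (formOver S G) x₀ y₀ k l := by
      ext k
      rw [Function.comp_apply, map_contr, comp_cross, hr, ht, contr_smul_left, contr_smul_right,
        Pi.smul_apply, smul_eq_mul, mul_assoc]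
    rw [h1, smul_dotProduct, hs.1, smul_zero, smul_zero]
  · intro x hx h hh h' hh' g hg g' hg' k
    apply eq_zero_of_local
    intro S _ _ _ f
    obtain ⟨x₀, y₀, hs, hℓ, hH⟩ := key S f
    obtain ⟨r, hr⟩ := hℓ x hx
    obtain ⟨t, ht⟩ := hH h hh h' hh'
    obtain ⟨t', ht'⟩ := hH g hg g' hg'
    rw [map_dotProduct', comp_cross, ht', dotProduct_smul]
    have h1 : (f ∘ contr (formOver R G) x (h ⨯₃ h') k) =
        (r * t) • contr (formOver S G) x₀ y₀ k := by
      ext l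
      rw [Function.comp_apply, map_contr, comp_cross, hr, ht, contr_smul_left, contr_smul_right,
        Pi.smul_apply, smul_eq_mul, mul_assoc]
    rw [h1, smul_dotProduct, hs.2, smul_zero, smul_zero]

theorem IsGraphOf.mem_singScheme {A : Submodule ℂ (ExteriorAlgebra ℂ W)} (hG : IsGraphOf u e A G)
    (hκ : κ ≠ 0) (hsymm : ∀ i j k l, G i j k l = G k l i j)
    {R : CommAlgCat.{0} ℂ} {Λ : (Gr W 3).obj R} (hΛ : Λ ∈ (schemeFMinus A U).obj R)
    {p : (planeProd U).obj R} (h : IsProjection Λ p) :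
    p ∈ (singScheme u e (biquadratic κ G)).obj R := by
  rw [mem_singScheme_iff hκ hsymm]
  intro S f x y hxy
  obtain ⟨hx, ⟨η, hη⟩, hy⟩ := isCoord_iff.1 hxy
  have h1 := (isProjection_iff u e).1 (hG.isProjection_map hΛ h f)
  have hL := hG.mem_schemeF_iff.1 ((schemeF A).map f hΛ.1)
  refine hL.contr_dotProduct hη ?_ ?_
  · have h2 : x ∈ coordSubmodule u ((planeProd U).map f p).1.toSubmodule := by
      rw [hx]
      exact Submodule.mem_span_singleton_self x
    rw [← h1.1] at h2
    exact h2
  · intro a ha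
    rw [← hy, ← h1.2] at ha
    obtain ⟨w, hw, rfl⟩ := ha
    exact ⟨w.1, hw⟩

end Coord

/-! ### The isomorphism and the nonvanishing of the form -/

section Isomorphism

variable {W : Type v} [AddCommGroup W] [Module ℂ W] {U : Submodule ℂ W}

/-- The points `(1 : t : 0)`, paired with one fixed hyperplane, are distinct. -/
theorem infinite_planeProd (u : Basis (Fin 3) ℂ U) (e : Basis (Fin 3) ℂ (W ⧸ U)) :
    Infinite ((planeProd U).obj (CommAlgCat.of ℂ ℂ)) := by
  let x : ℂ → Fin 3 → ℂ := fun t => ![1, t, 0]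
  let N : ℂ → Submodule ℂ (ℂ ⊗[ℂ] U) :=
    fun t => (Submodule.span ℂ {x t}).comap (tensorCoord u ℂ).toLinearMap
  have hN : ∀ t, coordSubmodule u (N t) = Submodule.span ℂ {x t} := fun t =>
    Submodule.map_comap_eq_of_surjective (tensorCoord u ℂ).surjective _
  have hr : ∀ t p, rankAtStalk (R := ℂ) ((Fin 3 → ℂ) ⧸ coordSubmodule u (N t)) p = 2 := by
    intro t p
    have hx : x t ≠ 0 := fun h => one_ne_zero (congrFun h 0)
    have h1 := Submodule.finrank_quotient_add_finrank (coordSubmodule u (N t))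
    rw [hN, finrank_span_singleton hx, finrank_fin_fun, ← hN] at h1
    rw [rankAtStalk_eq_finrank_of_free, Pi.natCast_apply, Nat.cast_id]
    omega
  let N' : Submodule ℂ (ℂ ⊗[ℂ] (W ⧸ U)) :=
    (LinearMap.ker (LinearMap.proj (R := ℂ) (φ := fun _ : Fin 3 => ℂ) 0)).comap
      (tensorCoord e ℂ).toLinearMap
  have hN' : coordSubmodule e N' =
      LinearMap.ker (LinearMap.proj (R := ℂ) (φ := fun _ : Fin 3 => ℂ) 0) :=
    Submodule.map_comap_eq_of_surjective (tensorCoord e ℂ).surjective _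
  have hr' : ∀ p, rankAtStalk (R := ℂ) ((Fin 3 → ℂ) ⧸ coordSubmodule e N') p = 1 := by
    intro p
    rw [hN', rankAtStalk_eq_of_equiv
      ((LinearMap.proj (R := ℂ) (φ := fun _ : Fin 3 => ℂ) 0).quotKerEquivOfSurjective
        (LinearMap.proj_surjective 0)), rankAtStalk_self]
    rfl
  let P : ℂ → (planeProd U).obj (CommAlgCat.of ℂ ℂ) := fun t =>
    (grassmannianOfCoord u (N t) 2 inferInstance (hr t),
      grassmannianOfCoord e N' 1 inferInstance hr')
  refine Infinite.of_injective P fun t s hts => ?_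
  have h1 : N t = N s := congrArg (fun p : (planeProd U).obj (CommAlgCat.of ℂ ℂ) =>
    p.1.toSubmodule) hts
  have h2 : x t ∈ Submodule.span ℂ {x s} := by
    rw [← hN, ← h1, hN]
    exact Submodule.mem_span_singleton_self _
  obtain ⟨r, hr⟩ := Submodule.mem_span_singleton.1 h2
  have h3 : r = 1 := by simpa [x] using congrFun hr 0
  have h4 : r * s = t := by simpa [x] using congrFun hr 1
  rw [← h4, h3, one_mul]

variable {u : Basis (Fin 3) ℂ U} {e : Basis (Fin 3) ℂ (W ⧸ U)}
variable {A : Submodule ℂ (ExteriorAlgebra ℂ W)}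
variable {κ : ℂ} {G : Fin 3 → Fin 3 → Fin 3 → Fin 3 → ℂ}

/-- The point `(Λ ∩ U, (Λ + U) / U)` of the singular scheme attached to a point `Λ` of
`F_A - {u}`. -/
def toSing (hG : IsGraphOf u e A G) (hκ : κ ≠ 0) (hsymm : ∀ i j k l, G i j k l = G k l i j)
    (R : CommAlgCat.{0} ℂ) (Λ : (schemeFMinus A U).toFunctor.obj R) :
    (singScheme u e (biquadratic κ G)).toFunctor.obj R :=
  ⟨(hG.exists_isProjection Λ.2).choose,
    hG.mem_singScheme hκ hsymm Λ.2 (hG.exists_isProjection Λ.2).choose_spec⟩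

variable (hG : IsGraphOf u e A G) (hκ : κ ≠ 0) (hsymm : ∀ i j k l, G i j k l = G k l i j)

theorem isProjection_toSing (R : CommAlgCat.{0} ℂ) (Λ : (schemeFMinus A U).toFunctor.obj R) :
    IsProjection Λ.1 (toSing hG hκ hsymm R Λ).1 :=
  (hG.exists_isProjection Λ.2).choose_spec

theorem toSing_bijective (R : CommAlgCat.{0} ℂ) :
    Function.Bijective (toSing hG hκ hsymm R) := by
  constructor
  · intro Λ Λ' h
    have h1 := isProjection_toSing hG hκ hsymm R Λ
    have h2 := isProjection_toSing hG hκ hsymm R Λ'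
    rw [h] at h1
    exact Subtype.ext (hG.injective Λ.2.1 Λ'.2.1 h1 h2)
  · intro p
    obtain ⟨Λ, hΛ, h⟩ := hG.surjective (isSingular_of_mem_singScheme hκ hsymm p.2)
    exact ⟨⟨Λ, hΛ⟩, Subtype.ext ((isProjection_toSing hG hκ hsymm R ⟨Λ, hΛ⟩).unique h)⟩

/-- The isomorphism between `F_A - {u}` and the singular scheme. -/
def singIso : (schemeFMinus A U).toFunctor ≅ (singScheme u e (biquadratic κ G)).toFunctor :=
  NatIso.ofComponents (fun R => (Equiv.ofBijective _ (toSing_bijective hG hκ hsymm R)).toIso) <| by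
    intro R S f
    ext Λ
    apply Subtype.ext
    exact (isProjection_toSing hG hκ hsymm S _).unique
      (hG.isProjection_map Λ.2 (isProjection_toSing hG hκ hsymm R Λ) f)

/-- For the zero form every point of `P_u × P_u^⊥` is singular, so the bijection would inject
infinitely many complex points into the finite `F_A`. -/
theorem biquadratic_ne_zero (hG : IsGraphOf u e A G) (hκ : κ ≠ 0)
    (hsymm : ∀ i j k l, G i j k l = G k l i j) (hfin : FiniteF A) : biquadratic κ G ≠ 0 := by
  intro h
  have := infinite_planeProd u e
  have hall : ∀ p : (planeProd U).obj (CommAlgCat.of ℂ ℂ),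
      p ∈ (singScheme u e (biquadratic κ G)).obj (CommAlgCat.of ℂ ℂ) := by
    intro p S f x y _ v w
    rw [h, map_zero]
  choose Λ hΛ using fun p => (toSing_bijective hG hκ hsymm (CommAlgCat.of ℂ ℂ)).2 ⟨p, hall p⟩
  have hinj : Function.Injective fun p => (⟨(Λ p).1, (Λ p).2.1⟩ :
      (schemeF A).obj (CommAlgCat.of ℂ ℂ)) := by
    intro p q hpq
    have h1 : Λ p = Λ q := by
      apply Subtype.ext
      simpa using hpq
    have h2 := hΛ p
    rw [h1, hΛ q] at h2
    exact congrArg Subtype.val h2.symm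
  have : Finite ((schemeF A).obj (CommAlgCat.of ℂ ℂ)) := hfin.to_subtype
  exact not_finite_iff_infinite.2 ‹Infinite _› (Finite.of_injective _ hinj)

end Isomorphism
end Morin

end

theorem mainTheorem2 {W : Type*} [AddCommGroup W] [Module ℂ W] (hW : Module.finrank ℂ W = 6)
    (U : Submodule ℂ W) (hU : Module.finrank ℂ U = 3)
    (A : Submodule ℂ (ExteriorAlgebra ℂ W)) (hA : Morin.IsLagrangian A)
    (huA : U.map (ExteriorAlgebra.ι ℂ) ^ 3 ≤ A)
    (hfin : Morin.FiniteF A) (hsm : Morin.TangentZeroAt A U)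
    (u : Module.Basis (Fin 3) ℂ U) (e : Module.Basis (Fin 3) ℂ (W ⧸ U))
    (vol : W [⋀^Fin 6]→ₗ[ℂ] ℂ) (hvol : vol ≠ 0) :
    Morin.verraForm u e A vol ≠ 0 ∧
    Morin.IsBihomogeneous (Morin.verraForm u e A vol) (2, 2) ∧
    Morin.singScheme u e (Morin.verraForm u e A vol) =
      Morin.zeroScheme u e
        (Set.range fun k => MvPolynomial.pderiv k (Morin.verraForm u e A vol)) ∧
    ∃ Φ : (Morin.schemeFMinus A U).toFunctor ≅
        (Morin.singScheme u e (Morin.verraForm u e A vol)).toFunctor,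
      ∀ (R : CommAlgCat.{0} ℂ) (Λ : (Morin.schemeFMinus A U).toFunctor.obj R),
        Morin.IsTangentialProjection Λ.1 (Φ.hom.app R Λ).1 := by

  let κ : ℂ := Morin.topForm vol (Morin.uVec u 0 * Morin.uVec u 1 * Morin.uVec u 2 *
    (Morin.eVec e 0 * Morin.eVec e 1 * Morin.eVec e 2))
  have hκ : κ ≠ 0 := Morin.topForm_ne_zero u e vol hvol
  have hT := hsm.isTransversal u e huA
  obtain ⟨c, G, hsymm, hG⟩ := Morin.exists_symmetric_form u e hA huA hT hvol
  have hf : Morin.verraForm u e A vol = Morin.biquadratic κ G :=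
    Morin.verraForm_eq u e hsymm fun i j => (hG i j).2
  have hgraph : Morin.IsGraphOf u e A G := fun R _ _ s₀ s t t₀ =>
    Morin.trivector_mem_baseChange_iff u e hA huA hvol hsymm hG s₀ s t t₀
  rw [hf]
  exact ⟨Morin.biquadratic_ne_zero hgraph hκ hsymm hfin, Morin.isBihomogeneous_biquadratic,
    Morin.singScheme_eq_zeroScheme Morin.isHomogeneous_biquadratic four_ne_zero,
    Morin.singIso hgraph hκ hsymm, fun R Λ =>
      hgraph.isTangentialProjection Λ.2.1 (Morin.isProjection_toSing hgraph hκ hsymm R Λ)⟩
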